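/- Let $n\ge 3$, let $T^n=\mathrm{SO}(2)^n$ be the usual (block-diagonal) maximal torus of $\mathrm{SO}(2n)$, and let $g_B$ be the standard metric on the full flag manifold $M=\mathrm{SO}(2n)/T^n$, i.e. the $\mathrm{SO}(2n)$-invariant metric given by $-B|_{\mathfrak p\times\mathfrak p}$, where $B$ is the Killing form of $\mathfrak g=\mathfrak{so}(2n)$ and $\mathfrak g=\mathfrak k\oplus\mathfrak p$ is the $B$-orthogonal decomposition, $\mathfrak k=\mathrm{Lie}(T^n)$; $\mathfrak p$ is the space of matrices in $\mathfrak{so}(2n)$ with vanishing diagonal $2\times2$ blocks. Notation, with $G=\mathrm{SO}(2n)$, $K=T^n$. $\mathrm{Sym}(\mathfrak p)^K$ is the space of $g_B$-symmetric $\mathrm{Ad}(K)$-equivariant endomorphisms $A$ of $\mathfrak p$, identified with the $G$-invariant symmetric 2-tensors $g_B(A\cdot,\cdot)$ on $M$ and endowed with the inner product $\operatorname{tr}AB$. $L_{\mathfrak p}$ is the operator on $\mathrm{Sym}(\mathfrak p)^K$ induced by the Lichnerowicz Laplacian $\Delta_L$: $\Delta_L\, g_B(A\cdot,\cdot)=g_B(L_{\mathfrak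 p}A\cdot,\cdot)$. $\mathcal{TT}^G$ is the space of $G$-invariant traceless divergence-free symmetric 2-tensors, and $\mathrm{scal}''$ is the second derivative at $g_B$ of the scalar curvature functional on $G$-invariant metrics of fixed volume, restricted to $\mathcal{TT}^G$. The nullity is $\dim\ker \mathrm{scal}''$ and the coindex is the maximal dimension of a subspace of $\mathcal{TT}^G$ on which $\mathrm{scal}''$ is positive definite. An Einstein metric is $G$-unstable if $\mathrm{scal}''\le 0$ fails, $G$-degenerate if $\ker\mathrm{scal}''\ne0$, and $G$-neutrally stable if $\mathrm{scal}''\le0$ and $\ker\mathrm{scal}''\neq 0$. Then $g_B$ is Einstein, $\mathrm{Ric}(g_B)=\rho\, g_B$ with $\rho=\frac{n}{4(n-1)}$, and it is a critical point of the scalar curvature among $G$-invariant metrics of the same volume (its derivative vanishes on $\mathcal{TT}^G$). For $\{i,j\}\subset\{1,\dots,n\}$, $i\neq j$, let $\mathfrak p_{ij}^1$ and $\mathfrak p_{ij}^2$ be the subspaces of those matrices in $\mathfrak p$ supported in the two $(i,j)$ off-diagonal blocks that commute, respectively anticommute, with the simultaneous rotation by $\pi/2$ in all $n$ coordinate planes.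 The orthogonal projections onto these $n(n-1)$ two-dimensional subspaces, multiplied by $1/\sqrt2$, form an orthonormal basis of $\mathrm{Sym}(\mathfrak p)^K$, in which $$[L_{\mathfrak p}]=\frac1{4(n-1)}\left(4(n-2)I-\begin{bmatrix}\mathrm{Adj}(X)&\mathrm{Adj}(X)\\ \mathrm{Adj}(X)&\mathrm{Adj}(X)\end{bmatrix}\right),$$ where $\mathrm{Adj}(X)$ is the adjacency matrix of the Johnson graph $X=J(n,2,1)$ (vertices: the 2-subsets of $\{1,\dots,n\}$; two are adjacent when they share exactly one element). The characteristic polynomial of $L_{\mathfrak p}$ is $$x\left(x-\tfrac{n}{2(n-1)}\right)^{n-1}(x-1)^{n(n-3)/2}\left(x-\tfrac{n-2}{n-1}\right)^{n(n-1)/2}.$$ In particular $\mathrm{Spec}(L_{\mathfrak p})=\{0,\frac{n}{2(n-1)},\frac{n-2}{n-1},1\}$ if $n\ge4$ (the two middle values coincide when $n=4$), and $\mathrm{Spec}(L_{\mathfrak p})=\{0,\frac12,\frac34\}$ if $n=3$. If $n\ge4$, then $g_B$ is $G$-neutrally stable; its nullity is $n-1$ if $n\ge5$, and $9$ if $n=4$.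 If $n=3$, then $g_B$ is $G$-unstable with coindex $3$ and $G$-degenerate with nullity $2$. -/

import Mathlib

noncomputable section

/-! ### Invariant Riemannian geometry of a reductive homogeneous space

`G/K` with reductive decomposition `𝔤 = 𝔨 ⊕ 𝔭`; the tangent space at the base point is `𝔭`
(`X ∈ 𝔭` corresponds to `d/dt (exp tX · o)` at `t = 0`), and `G`-invariant tensor fields are
`Ad(K)`-invariant tensors on `𝔭`. -/

structure ReductiveDecomposition (L : Type*) [LieRing L] [LieAlgebra ℝ L] where
  k : LieSubalgebra ℝ L
  p : Submodule ℝ L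
  isCompl : IsCompl p k.toSubmodule
  lie_mem : ∀ Z ∈ k, ∀ X ∈ p, ⁅Z, X⁆ ∈ p

namespace ReductiveDecomposition

/-- `∑ g^{ij} h(e_i, e_j)`, the trace of a bilinear form `h` with respect to `g`. -/
def metricTrace {V : Type*} [AddCommGroup V] [Module ℝ V] [Module.Finite ℝ V]
    (g : LinearMap.BilinForm ℝ V) (h : V → V → ℝ) : ℝ :=
  ∑ i, ∑ j, (LinearMap.BilinForm.toMatrix (Module.finBasis ℝ V) g)⁻¹ i j *
    h (Module.finBasis ℝ V i) (Module.finBasis ℝ V j)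

/-- The vector `v = ∑ g^{ij} φ(e_i) e_j` that represents the functional `φ`: `g(v, ·) = φ`. -/
def metricRaise {V : Type*} [AddCommGroup V] [Module ℝ V] [Module.Finite ℝ V]
    (g : LinearMap.BilinForm ℝ V) (φ : V → ℝ) : V :=
  ∑ i, ∑ j, ((LinearMap.BilinForm.toMatrix (Module.finBasis ℝ V) g)⁻¹ i j *
    φ (Module.finBasis ℝ V i)) • Module.finBasis ℝ V j

/-- The exponential `e^A` of an endomorphism of a finite-dimensional real vector space. -/
def expEnd {V : Type*} [AddCommGroup V] [Module ℝ V] [Module.Finite ℝ V]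
    (A : Module.End ℝ V) : Module.End ℝ V :=
  Matrix.toLin (Module.finBasis ℝ V) (Module.finBasis ℝ V)
    (NormedSpace.exp (LinearMap.toMatrix (Module.finBasis ℝ V) (Module.finBasis ℝ V) A))

variable {L : Type*} [LieRing L] [LieAlgebra ℝ L] (D : ReductiveDecomposition L)

/-- `[X, Y]_𝔭`. -/
def lieP (X Y : D.p) : D.p :=
  D.p.projectionOnto D.k.toSubmodule D.isCompl ⁅(X : L), (Y : L)⁆

/-- `[X, Y]_𝔨`. -/
def lieK (X Y : D.p) : D.k :=
  D.k.toSubmodule.projectionOnto D.p D.isCompl.symm ⁅(X : L), (Y : L)⁆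

/-- The isotropy representation of `𝔨` on `𝔭`. -/
def isotropy (Z : D.k) (X : D.p) : D.p :=
  ⟨⁅(Z : L), (X : L)⁆, D.lie_mem _ Z.2 _ X.2⟩

/-- The standard metric: minus the Killing form of `𝔤`, restricted to `𝔭`. -/
def standardMetric : LinearMap.BilinForm ℝ D.p :=
  (-(killingForm ℝ L)).restrict D.p

variable [Module.Finite ℝ L]

/-- The Levi-Civita connection of the `G`-invariant metric `g` at the base point (Koszul formula):
`2 g(Λ(X)Y, Z) = g([X,Y]_𝔭, Z) + g([Z,X]_𝔭, Y) + g(X, [Z,Y]_𝔭)`.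
The covariant derivative of a `G`-invariant tensor field in the direction `X` is the action of the
endomorphism `Λ(X)` on it. -/
def leviCivita (g : LinearMap.BilinForm ℝ D.p) (X Y : D.p) : D.p :=
  metricRaise g fun Z =>
    (g (D.lieP X Y) Z + g (D.lieP Z X) Y + g X (D.lieP Z Y)) / 2

/-- The curvature tensor
`R(X,Y)Z = Λ(X)Λ(Y)Z - Λ(Y)Λ(X)Z - Λ([X,Y]_𝔭)Z - [[X,Y]_𝔨, Z]`. -/
def curvature (g : LinearMap.BilinForm ℝ D.p) (X Y Z : D.p) : D.p :=
  D.leviCivita g X (D.leviCivita g Y Z) - D.leviCivita g Y (D.leviCivita g X Z)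
    - D.leviCivita g (D.lieP X Y) Z - D.isotropy (D.lieK X Y) Z

/-- `Ric(Y,Z) = tr (X ↦ R(X,Y)Z)`. -/
def ricci (g : LinearMap.BilinForm ℝ D.p) (Y Z : D.p) : ℝ :=
  metricTrace g fun X W => g (D.curvature g X Y Z) W

/-- The scalar curvature of the `G`-invariant metric `g`. -/
def scal (g : LinearMap.BilinForm ℝ D.p) : ℝ :=
  metricTrace g (D.ricci g)

def IsEinstein (g : LinearMap.BilinForm ℝ D.p) (ρ : ℝ) : Prop :=
  ∀ X Y : D.p, D.ricci g X Y = ρ * g X Y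

/-- `(∇_X T)(Y, Z)` for a `G`-invariant `2`-tensor `T`. -/
def covDeriv (g : LinearMap.BilinForm ℝ D.p) (T : D.p → D.p → ℝ) (X Y Z : D.p) : ℝ :=
  -T (D.leviCivita g X Y) Z - T Y (D.leviCivita g X Z)

/-- `(∇_X (∇T))(Y; Z, W)`. -/
def covDeriv₂ (g : LinearMap.BilinForm ℝ D.p) (T : D.p → D.p → ℝ) (X Y Z W : D.p) : ℝ :=
  -D.covDeriv g T (D.leviCivita g X Y) Z W - D.covDeriv g T Y (D.leviCivita g X Z) W
    - D.covDeriv g T Y Z (D.leviCivita g X W)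

/-- The divergence `(δT)(Y) = -∑ (∇_{e_i} T)(e_i, Y)`. -/
def divergence (g : LinearMap.BilinForm ℝ D.p) (T : D.p → D.p → ℝ) (Y : D.p) : ℝ :=
  -metricTrace g fun X Z => D.covDeriv g T X Z Y

/-- The Lichnerowicz Laplacian `Δ_L T = ∇^*∇ T + Ric ∘ T + T ∘ Ric - 2 R° T` on `G`-invariant
`2`-tensors, where `(R° T)(Z, W) = ∑ T(R(e_i, Z)W, e_i)`. -/
def lichnerowicz (g : LinearMap.BilinForm ℝ D.p) (T : D.p → D.p → ℝ) (Z W : D.p) : ℝ :=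
  -metricTrace g (fun X Y => D.covDeriv₂ g T X Y Z W)
    + metricTrace g (fun X Y => D.ricci g Z X * T Y W)
    + metricTrace g (fun X Y => T Z X * D.ricci g Y W)
    - 2 * metricTrace g (fun X Y => T (D.curvature g X Z W) Y)

/-- The `2`-tensor `g(A ·, ·)`. -/
def tensorOf (g : LinearMap.BilinForm ℝ D.p) (A : Module.End ℝ D.p) (X Y : D.p) : ℝ :=
  g (A X) Y

/-- `Sym(𝔭)^K`: the `g`-symmetric endomorphisms of `𝔭` that commute with the isotropy
transformations `Γ = Ad(K)|_𝔭`. It is identified with the `G`-invariant symmetric `2`-tensors through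
`A ↦ g(A ·, ·)`. -/
def symInv (g : LinearMap.BilinForm ℝ D.p) (Γ : Set (Module.End ℝ D.p)) :
    Submodule ℝ (Module.End ℝ D.p) where
  carrier := {A | (∀ X Y, g (A X) Y = g X (A Y)) ∧ ∀ γ ∈ Γ, γ * A = A * γ}
  zero_mem' := by simp
  add_mem' := by
    rintro A B ⟨hA, hA'⟩ ⟨hB, hB'⟩
    refine ⟨fun X Y => by simp [hA, hB], fun γ hγ => ?_⟩
    rw [mul_add, add_mul, hA' γ hγ, hB' γ hγ]
  smul_mem' := by
    rintro c A ⟨hA, hA'⟩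
    refine ⟨fun X Y => by simp [hA], fun γ hγ => ?_⟩
    rw [mul_smul_comm, smul_mul_assoc, hA' γ hγ]

/-- The `G`-invariant TT-tensors: the `A ∈ Sym(𝔭)^K` for which `g(A ·, ·)` is traceless and
divergence-free. -/
def ttInv (g : LinearMap.BilinForm ℝ D.p) (Γ : Set (Module.End ℝ D.p)) :
    Submodule ℝ (Module.End ℝ D.p) where
  carrier := {A | A ∈ D.symInv g Γ ∧ LinearMap.trace ℝ D.p A = 0 ∧
    ∀ Y, D.divergence g (D.tensorOf g A) Y = 0}
  zero_mem' := by
    refine ⟨zero_mem _, map_zero _, fun Y => ?_⟩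
    simp [divergence, metricTrace, covDeriv, tensorOf]
  add_mem' := by
    rintro A B ⟨hA, hA', hA''⟩ ⟨hB, hB', hB''⟩
    refine ⟨add_mem hA hB, by rw [map_add, hA', hB', add_zero], fun Y => ?_⟩
    have h : D.divergence g (D.tensorOf g (A + B)) Y =
        D.divergence g (D.tensorOf g A) Y + D.divergence g (D.tensorOf g B) Y := by
      simp only [divergence, metricTrace, covDeriv, tensorOf, LinearMap.add_apply, map_add,
        ← neg_add, ← Finset.sum_add_distrib]
      congr 1
      refine Finset.sum_congr rfl fun i _ => Finset.sum_congr rfl fun j _ => ?_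
      ring
    rw [h, hA'', hB'', add_zero]
  smul_mem' := by
    rintro c A ⟨hA, hA', hA''⟩
    refine ⟨Submodule.smul_mem _ c hA, by rw [map_smul, hA', smul_zero], fun Y => ?_⟩
    have h : D.divergence g (D.tensorOf g (c • A)) Y =
        c * D.divergence g (D.tensorOf g A) Y := by
      simp only [divergence, metricTrace, covDeriv, tensorOf, LinearMap.smul_apply, map_smul,
        smul_eq_mul, mul_neg, Finset.mul_sum]
      congr 1
      refine Finset.sum_congr rfl fun i _ => Finset.sum_congr rfl fun j _ => ?_
      ring
    rw [h, hA'', mul_zero]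

/-- The scalar curvature of the metric `g(e^A ·, ·)`. As `A` runs over the traceless elements of
`Sym(𝔭)^K`, these are the `G`-invariant metrics with the same volume as `g`, and `A` is a global
coordinate on the manifold of these metrics whose differential at `g` is the identity. -/
def scalExp (g : LinearMap.BilinForm ℝ D.p) (A : Module.End ℝ D.p) : ℝ :=
  D.scal (g.comp (expEnd A) LinearMap.id)

/-- `g` is a critical point of the scalar curvature on the `G`-invariant metrics of the same volume,
modulo trivial variations. -/
def IsCritical (g : LinearMap.BilinForm ℝ D.p) (Γ : Set (Module.End ℝ D.p)) : Prop :=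
  ∀ A ∈ D.ttInv g Γ, HasDerivAt (fun t : ℝ => D.scalExp g (t • A)) 0 0

/-- The second derivative `scal''_g` at `g` in the directions `g(A ·, ·)` and `g(B ·, ·)`; at a
critical point it does not depend on the coordinate used. -/
def hess (g : LinearMap.BilinForm ℝ D.p) (A B : Module.End ℝ D.p) : ℝ :=
  deriv (fun s : ℝ => deriv (fun t : ℝ => D.scalExp g (s • A + t • B)) 0) 0

/-- The kernel of `scal''_g` restricted to the `G`-invariant TT-tensors. -/
def hessKer (g : LinearMap.BilinForm ℝ D.p) (Γ : Set (Module.End ℝ D.p)) :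
    Set (Module.End ℝ D.p) :=
  {A | A ∈ D.ttInv g Γ ∧ ∀ B ∈ D.ttInv g Γ, D.hess g A B = 0}

def GSemistable (g : LinearMap.BilinForm ℝ D.p) (Γ : Set (Module.End ℝ D.p)) : Prop :=
  ∀ A ∈ D.ttInv g Γ, D.hess g A A ≤ 0

def GUnstable (g : LinearMap.BilinForm ℝ D.p) (Γ : Set (Module.End ℝ D.p)) : Prop :=
  ¬ D.GSemistable g Γ

def GDegenerate (g : LinearMap.BilinForm ℝ D.p) (Γ : Set (Module.End ℝ D.p)) : Prop :=
  ∃ A ∈ D.hessKer g Γ, A ≠ 0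

def GNeutrallyStable (g : LinearMap.BilinForm ℝ D.p) (Γ : Set (Module.End ℝ D.p)) : Prop :=
  D.GSemistable g Γ ∧ ∃ A ∈ D.hessKer g Γ, A ≠ 0

/-- The nullity, the dimension of the kernel of `scal''_g` on the `G`-invariant TT-tensors,
equals `m`. -/
def HasNullity (g : LinearMap.BilinForm ℝ D.p) (Γ : Set (Module.End ℝ D.p)) (m : ℕ) : Prop :=
  ∃ W : Submodule ℝ (Module.End ℝ D.p),
    (W : Set (Module.End ℝ D.p)) = D.hessKer g Γ ∧ Module.finrank ℝ W = m

/-- The coindex, the maximal dimension of a space of `G`-invariant TT-tensors on which `scal''_g` is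
positive definite, equals `m`. -/
def HasCoindex (g : LinearMap.BilinForm ℝ D.p) (Γ : Set (Module.End ℝ D.p)) (m : ℕ) : Prop :=
  IsGreatest {d : ℕ | ∃ W : Submodule ℝ (Module.End ℝ D.p), W ≤ D.ttInv g Γ ∧
    Module.finrank ℝ W = d ∧ ∀ A ∈ W, A ≠ 0 → 0 < D.hess g A A} m

end ReductiveDecomposition

/-! ### The full flag manifold `SO(2n)/T^n` -/

namespace SO2nFlag

open Matrix

attribute [local instance] LieRing.ofAssociativeRing

/-- `ℝ^{2n} = (ℝ²)^n`: the coordinate `(a, i)` is the `a`-th coordinate of the `i`-th plane. -/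
abbrev Idx (n : ℕ) : Type := Fin 2 × Fin n

/-- The Lie algebra `𝔰𝔬(2n)` of skew-symmetric matrices. -/
abbrev so2n (n : ℕ) : LieSubalgebra ℝ (Matrix (Idx n) (Idx n) ℝ) :=
  LieAlgebra.Orthogonal.so (Idx n) ℝ

def rotMatrix {n : ℕ} (θ : Fin n → ℝ) : Matrix (Idx n) (Idx n) ℝ :=
  blockDiagonal fun i => !![Real.cos (θ i), -Real.sin (θ i); Real.sin (θ i), Real.cos (θ i)]

lemma rotMatrix_add {n : ℕ} (θ φ : Fin n → ℝ) :
    rotMatrix (θ + φ) = rotMatrix θ * rotMatrix φ := by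
  rw [rotMatrix, rotMatrix, rotMatrix, ← blockDiagonal_mul]
  congr 1
  funext i
  ext a b
  fin_cases a <;> fin_cases b <;>
    simp [Real.cos_add, Real.sin_add, Matrix.mul_apply, Fin.sum_univ_two] <;> ring

lemma rotMatrix_zero (n : ℕ) : rotMatrix (0 : Fin n → ℝ) = 1 := by
  rw [rotMatrix, ← blockDiagonal_one]
  congr 1
  funext i
  ext a b
  fin_cases a <;> fin_cases b <;> simp

lemma rotMatrix_transpose {n : ℕ} (θ : Fin n → ℝ) : (rotMatrix θ)ᵀ = rotMatrix (-θ) := by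
  rw [rotMatrix, rotMatrix, blockDiagonal_transpose]
  congr 1
  funext i
  ext a b
  fin_cases a <;> fin_cases b <;> simp

lemma rotMatrix_mem {n : ℕ} (θ : Fin n → ℝ) :
    rotMatrix θ ∈ specialOrthogonalGroup (Idx n) ℝ := by
  rw [mem_specialOrthogonalGroup_iff, mem_orthogonalGroup_iff]
  constructor
  · rw [rotMatrix_transpose, ← rotMatrix_add, add_neg_cancel, rotMatrix_zero]
  · rw [rotMatrix, det_blockDiagonal]
    refine Finset.prod_eq_one fun i _ => ?_
    rw [det_fin_two_of]
    nlinarith [Real.sin_sq_add_cos_sq (θ i)]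

/-- The usual maximal torus `T^n = SO(2)^n` of `SO(2n)`. -/
def maxTorus (n : ℕ) : Subgroup (specialOrthogonalGroup (Idx n) ℝ) where
  carrier := Set.range fun θ : Fin n → ℝ => ⟨rotMatrix θ, rotMatrix_mem θ⟩
  one_mem' := ⟨0, Subtype.ext (rotMatrix_zero n)⟩
  mul_mem' := by
    rintro _ _ ⟨θ, rfl⟩ ⟨φ, rfl⟩
    exact ⟨θ + φ, Subtype.ext (rotMatrix_add θ φ)⟩
  inv_mem' := by
    rintro _ ⟨θ, rfl⟩
    refine ⟨-θ, eq_inv_of_mul_eq_one_left (Subtype.ext ?_)⟩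
    change rotMatrix (-θ) * rotMatrix θ = 1
    rw [← rotMatrix_add, neg_add_cancel, rotMatrix_zero]

/-- The reductive decomposition of `𝔰𝔬(2n)`: `𝔨` (the Lie algebra of `T^n`) is the set of matrices
with zero `2 × 2` blocks off the diagonal, `𝔭` the set of those with zero diagonal blocks. -/
def decomposition (n : ℕ) : ReductiveDecomposition (so2n n) where
  k :=
    { carrier := {X | ∀ a b i j, i ≠ j → X.1 (a, i) (b, j) = 0}
      zero_mem' := by intro a b i j _; rfl
      add_mem' := by
        intro X Y hX hY a b i j h
        change X.1 (a, i) (b, j) + Y.1 (a, i) (b, j) = 0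
        rw [hX a b i j h, hY a b i j h, add_zero]
      smul_mem' := by
        intro c X hX a b i j h
        change c * X.1 (a, i) (b, j) = 0
        rw [hX a b i j h, mul_zero]
      lie_mem' := by
        intro X Y hX hY a b i j h
        have key : ∀ P Q : so2n n, (∀ a b i j, i ≠ j → P.1 (a, i) (b, j) = 0) →
            (∀ a b i j, i ≠ j → Q.1 (a, i) (b, j) = 0) → (P.1 * Q.1) (a, i) (b, j) = 0 := by
          intro P Q hP hQ
          rw [Matrix.mul_apply]
          refine Finset.sum_eq_zero fun c _ => ?_
          obtain ⟨c, l⟩ := c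
          by_cases hl : i = l
          · rw [hQ c b l j (hl ▸ h), mul_zero]
          · rw [hP a c i l hl, zero_mul]
        change (X.1 * Y.1 - Y.1 * X.1) (a, i) (b, j) = 0
        rw [Matrix.sub_apply, key X Y hX hY, key Y X hY hX, sub_zero] }
  p :=
    { carrier := {X | ∀ a b i, X.1 (a, i) (b, i) = 0}
      zero_mem' := by intro a b i; rfl
      add_mem' := by
        intro X Y hX hY a b i
        change X.1 (a, i) (b, i) + Y.1 (a, i) (b, i) = 0
        rw [hX a b i, hY a b i, add_zero]
      smul_mem' := by
        intro c X hX a b i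
        change c * X.1 (a, i) (b, i) = 0
        rw [hX a b i, mul_zero] }
  isCompl := by
    refine ⟨?_, ?_⟩
    · rw [Submodule.disjoint_def]
      intro X hX hX'
      refine Subtype.ext ?_
      ext ⟨a, i⟩ ⟨b, j⟩
      by_cases h : i = j
      · subst h; exact hX a b i
      · exact hX' a b i j h
    · rw [codisjoint_iff, Submodule.eq_top_iff']
      intro X
      have hX := (LieAlgebra.Orthogonal.mem_so _ _ _).1 X.2
      have hX' : ∀ x y, X.1 y x = -X.1 x y := fun x y => congrFun (congrFun hX x) y
      let P : Matrix (Idx n) (Idx n) ℝ := fun x y => if x.2 = y.2 then 0 else X.1 x y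
      have hP : P ∈ so2n n := by
        rw [LieAlgebra.Orthogonal.mem_so]
        ext x y
        change (if y.2 = x.2 then 0 else X.1 y x) = -(if x.2 = y.2 then 0 else X.1 x y)
        by_cases h : x.2 = y.2
        · simp [h]
        · rw [if_neg h, if_neg (Ne.symm h), hX' x y]
      refine Submodule.mem_sup.2 ⟨⟨P, hP⟩, ?_, X - ⟨P, hP⟩, ?_, by abel⟩
      · intro a b i
        simp [P]
      · intro a b i j h
        change X.1 (a, i) (b, j) - P (a, i) (b, j) = 0
        simp [P, h]
  lie_mem := by
    intro Z hZ X hX a b i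
    change (Z.1 * X.1 - X.1 * Z.1) (a, i) (b, i) = 0
    rw [Matrix.sub_apply, Matrix.mul_apply, Matrix.mul_apply]
    rw [Finset.sum_eq_zero, Finset.sum_eq_zero, sub_zero]
    · rintro ⟨c, l⟩ _
      by_cases hl : l = i
      · subst hl; rw [hX a c l, zero_mul]
      · rw [hZ c b l i hl, mul_zero]
    · rintro ⟨c, l⟩ _
      by_cases hl : i = l
      · subst hl; rw [hX c b i, mul_zero]
      · rw [hZ a c i l hl, zero_mul]

/-- `Ad(t)` on `𝔰𝔬(2n)`, that is `X ↦ t X tᵀ`, for `t ∈ SO(2n)`. -/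
def Ad {n : ℕ} (t : specialOrthogonalGroup (Idx n) ℝ) : Module.End ℝ (so2n n) where
  toFun X := ⟨t.1 * X.1 * t.1ᵀ, by
    have hX := (LieAlgebra.Orthogonal.mem_so _ _ _).1 X.2
    rw [LieAlgebra.Orthogonal.mem_so, transpose_mul, transpose_mul, transpose_transpose, hX]
    simp [Matrix.mul_assoc]⟩
  map_add' X Y := Subtype.ext (by simp [Matrix.mul_add, Matrix.add_mul])
  map_smul' c X := Subtype.ext (by simp)

lemma Ad_mem_p {n : ℕ} {t : specialOrthogonalGroup (Idx n) ℝ} (ht : t ∈ maxTorus n)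
    {X : so2n n} (hX : X ∈ (decomposition n).p) : Ad t X ∈ (decomposition n).p := by
  obtain ⟨θ, rfl⟩ := ht
  intro a b i
  change (rotMatrix θ * X.1 * (rotMatrix θ)ᵀ) (a, i) (b, i) = 0
  have hr : ∀ (φ : Fin n → ℝ) a b i j, i ≠ j → rotMatrix φ (a, i) (b, j) = 0 :=
    fun φ a b i j h => blockDiagonal_apply_ne _ _ _ h
  rw [Matrix.mul_apply]
  refine Finset.sum_eq_zero ?_
  rintro ⟨c, l⟩ _
  by_cases hl : i = l
  · subst hl
    rw [Matrix.mul_apply, Finset.sum_eq_zero, zero_mul]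
    rintro ⟨e, m⟩ _
    by_cases hm : i = m
    · subst hm; rw [hX e c i, mul_zero]
    · rw [hr θ a e i m hm, zero_mul]
  · rw [Matrix.transpose_apply, hr θ b c i l hl, mul_zero]

/-- The transformations `Ad(t)|_𝔭`, `t ∈ T^n`. -/
def isotropySet (n : ℕ) : Set (Module.End ℝ (decomposition n).p) :=
  Set.range fun t : maxTorus n => (Ad t.1).restrict fun _ hX => Ad_mem_p t.2 hX

/-- The standard metric `g_B` on `SO(2n)/T^n`. -/
abbrev gB (n : ℕ) : LinearMap.BilinForm ℝ (decomposition n).p :=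
  (decomposition n).standardMetric

/-- `Sym(𝔭)^{T^n}`, the space of `SO(2n)`-invariant symmetric `2`-tensors on `SO(2n)/T^n`. -/
abbrev invSym (n : ℕ) : Submodule ℝ (Module.End ℝ (decomposition n).p) :=
  (decomposition n).symInv (gB n) (isotropySet n)

instance (n : ℕ) : AddCommGroup (invSym n) := (invSym n).addCommGroup

instance (n : ℕ) : Ring (Module.End ℝ (invSym n)) := Module.End.instRing

abbrev Pairs (n : ℕ) : Type := {S : Finset (Fin n) // S.card = 2}

/-- The isotropy summands `𝔭_{ij}^1` (index `inl {i,j}`) and `𝔭_{ij}^2` (index `inr {i,j}`): matrices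
supported in the two off-diagonal blocks of `{i, j}`, commuting, respectively anticommuting, with
the rotation by `π/2` in every plane. -/
def summand {n : ℕ} (s : Pairs n ⊕ Pairs n) : Submodule ℝ (decomposition n).p where
  carrier := {X | (∀ a b i j, ({i, j} : Finset (Fin n)) ≠ s.elim Subtype.val Subtype.val →
      X.1.1 (a, i) (b, j) = 0) ∧
    rotMatrix (fun _ => Real.pi / 2) * X.1.1 =
      s.elim (fun _ => (1 : ℝ)) (fun _ => -1) •
        (X.1.1 * rotMatrix (fun _ => Real.pi / 2))}
  zero_mem' := by
    refine ⟨fun a b i j _ => rfl, ?_⟩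
    change _ * (0 : Matrix (Idx n) (Idx n) ℝ) = _ • ((0 : Matrix (Idx n) (Idx n) ℝ) * _)
    simp
  add_mem' := by
    rintro X Y ⟨hX, hX'⟩ ⟨hY, hY'⟩
    refine ⟨fun a b i j h => ?_, ?_⟩
    · change X.1.1 (a, i) (b, j) + Y.1.1 (a, i) (b, j) = 0
      rw [hX a b i j h, hY a b i j h, add_zero]
    · change _ * (X.1.1 + Y.1.1) = _ • ((X.1.1 + Y.1.1) * _)
      rw [Matrix.mul_add, Matrix.add_mul, smul_add, hX', hY']
  smul_mem' := by
    rintro c X ⟨hX, hX'⟩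
    refine ⟨fun a b i j h => ?_, ?_⟩
    · change c * X.1.1 (a, i) (b, j) = 0
      rw [hX a b i j h, mul_zero]
    · change _ * (c • X.1.1) = _ • ((c • X.1.1) * _)
      rw [Matrix.mul_smul, Matrix.smul_mul, hX', smul_comm]

end SO2nFlag

/-- The graph `J(v, k, i)`: its vertices are the `k`-subsets of a `v`-set, two of them being adjacent
when they meet in exactly `i` elements. -/
def johnsonGraph (v k i : ℕ) : SimpleGraph {S : Finset (Fin v) // S.card = k} where
  Adj S T := S ≠ T ∧ (S.1 ∩ T.1).card = i
  symm := ⟨fun S T h => ⟨h.1.symm, by rw [Finset.inter_comm]; exact h.2⟩⟩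
  loopless := ⟨fun _ h => h.1 rfl⟩

instance (v k i : ℕ) : DecidableRel (johnsonGraph v k i).Adj :=
  fun S T => inferInstanceAs (Decidable (S ≠ T ∧ (S.1 ∩ T.1).card = i))

end

/-! ### Metric traces, index raising and exponentials computed in a frame. -/

noncomputable section

namespace ReductiveDecomposition

section FiniteDimensional

variable {V : Type*} [AddCommGroup V] [Module ℝ V] [Module.Finite ℝ V]

/-! The geometry reduces to a weighted graph on the isotropy summands. The argument uses a
`g_B`-orthonormal frame with two vectors in each summand, such that `ad(e_α)` satisfies Schur-type
relations: the vectors `[e_α, e_β]_𝔭` with `α` fixed are mutually orthogonal, their squared lengths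
`ν` depend only on the labels of `α` and `β`, and `[e_α, e_β]_𝔨` is nonzero only for the two vectors
of one summand. These are the data of `NormalFrame`. Since the structure constants are totally
antisymmetric, every contraction occurring in Ricci, `Δ_L` or the scalar curvature collapses to the
constants `lam` and `μ` and to the matrix `ν`.

For a tensor with eigenvalue `a s` on summand `s` this gives Ricci constant `ρ = lam/4 + μ`, zero
divergence, and `(L a) s = lam * a s - 2 ∑ t, ν t s * a t` (`lichnerowicz_tensorOf`). The scalar
curvature of `g(e^A ·, ·)` is a finite sum of exponentials of linear forms in `a`, so its Hessian is
explicit: it is the form `2ρ - L` on label vectors (`hess_eq`). Stability is therefore decided by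
comparing the spectrum of `L` on traceless vectors with `2ρ = n/(2(n-1))`.

For `𝔰𝔬(2n)` the frame consists of matrices `A` whose two blocks are built from an orthogonal `2 ×
2` matrix, so that `A²` is minus the projection onto the planes of the pair. The double bracket `[A,
[A, B]] = A²B + BA² - 2ABA` is then a multiple of `B`: `-B` for pairs sharing one plane, `0` for
disjoint pairs, and inside a pair `-4B` or `0` according as the labels agree or not, for `A ≠ B`.
Invariance of the Killing form turns this into the Schur relations (`frame`), with `ν` proportional
to the adjacency matrix of `J(n,2,1)`. The torus distinguishes the summands and acts on each by
rotations, so every element of `Sym(𝔭)^K` is diagonal (`apply_frameVec_of_mem`).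

The spectrum comes from the point-pair incidence matrix `N`: `NᵀN = Adj + 2` and `NNᵀ = (n-2) + J`,
with `J` the all-ones matrix (`charpoly_lichMatrix`). The eigenvalue `0` belongs to the metric
itself, and the eigenspace for `2ρ` is the kernel of the Hessian. The antisymmetric part under
exchange of the two summands of each pair has eigenvalue `(n-2)/(n-1)`, which is above `2ρ` for `n ≥
5`, equal to it for `n = 4` and below it for `n = 3`; this accounts for the exceptional cases. -/

lemma apply_eq_sum_repr_finBasis (φ : V → ℝ) (hφ : IsLinearMap ℝ φ) (u : V) :
    φ u = ∑ i, (Module.finBasis ℝ V).repr u i * φ (Module.finBasis ℝ V i) := by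
  change hφ.mk' _ u = _
  conv_lhs => rw [← (Module.finBasis ℝ V).sum_repr u]
  rw [map_sum]
  simp only [map_smul, smul_eq_mul, IsLinearMap.mk'_apply]

/-- The reproducing identity `he` says that `∑ w α • e α ⊗ e α` is the inverse of `g`; neither
orthonormality nor linear independence of `e` is assumed. This is what allows the arbitrary basis in
the definitions to be replaced by an adapted frame. -/
lemma toMatrix_inv_eq_sum_of_frame {ι : Type*} [Fintype ι] (g : LinearMap.BilinForm ℝ V)
    (e : ι → V) (w : ι → ℝ) (he : ∀ v, ∑ α, (w α * g (e α) v) • e α = v) :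
    (LinearMap.BilinForm.toMatrix (Module.finBasis ℝ V) g)⁻¹ =
      Matrix.of fun i j => ∑ α, w α * (Module.finBasis ℝ V).repr (e α) i *
        (Module.finBasis ℝ V).repr (e α) j := by
  refine Matrix.inv_eq_left_inv ?_
  ext i k
  have h1 : ∀ u v : V, g u v = ∑ j, (Module.finBasis ℝ V).repr u j *
      g (Module.finBasis ℝ V j) v := fun u v =>
    apply_eq_sum_repr_finBasis (fun u => g u v) (g.flip v).isLinear u
  have h2 : (Module.finBasis ℝ V).repr (Module.finBasis ℝ V k) i =
      ∑ α, w α * g (e α) (Module.finBasis ℝ V k) * (Module.finBasis ℝ V).repr (e α) i := by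
    conv_lhs => rw [← he (Module.finBasis ℝ V k)]
    simp [Finsupp.finsetSum_apply]
  simp only [Matrix.mul_apply, Matrix.of_apply, LinearMap.BilinForm.toMatrix_apply,
    Finset.sum_mul]
  rw [Finset.sum_comm]
  rw [Module.Basis.repr_self, Finsupp.single_apply] at h2
  rw [Matrix.one_apply]
  simp only [eq_comm (a := i) (b := k)]
  rw [h2]
  refine Finset.sum_congr rfl fun α _ => ?_
  rw [h1, Finset.mul_sum, Finset.sum_mul]
  refine Finset.sum_congr rfl fun j _ => ?_
  ring

lemma metricTrace_eq_sum_of_frame {ι : Type*} [Fintype ι] (g : LinearMap.BilinForm ℝ V)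
    (e : ι → V) (w : ι → ℝ) (he : ∀ v, ∑ α, (w α * g (e α) v) • e α = v) (h : V → V → ℝ)
    (h₁ : ∀ Y, IsLinearMap ℝ fun X => h X Y) (h₂ : ∀ X, IsLinearMap ℝ (h X)) :
    metricTrace g h = ∑ α, w α * h (e α) (e α) := by
  have hs : ∀ u v : V, h u v = ∑ i, ∑ j, (Module.finBasis ℝ V).repr u i *
      (Module.finBasis ℝ V).repr v j * h (Module.finBasis ℝ V i) (Module.finBasis ℝ V j) := by
    intro u v
    have e1 : h u v = ∑ i, (Module.finBasis ℝ V).repr u i * h (Module.finBasis ℝ V i) v :=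
      apply_eq_sum_repr_finBasis _ (h₁ v) u
    rw [e1]
    refine Finset.sum_congr rfl fun i _ => ?_
    have e2 : h (Module.finBasis ℝ V i) v = ∑ j, (Module.finBasis ℝ V).repr v j *
        h (Module.finBasis ℝ V i) (Module.finBasis ℝ V j) :=
      apply_eq_sum_repr_finBasis _ (h₂ _) v
    rw [e2, Finset.mul_sum]
    refine Finset.sum_congr rfl fun j _ => ?_
    ring
  rw [metricTrace, toMatrix_inv_eq_sum_of_frame g e w he]
  simp only [Matrix.of_apply, Finset.sum_mul]
  simp_rw [hs (e _) (e _), Finset.mul_sum]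
  rw [Finset.sum_comm' (t' := Finset.univ) (s' := fun _ => Finset.univ) (by simp)]
  conv_rhs => rw [Finset.sum_comm]
  rw [Finset.sum_comm]
  refine Finset.sum_congr rfl fun i _ => ?_
  rw [Finset.sum_comm' (t' := Finset.univ) (s' := fun _ => Finset.univ) (by simp)]
  refine Finset.sum_congr rfl fun α _ => Finset.sum_congr rfl fun j _ => ?_
  ring

lemma metricRaise_eq_sum_of_frame {ι : Type*} [Fintype ι] (g : LinearMap.BilinForm ℝ V)
    (e : ι → V) (w : ι → ℝ) (he : ∀ v, ∑ α, (w α * g (e α) v) • e α = v) (φ : V → ℝ)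
    (hφ : IsLinearMap ℝ φ) :
    metricRaise g φ = ∑ α, (w α * φ (e α)) • e α := by
  have hs := apply_eq_sum_repr_finBasis φ hφ
  have hv : ∀ u : V, u = ∑ j, (Module.finBasis ℝ V).repr u j • Module.finBasis ℝ V j :=
    fun u => ((Module.finBasis ℝ V).sum_repr u).symm
  have hr : ∀ α, (w α * φ (e α)) • e α = ∑ i, ∑ j, ((w α * (Module.finBasis ℝ V).repr (e α) i *
      (Module.finBasis ℝ V).repr (e α) j) * φ (Module.finBasis ℝ V i)) •
        Module.finBasis ℝ V j := by
    intro α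
    conv_lhs => rw [hs (e α), Finset.mul_sum, Finset.sum_smul]
    refine Finset.sum_congr rfl fun i _ => ?_
    conv_lhs => rw [hv (e α), Finset.smul_sum]
    refine Finset.sum_congr rfl fun j _ => ?_
    rw [smul_smul]
    congr 1
    simp
    ring
  rw [metricRaise, toMatrix_inv_eq_sum_of_frame g e w he, Finset.sum_congr rfl fun α _ => hr α,
    Finset.sum_comm (s := Finset.univ (α := ι))]
  refine Finset.sum_congr rfl fun i _ => ?_
  rw [Finset.sum_comm (s := Finset.univ (α := ι))]
  refine Finset.sum_congr rfl fun j _ => ?_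
  rw [← Finset.sum_smul, Matrix.of_apply, Finset.sum_mul]

lemma metricRaise_add (g : LinearMap.BilinForm ℝ V) (φ ψ : V → ℝ) :
    metricRaise g (fun Z => φ Z + ψ Z) = metricRaise g φ + metricRaise g ψ := by
  simp only [metricRaise, mul_add, add_smul, Finset.sum_add_distrib]

lemma metricRaise_smul (g : LinearMap.BilinForm ℝ V) (c : ℝ) (φ : V → ℝ) :
    metricRaise g (fun Z => c * φ Z) = c • metricRaise g φ := by
  simp only [metricRaise, Finset.smul_sum, smul_smul]
  refine Finset.sum_congr rfl fun i _ => Finset.sum_congr rfl fun j _ => ?_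
  congr 1
  ring

-- The exponential series acts term by term on an eigenvector. The metrics considered later are
-- diagonal in one fixed frame, so no other information about the matrix exponential is needed.
open Matrix in
open scoped Matrix.Norms.Operator in
lemma exp_mulVec_of_mulVec_eq_smul {m : Type*} [Fintype m] [DecidableEq m] (M : Matrix m m ℝ)
    (u : m → ℝ) (a : ℝ) (h : M *ᵥ u = a • u) :
    NormedSpace.exp M *ᵥ u = Real.exp a • u := by
  have hp : ∀ k : ℕ, M ^ k *ᵥ u = a ^ k • u := by
    intro k
    induction k with
    | zero => simp
    | succ k ih => rw [pow_succ', ← Matrix.mulVec_mulVec, ih, Matrix.mulVec_smul, h, smul_smul,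
        pow_succ]
  have h1 := NormedSpace.exp_series_hasSum_exp' (𝕂 := ℝ) M
  let T : Matrix m m ℝ →ₗ[ℝ] (m → ℝ) := (Matrix.mulVecBilin ℝ ℝ).flip u
  have hT : ∀ N, T N = N *ᵥ u := fun N => rfl
  have h2 := h1.mapL T.toContinuousLinearMap
  have h3 := (NormedSpace.exp_series_hasSum_exp' (𝕂 := ℝ) a).smul_const u
  rw [← Real.exp_eq_exp_ℝ] at h3
  refine HasSum.unique (f := fun k : ℕ => ((k.factorial : ℝ)⁻¹ • a ^ k) • u) ?_ h3
  have h4 : (fun k : ℕ => ((k.factorial : ℝ)⁻¹ • a ^ k) • u) =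
      fun k : ℕ => T ((k.factorial : ℝ)⁻¹ • M ^ k) := by
    funext k
    rw [hT, Matrix.smul_mulVec, hp, smul_assoc]
  rw [h4]
  exact h2

lemma expEnd_apply_of_apply_eq_smul (A : Module.End ℝ V) (v : V) (a : ℝ) (h : A v = a • v) :
    expEnd A v = Real.exp a • v := by
  apply (Module.finBasis ℝ V).repr.injective
  ext i
  rw [expEnd, Matrix.repr_toLin, exp_mulVec_of_mulVec_eq_smul _ _ a]
  · simp
  · rw [LinearMap.toMatrix_mulVec_repr, h, map_smul]
    rfl

end FiniteDimensional

end ReductiveDecomposition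
end

/-! ### Multilinearity of connection and curvature; invariants as frame sums. -/

noncomputable section

namespace ReductiveDecomposition

section Multilinear

lemma metricTrace_add {V : Type*} [AddCommGroup V] [Module ℝ V] [Module.Finite ℝ V]
    (g : LinearMap.BilinForm ℝ V) (h k : V → V → ℝ) :
    metricTrace g (fun X Y => h X Y + k X Y) = metricTrace g h + metricTrace g k := by
  simp only [metricTrace, mul_add, Finset.sum_add_distrib]

lemma metricTrace_smul {V : Type*} [AddCommGroup V] [Module ℝ V] [Module.Finite ℝ V]
    (g : LinearMap.BilinForm ℝ V) (c : ℝ) (h : V → V → ℝ) :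
    metricTrace g (fun X Y => c * h X Y) = c * metricTrace g h := by
  simp only [metricTrace, Finset.mul_sum]
  refine Finset.sum_congr rfl fun i _ => Finset.sum_congr rfl fun j _ => ?_
  ring

variable {L : Type*} [LieRing L] [LieAlgebra ℝ L] (D : ReductiveDecomposition L)

lemma lieP_add_left (X X' Y : D.p) : D.lieP (X + X') Y = D.lieP X Y + D.lieP X' Y := by
  simp [lieP]

lemma lieP_add_right (X Y Y' : D.p) : D.lieP X (Y + Y') = D.lieP X Y + D.lieP X Y' := by
  simp [lieP]

lemma lieP_smul_left (c : ℝ) (X Y : D.p) : D.lieP (c • X) Y = c • D.lieP X Y := by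
  simp [lieP]

lemma lieP_smul_right (c : ℝ) (X Y : D.p) : D.lieP X (c • Y) = c • D.lieP X Y := by
  simp [lieP]

lemma lieP_swap (X Y : D.p) : D.lieP Y X = -D.lieP X Y := by
  rw [lieP, lieP, ← lie_skew, map_neg]

lemma lieP_self (X : D.p) : D.lieP X X = 0 := by
  simp [lieP]

lemma lieK_add_left (X X' Y : D.p) : D.lieK (X + X') Y = D.lieK X Y + D.lieK X' Y := by
  simp only [lieK, Submodule.coe_add, add_lie]
  exact map_add _ _ _

lemma lieK_add_right (X Y Y' : D.p) : D.lieK X (Y + Y') = D.lieK X Y + D.lieK X Y' := by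
  simp only [lieK, Submodule.coe_add, lie_add]
  exact map_add _ _ _

lemma lieK_smul_left (c : ℝ) (X Y : D.p) : D.lieK (c • X) Y = c • D.lieK X Y := by
  simp only [lieK, Submodule.coe_smul, smul_lie]
  exact map_smul _ _ _

lemma lieK_smul_right (c : ℝ) (X Y : D.p) : D.lieK X (c • Y) = c • D.lieK X Y := by
  simp only [lieK, Submodule.coe_smul, lie_smul]
  exact map_smul _ _ _

lemma lieK_swap (X Y : D.p) : D.lieK Y X = -D.lieK X Y := by
  rw [lieK, lieK, ← lie_skew]
  exact map_neg _ _

lemma lie_eq_lieP_add_lieK (X Y : D.p) :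
    ⁅(X : L), (Y : L)⁆ = (D.lieP X Y : L) + (D.lieK X Y : L) :=
  (Submodule.projection_add_projection_eq_self D.isCompl _).symm

lemma isotropy_add_left (Z Z' : D.k) (X : D.p) :
    D.isotropy (Z + Z') X = D.isotropy Z X + D.isotropy Z' X :=
  Subtype.ext (add_lie _ _ _)

lemma isotropy_add_right (Z : D.k) (X X' : D.p) :
    D.isotropy Z (X + X') = D.isotropy Z X + D.isotropy Z X' :=
  Subtype.ext (lie_add _ _ _)

lemma isotropy_smul_left (c : ℝ) (Z : D.k) (X : D.p) :
    D.isotropy (c • Z) X = c • D.isotropy Z X :=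
  Subtype.ext (smul_lie _ _ _)

lemma isotropy_smul_right (c : ℝ) (Z : D.k) (X : D.p) :
    D.isotropy Z (c • X) = c • D.isotropy Z X :=
  Subtype.ext (lie_smul _ _ _)

/-- The isotropy term of the curvature as a trilinear map. -/
def isotropyTrilin : D.p →ₗ[ℝ] D.p →ₗ[ℝ] D.p →ₗ[ℝ] D.p :=
  LinearMap.mk₂ ℝ (fun X Y =>
    { toFun := fun Z => D.isotropy (D.lieK X Y) Z
      map_add' := D.isotropy_add_right _
      map_smul' := fun c => D.isotropy_smul_right c _ })
    (fun X X' Y => LinearMap.ext fun Z => by simp [lieK_add_left, isotropy_add_left])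
    (fun c X Y => LinearMap.ext fun Z => by simp [lieK_smul_left, isotropy_smul_left])
    (fun X Y Y' => LinearMap.ext fun Z => by simp [lieK_add_right, isotropy_add_left])
    (fun c X Y => LinearMap.ext fun Z => by simp [lieK_smul_right, isotropy_smul_left])

lemma isotropyTrilin_apply (X Y Z : D.p) :
    D.isotropyTrilin X Y Z = D.isotropy (D.lieK X Y) Z := rfl

variable [Module.Finite ℝ L] (g : LinearMap.BilinForm ℝ D.p)

lemma leviCivita_add_left (X X' Y : D.p) :
    D.leviCivita g (X + X') Y = D.leviCivita g X Y + D.leviCivita g X' Y := by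
  rw [leviCivita, leviCivita, leviCivita, ← metricRaise_add]
  congr 1
  funext Z
  simp only [lieP_add_left, lieP_add_right, map_add, LinearMap.add_apply]
  ring

lemma leviCivita_add_right (X Y Y' : D.p) :
    D.leviCivita g X (Y + Y') = D.leviCivita g X Y + D.leviCivita g X Y' := by
  rw [leviCivita, leviCivita, leviCivita, ← metricRaise_add]
  congr 1
  funext Z
  simp only [lieP_add_right, map_add, LinearMap.add_apply]
  ring

lemma leviCivita_smul_left (c : ℝ) (X Y : D.p) :
    D.leviCivita g (c • X) Y = c • D.leviCivita g X Y := by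
  rw [leviCivita, leviCivita, ← metricRaise_smul]
  congr 1
  funext Z
  simp only [lieP_smul_left, lieP_smul_right, map_smul, LinearMap.smul_apply, smul_eq_mul]
  ring

lemma leviCivita_smul_right (c : ℝ) (X Y : D.p) :
    D.leviCivita g X (c • Y) = c • D.leviCivita g X Y := by
  rw [leviCivita, leviCivita, ← metricRaise_smul]
  congr 1
  funext Z
  simp only [lieP_smul_right, map_smul, LinearMap.smul_apply, smul_eq_mul]
  ring

/-- The Levi-Civita connection as a bilinear map. -/
def leviCivitaBilin : D.p →ₗ[ℝ] D.p →ₗ[ℝ] D.p :=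
  LinearMap.mk₂ ℝ (D.leviCivita g) (D.leviCivita_add_left g) (D.leviCivita_smul_left g)
    (D.leviCivita_add_right g) (D.leviCivita_smul_right g)

lemma leviCivitaBilin_apply (X Y : D.p) : D.leviCivitaBilin g X Y = D.leviCivita g X Y := rfl

lemma curvature_eq (X Y Z : D.p) :
    D.curvature g X Y Z = D.leviCivitaBilin g X (D.leviCivitaBilin g Y Z)
      - D.leviCivitaBilin g Y (D.leviCivitaBilin g X Z)
      - D.leviCivitaBilin g (D.lieP X Y) Z - D.isotropyTrilin X Y Z := rfl

lemma isLinearMap_curvature₁ (Y Z : D.p) : IsLinearMap ℝ fun X => D.curvature g X Y Z where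
  map_add X X' := by
    simp only [curvature_eq, lieP_add_left, map_add, LinearMap.add_apply]
    abel
  map_smul c X := by
    simp only [curvature_eq, lieP_smul_left, map_smul, LinearMap.smul_apply, smul_sub]

lemma isLinearMap_curvature₂ (X Z : D.p) : IsLinearMap ℝ fun Y => D.curvature g X Y Z where
  map_add Y Y' := by
    simp only [curvature_eq, lieP_add_right, map_add, LinearMap.add_apply]
    abel
  map_smul c X := by
    simp only [curvature_eq, lieP_smul_right, map_smul, LinearMap.smul_apply, smul_sub]

lemma isLinearMap_curvature₃ (X Y : D.p) : IsLinearMap ℝ fun Z => D.curvature g X Y Z where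
  map_add Z Z' := by
    simp only [curvature_eq, map_add]
    abel
  map_smul c X := by
    simp only [curvature_eq, map_smul, smul_sub]

lemma isLinearMap_ricci₁ (Z : D.p) : IsLinearMap ℝ fun Y => D.ricci g Y Z where
  map_add Y Y' := by
    simp only [ricci, (D.isLinearMap_curvature₂ g _ Z).map_add, map_add, LinearMap.add_apply]
    exact metricTrace_add _ _ _
  map_smul c Y := by
    simp only [ricci, (D.isLinearMap_curvature₂ g _ Z).map_smul, map_smul, LinearMap.smul_apply,
      smul_eq_mul]
    exact metricTrace_smul _ _ _

lemma isLinearMap_ricci₂ (Y : D.p) : IsLinearMap ℝ (D.ricci g Y) where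
  map_add Z Z' := by
    simp only [ricci, (D.isLinearMap_curvature₃ g _ Y).map_add, map_add, LinearMap.add_apply]
    exact metricTrace_add _ _ _
  map_smul c Z := by
    simp only [ricci, (D.isLinearMap_curvature₃ g _ Y).map_smul, map_smul, LinearMap.smul_apply,
      smul_eq_mul]
    exact metricTrace_smul _ _ _

/-- Each of the four metric traces is taken of an expression bilinear in the traced slots, so the
frame formula applies to all of them. Taking `T` as a bundled bilinear map supplies its part of that
linearity. -/
lemma lichnerowicz_congr_of_frame {ι : Type*} [Fintype ι] (e : ι → D.p) (w : ι → ℝ)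
    (he : ∀ v, ∑ α, (w α * g (e α) v) • e α = v) (T : D.p →ₗ[ℝ] D.p →ₗ[ℝ] ℝ) (Z W : D.p) :
    D.lichnerowicz g (fun X Y => T X Y) Z W =
      ∑ α, w α * (-D.covDeriv₂ g (fun X Y => T X Y) (e α) (e α) Z W
        + D.ricci g Z (e α) * T (e α) W + T Z (e α) * D.ricci g (e α) W
        - 2 * T (D.curvature g (e α) Z W) (e α)) := by
  rw [lichnerowicz, metricTrace_eq_sum_of_frame g e w he, metricTrace_eq_sum_of_frame g e w he,
    metricTrace_eq_sum_of_frame g e w he, metricTrace_eq_sum_of_frame g e w he, Finset.mul_sum,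
    ← Finset.sum_neg_distrib, ← Finset.sum_add_distrib, ← Finset.sum_add_distrib,
    ← Finset.sum_sub_distrib]
  · refine Finset.sum_congr rfl fun α _ => ?_
    ring
  · intro Y
    constructor <;> intros <;>
      simp only [(D.isLinearMap_curvature₁ g Z W).map_add, (D.isLinearMap_curvature₁ g Z W).map_smul,
        map_add, map_smul, LinearMap.add_apply, LinearMap.smul_apply]
  · intro X
    exact (T _).isLinear
  · intro Y
    constructor <;> intros <;> simp only [map_add, map_smul, smul_eq_mul] <;> ring
  · intro X
    constructor <;> intros <;>
      simp only [(D.isLinearMap_ricci₁ g W).map_add, (D.isLinearMap_ricci₁ g W).map_smul,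
        smul_eq_mul] <;> ring
  · intro Y
    constructor <;> intros <;>
      simp only [(D.isLinearMap_ricci₂ g Z).map_add, (D.isLinearMap_ricci₂ g Z).map_smul,
        smul_eq_mul] <;> ring
  · intro X
    constructor <;> intros <;>
      simp only [map_add, map_smul, smul_eq_mul, LinearMap.add_apply, LinearMap.smul_apply] <;> ring
  · intro Y
    constructor <;> intros <;>
      simp only [covDeriv₂, covDeriv, ← leviCivitaBilin_apply, map_add, map_smul, smul_eq_mul,
        LinearMap.add_apply, LinearMap.smul_apply] <;> ring
  · intro X
    constructor <;> intros <;>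
      simp only [covDeriv₂, covDeriv, ← leviCivitaBilin_apply, map_add, map_smul, smul_eq_mul,
        LinearMap.add_apply, LinearMap.smul_apply] <;> ring

lemma divergence_congr_of_frame {ι : Type*} [Fintype ι] (e : ι → D.p) (w : ι → ℝ)
    (he : ∀ v, ∑ α, (w α * g (e α) v) • e α = v) (T : D.p →ₗ[ℝ] D.p →ₗ[ℝ] ℝ) (Z : D.p) :
    D.divergence g (fun X Y => T X Y) Z =
      -∑ α, w α * D.covDeriv g (fun X Y => T X Y) (e α) (e α) Z := by
  rw [divergence, metricTrace_eq_sum_of_frame g e w he]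
  · intro Y
    constructor <;> intros <;>
      simp only [covDeriv, ← leviCivitaBilin_apply, map_add, map_smul, smul_eq_mul,
        LinearMap.add_apply, LinearMap.smul_apply] <;> ring
  · intro X
    constructor <;> intros <;>
      simp only [covDeriv, ← leviCivitaBilin_apply, map_add, map_smul, smul_eq_mul,
        LinearMap.add_apply, LinearMap.smul_apply] <;> ring

lemma ricci_eq_sum_of_frame {ι : Type*} [Fintype ι] (e : ι → D.p) (w : ι → ℝ)
    (he : ∀ v, ∑ α, (w α * g (e α) v) • e α = v) (Y Z : D.p) :
    D.ricci g Y Z = ∑ α, w α * g (D.curvature g (e α) Y Z) (e α) := by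
  rw [ricci, metricTrace_eq_sum_of_frame g e w he]
  · intro W
    constructor <;> intros <;>
      simp only [(D.isLinearMap_curvature₁ g Y Z).map_add, (D.isLinearMap_curvature₁ g Y Z).map_smul,
        map_add, map_smul, LinearMap.add_apply, LinearMap.smul_apply]
  · intro X
    exact (g _).isLinear

lemma scal_eq_sum_of_frame {ι : Type*} [Fintype ι] (e : ι → D.p) (w : ι → ℝ)
    (he : ∀ v, ∑ α, (w α * g (e α) v) • e α = v) :
    D.scal g = ∑ α, w α * D.ricci g (e α) (e α) := by
  rw [scal, metricTrace_eq_sum_of_frame g e w he]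
  · exact D.isLinearMap_ricci₁ g
  · exact D.isLinearMap_ricci₂ g

end Multilinear

end ReductiveDecomposition
end

/-! ### Normal frames: Ricci curvature, divergence and Lichnerowicz Laplacian. -/

noncomputable section

namespace ReductiveDecomposition

/-- An orthonormal frame of `𝔭` for the standard metric, grouped into pairs labelled by `S`, whose
brackets satisfy Schur-type orthogonality relations. -/
structure NormalFrame {L : Type*} [LieRing L] [LieAlgebra ℝ L] (D : ReductiveDecomposition L)
    (S : Type*) [Fintype S] [DecidableEq S] where
  e : S × Fin 2 → D.p
  ν : S → S → ℝ
  lam : ℝ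
  μ : ℝ
  killing_k_p : ∀ Z : D.k, ∀ X : D.p, killingForm ℝ L (Z : L) (X : L) = 0
  ortho : ∀ α β, D.standardMetric (e α) (e β) = if α = β then 1 else 0
  expand : ∀ X, ∑ α, D.standardMetric (e α) X • e α = X
  bracketP : ∀ α β δ, D.standardMetric (D.lieP (e α) (e β)) (D.lieP (e α) (e δ)) =
    if β = δ then ν α.1 β.1 else 0
  bracketK : ∀ α β δ, killingForm ℝ L (D.lieK (e α) (e β) : L) (D.lieK (e α) (e δ) : L) =
    if β = δ ∧ α.1 = β.1 ∧ α ≠ β then -μ else 0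
  sum_ν : ∀ s, 2 * ∑ t, ν t s = lam

section Metric

variable {L : Type*} [LieRing L] [LieAlgebra ℝ L] (D : ReductiveDecomposition L)

lemma standardMetric_apply (X Y : D.p) :
    D.standardMetric X Y = -killingForm ℝ L (X : L) (Y : L) := by
  simp [standardMetric]

lemma standardMetric_comm (X Y : D.p) : D.standardMetric X Y = D.standardMetric Y X := by
  rw [standardMetric_apply, standardMetric_apply, LieModule.traceForm_comm]

end Metric

namespace NormalFrame

variable {L : Type*} [LieRing L] [LieAlgebra ℝ L] {D : ReductiveDecomposition L}
  {S : Type*} [Fintype S] [DecidableEq S] (F : D.NormalFrame S)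

/-- The structure constants of the bracket `[·, ·]_𝔭`. -/
def c (α β γ : S × Fin 2) : ℝ := D.standardMetric (D.lieP (F.e α) (F.e β)) (F.e γ)

include F in
lemma metric_lieP_left (X Y Z : D.p) :
    D.standardMetric (D.lieP X Y) Z = -killingForm ℝ L ⁅(X : L), (Y : L)⁆ (Z : L) := by
  rw [D.lie_eq_lieP_add_lieK, map_add, LinearMap.add_apply, F.killing_k_p, add_zero,
    standardMetric_apply]

-- Since `𝔨` and `𝔭` are Killing-orthogonal, projecting the bracket to `𝔭` does not change the
-- pairing, and invariance of the Killing form gives the cyclic symmetry. With skewness of the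
-- bracket this makes the constants `c` totally antisymmetric.
include F in
lemma metric_lieP_cyclic (X Y Z : D.p) :
    D.standardMetric (D.lieP X Y) Z = D.standardMetric (D.lieP Y Z) X := by
  rw [F.metric_lieP_left, F.metric_lieP_left, LieModule.traceForm_apply_lie_apply,
    LieModule.traceForm_comm]

lemma c_swap (α β γ : S × Fin 2) : F.c β α γ = -F.c α β γ := by
  simp [c, D.lieP_swap (F.e α) (F.e β)]

lemma c_cyclic (α β γ : S × Fin 2) : F.c β γ α = F.c α β γ :=
  (F.metric_lieP_cyclic _ _ _).symm

lemma c_swap_outer (α β γ : S × Fin 2) : F.c γ β α = -F.c α β γ := by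
  rw [← F.c_cyclic γ β α, c_swap, F.c_cyclic]

lemma c_swap_right (α β γ : S × Fin 2) : F.c α γ β = -F.c α β γ := by
  rw [← F.c_cyclic α γ β, c_swap_outer, F.c_cyclic]

lemma c_self (α γ : S × Fin 2) : F.c α α γ = 0 := by
  simp [c, lieP_self]

lemma c_self_outer (α γ : S × Fin 2) : F.c α γ α = 0 := by
  rw [← F.c_cyclic, ← F.c_cyclic, c_self]

lemma metric_eq_sum (X Y : D.p) :
    D.standardMetric X Y = ∑ α, D.standardMetric (F.e α) X * D.standardMetric (F.e α) Y := by
  conv_lhs => rw [← F.expand X]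
  simp only [map_sum, map_smul, LinearMap.sum_apply, LinearMap.smul_apply, smul_eq_mul]

lemma lieP_eq_sum (α β : S × Fin 2) : D.lieP (F.e α) (F.e β) = ∑ γ, F.c α β γ • F.e γ := by
  conv_lhs => rw [← F.expand (D.lieP (F.e α) (F.e β))]
  simp only [c, D.standardMetric_comm]

lemma sum_c_mul_c (γ β δ : S × Fin 2) :
    ∑ α, F.c γ β α * F.c γ δ α = if β = δ then F.ν γ.1 β.1 else 0 := by
  rw [← F.bracketP, F.metric_eq_sum]
  simp only [c, D.standardMetric_comm]

/-- Antisymmetry rewrites the sum over `α` as an inner product of two brackets with `e γ`, to which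
`bracketP` applies. The vanishing for `β ≠ δ` is the reason why Ricci and `Δ_L` stay diagonal in the
frame. -/
lemma sum_sum_c_mul_c (a : S × Fin 2 → ℝ) (β δ : S × Fin 2) :
    ∑ α, ∑ γ, a γ * (F.c α β γ * F.c α δ γ) = if β = δ then ∑ γ, a γ * F.ν γ.1 β.1 else 0 := by
  rw [Finset.sum_comm]
  have h : ∀ γ, ∑ α, a γ * (F.c α β γ * F.c α δ γ) =
      a γ * if β = δ then F.ν γ.1 β.1 else 0 := by
    intro γ
    rw [← F.sum_c_mul_c, Finset.mul_sum]
    refine Finset.sum_congr rfl fun α _ => ?_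
    rw [F.c_swap_outer γ β α, F.c_swap_outer γ δ α, neg_mul_neg]
  simp only [h]
  split_ifs <;> simp

lemma sum_ν_eq (s : S) : ∑ γ : S × Fin 2, F.ν γ.1 s = F.lam := by
  rw [← F.sum_ν s, Fintype.sum_prod_type, Finset.mul_sum]
  simp

lemma sum_sum_c_mul_c_one (β δ : S × Fin 2) :
    ∑ α, ∑ γ, F.c α β γ * F.c α δ γ = if β = δ then F.lam else 0 := by
  simpa [F.sum_ν_eq] using F.sum_sum_c_mul_c (fun _ => 1) β δ

lemma sum_bracketK (a : S → ℝ) (β δ : S × Fin 2) :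
    ∑ α, a α.1 * killingForm ℝ L (D.lieK (F.e α) (F.e β) : L) (D.lieK (F.e δ) (F.e α) : L) =
      if β = δ then a β.1 * F.μ else 0 := by
  -- Only one `α` contributes: the partner of `β` in its summand, written with addition in `Fin 2`.
  -- The sign comes from reversing one bracket in `bracketK`.
  have h : ∀ α : S × Fin 2,
      a α.1 * killingForm ℝ L (D.lieK (F.e α) (F.e β) : L) (D.lieK (F.e δ) (F.e α) : L) =
      if β = δ then (if α = (β.1, β.2 + 1) then a β.1 * F.μ else 0) else 0 := by
    intro α
    rw [D.lieK_swap (F.e α) (F.e δ)]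
    simp only [NegMemClass.coe_neg, map_neg, F.bracketK]
    obtain ⟨s, i⟩ := α
    obtain ⟨t, j⟩ := β
    by_cases h1 : (t, j) = δ
    · by_cases h2 : s = t
      · subst h2
        fin_cases i <;> fin_cases j <;> simp [neg_ite]
      · simp [h2]
    · simp [h1]
  simp only [h]
  split_ifs <;> simp

lemma expand_one_mul (v : D.p) :
    ∑ α, ((1 : ℝ) * D.standardMetric (F.e α) v) • F.e α = v := by
  simp only [one_mul, F.expand]

lemma bilin_eq_sum (h : D.p → D.p → ℝ) (h₁ : ∀ Y, IsLinearMap ℝ fun X => h X Y)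
    (h₂ : ∀ X, IsLinearMap ℝ (h X)) (X Y : D.p) :
    h X Y = ∑ α, ∑ β, D.standardMetric (F.e α) X * (D.standardMetric (F.e β) Y *
      h (F.e α) (F.e β)) := by
  have e1 : h X Y = ∑ α, D.standardMetric (F.e α) X * h (F.e α) Y := by
    change (h₁ Y).mk' _ X = _
    conv_lhs => rw [← F.expand X]
    rw [map_sum]
    simp only [map_smul, smul_eq_mul, IsLinearMap.mk'_apply]
  rw [e1]
  refine Finset.sum_congr rfl fun α _ => ?_
  have e2 : h (F.e α) Y = ∑ β, D.standardMetric (F.e β) Y * h (F.e α) (F.e β) := by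
    change (h₂ (F.e α)).mk' _ Y = _
    conv_lhs => rw [← F.expand Y]
    rw [map_sum]
    simp only [map_smul, smul_eq_mul, IsLinearMap.mk'_apply]
  rw [e2, Finset.mul_sum]

lemma bilin_ext {h k : D.p → D.p → ℝ} (h₁ : ∀ Y, IsLinearMap ℝ fun X => h X Y)
    (h₂ : ∀ X, IsLinearMap ℝ (h X)) (k₁ : ∀ Y, IsLinearMap ℝ fun X => k X Y)
    (k₂ : ∀ X, IsLinearMap ℝ (k X)) (hk : ∀ α β, h (F.e α) (F.e β) = k (F.e α) (F.e β))
    (X Y : D.p) : h X Y = k X Y := by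
  rw [F.bilin_eq_sum h h₁ h₂, F.bilin_eq_sum k k₁ k₂]
  simp only [hk]

section Diagonal

variable (g : LinearMap.BilinForm ℝ D.p) (x : S × Fin 2 → ℝ)

lemma frame_of_diagonal (hx : ∀ α, x α ≠ 0)
    (hg : ∀ α v, g (F.e α) v = x α * D.standardMetric (F.e α) v) (v : D.p) :
    ∑ α, ((x α)⁻¹ * g (F.e α) v) • F.e α = v := by
  conv_rhs => rw [← F.expand v]
  refine Finset.sum_congr rfl fun α _ => ?_
  rw [hg, inv_mul_cancel_left₀ (hx α)]

lemma diagonal_apply_right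
    (hg : ∀ α v, g (F.e α) v = x α * D.standardMetric (F.e α) v) (Y : D.p) (γ : S × Fin 2) :
    g Y (F.e γ) = x γ * D.standardMetric (F.e γ) Y := by
  conv_lhs => rw [← F.expand Y]
  simp [LinearMap.sum_apply, hg, F.ortho, mul_comm]

variable [Module.Finite ℝ L]

/-- Total antisymmetry makes the three Koszul terms multiples of the same constant `c α β γ`. When
all `x` agree, the connection is half the bracket. -/
lemma leviCivita_of_diagonal (hx : ∀ α, x α ≠ 0)
    (hg : ∀ α v, g (F.e α) v = x α * D.standardMetric (F.e α) v) (α β : S × Fin 2) :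
    D.leviCivita g (F.e α) (F.e β) =
      ∑ γ, (F.c α β γ * (x γ + x β - x α) / (2 * x γ)) • F.e γ := by
  rw [leviCivita, metricRaise_eq_sum_of_frame g F.e (fun α => (x α)⁻¹)
    (F.frame_of_diagonal g x hx hg)]
  · refine Finset.sum_congr rfl fun γ _ => ?_
    congr 1
    rw [F.diagonal_apply_right g x hg, F.diagonal_apply_right g x hg, hg]
    rw [D.standardMetric_comm (F.e γ), D.standardMetric_comm (F.e β),
      D.standardMetric_comm (F.e α)]
    change (x γ)⁻¹ * ((x γ * F.c α β γ + x β * F.c γ α β + x α * F.c γ β α) / 2) = _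
    rw [← F.c_cyclic γ α β, F.c_swap_outer α β γ]
    have := hx γ
    field_simp
    ring
  · constructor <;> intros <;>
      simp only [lieP_add_left, lieP_smul_left, map_add, map_smul,
        LinearMap.add_apply, LinearMap.smul_apply, smul_eq_mul] <;> ring

/-- Invariance moves the isotropy term onto the Killing form of `𝔨`, where `bracketK` evaluates it.
That term is independent of `g`; only the coefficients `l` depend on the metric. -/
lemma metric_curvature (l : S × Fin 2 → S × Fin 2 → S × Fin 2 → ℝ)
    (hl : ∀ α β, D.leviCivita g (F.e α) (F.e β) = ∑ γ, l α β γ • F.e γ)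
    (α β δ ε : S × Fin 2) :
    D.standardMetric (F.e ε) (D.curvature g (F.e α) (F.e β) (F.e δ)) =
      ∑ γ, (l β δ γ * l α γ ε - l α δ γ * l β γ ε - F.c α β γ * l γ δ ε) +
        killingForm ℝ L (D.lieK (F.e α) (F.e β) : L) (D.lieK (F.e δ) (F.e ε) : L) := by
  have h1 : ∀ α γ ε, D.standardMetric (F.e ε) (D.leviCivita g (F.e α) (F.e γ)) = l α γ ε := by
    intro α γ ε
    simp [hl, F.ortho]
  have h2 : D.standardMetric (F.e ε) (D.isotropyTrilin (F.e α) (F.e β) (F.e δ)) =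
      -killingForm ℝ L (D.lieK (F.e α) (F.e β) : L) (D.lieK (F.e δ) (F.e ε) : L) := by
    rw [D.standardMetric_comm, standardMetric_apply, isotropyTrilin_apply]
    change -killingForm ℝ L ⁅(D.lieK (F.e α) (F.e β) : L), (F.e δ : L)⁆ (F.e ε : L) = _
    rw [LieModule.traceForm_apply_lie_apply, D.lie_eq_lieP_add_lieK, map_add, F.killing_k_p,
      zero_add]
  rw [curvature_eq, map_sub, map_sub, map_sub, h2, sub_neg_eq_add]
  simp only [leviCivitaBilin_apply, hl, lieP_eq_sum]
  simp only [← leviCivitaBilin_apply, map_sum, map_smul, LinearMap.sum_apply, LinearMap.smul_apply]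
  simp only [leviCivitaBilin_apply, h1, smul_eq_mul, Finset.sum_sub_distrib]

end Diagonal

lemma tensorOf_frame (A : Module.End ℝ D.p) (a : S → ℝ) (hA : ∀ α, A (F.e α) = a α.1 • F.e α)
    (α : S × Fin 2) (v : D.p) :
    (D.standardMetric ∘ₗ A) (F.e α) v = a α.1 * D.standardMetric (F.e α) v := by
  simp [hA]

lemma tensorOf_frame_right (A : Module.End ℝ D.p) (a : S → ℝ)
    (hA : ∀ α, A (F.e α) = a α.1 • F.e α) (Y : D.p) (γ : S × Fin 2) :
    (D.standardMetric ∘ₗ A) Y (F.e γ) = a γ.1 * D.standardMetric (F.e γ) Y :=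
  F.diagonal_apply_right (D.standardMetric ∘ₗ A) (fun α => a α.1) (F.tensorOf_frame A a hA) Y γ

variable [Module.Finite ℝ L]

lemma leviCivita_standardMetric (α β : S × Fin 2) :
    D.leviCivita D.standardMetric (F.e α) (F.e β) = ∑ γ, (F.c α β γ / 2) • F.e γ := by
  rw [F.leviCivita_of_diagonal D.standardMetric (fun _ => 1) (fun _ => one_ne_zero) (by simp)]
  simp

/-- One contraction serves twice: `a = 1` gives the Ricci tensor, and general `a` gives the
curvature term of the Lichnerowicz Laplacian. -/
lemma sum_metric_curvature (a : S → ℝ) (β δ : S × Fin 2) :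
    ∑ α, a α.1 * D.standardMetric (F.e α)
        (D.curvature D.standardMetric (F.e α) (F.e β) (F.e δ)) =
      if β = δ then (∑ γ : S × Fin 2, a γ.1 * F.ν γ.1 β.1) / 4 + a β.1 * F.μ else 0 := by
  simp only [F.metric_curvature _ _ F.leviCivita_standardMetric, mul_add, Finset.sum_add_distrib,
    F.sum_bracketK]
  have h : ∀ α γ : S × Fin 2, a α.1 * (F.c β δ γ / 2 * (F.c α γ α / 2) -
      F.c α δ γ / 2 * (F.c β γ α / 2) - F.c α β γ * (F.c γ δ α / 2)) =
      a α.1 / 4 * (F.c γ β α * F.c γ δ α) := by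
    intro α γ
    rw [F.c_self_outer, F.c_cyclic α β γ, F.c_swap_outer α δ γ, F.c_swap_outer α β γ]
    ring
  simp only [Finset.mul_sum, h]
  rw [Finset.sum_comm, F.sum_sum_c_mul_c (fun α => a α.1 / 4)]
  split_ifs
  · rw [Finset.sum_div]
    congr 1
    refine Finset.sum_congr rfl fun γ _ => ?_
    ring
  · simp

theorem ricci_standardMetric (X Y : D.p) :
    D.ricci D.standardMetric X Y = (F.lam / 4 + F.μ) * D.standardMetric X Y := by
  refine F.bilin_ext (D.isLinearMap_ricci₁ _) (D.isLinearMap_ricci₂ _)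
    (k := fun X Y => (F.lam / 4 + F.μ) * D.standardMetric X Y) ?_ ?_ ?_ X Y
  · intro Y
    constructor <;> intros <;> simp <;> ring
  · intro Y
    constructor <;> intros <;> simp <;> ring
  · intro β δ
    have h := F.sum_metric_curvature (fun _ => 1) β δ
    simp only [one_mul, F.sum_ν_eq] at h
    rw [D.ricci_eq_sum_of_frame _ _ _ F.expand_one_mul]
    simp only [one_mul]
    rw [Finset.sum_congr rfl fun α _ => D.standardMetric_comm _ (F.e α), h, F.ortho]
    split_ifs <;> simp

section Tensor

variable (A : Module.End ℝ D.p) (a : S → ℝ) (hA : ∀ α, A (F.e α) = a α.1 • F.e α)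

lemma leviCivita_frame_self (α : S × Fin 2) :
    D.leviCivitaBilin D.standardMetric (F.e α) (F.e α) = 0 := by
  simp [leviCivitaBilin_apply, F.leviCivita_standardMetric, F.c_self]

lemma metric_leviCivita_frame (α β γ : S × Fin 2) :
    D.standardMetric (F.e γ) (D.leviCivitaBilin D.standardMetric (F.e α) (F.e β)) =
      F.c α β γ / 2 := by
  simp [leviCivitaBilin_apply, F.leviCivita_standardMetric, F.ortho]

lemma metric_leviCivita_leviCivita_frame (α β γ : S × Fin 2) :
    D.standardMetric (F.e γ) (D.leviCivitaBilin D.standardMetric (F.e α)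
      (D.leviCivitaBilin D.standardMetric (F.e α) (F.e β))) =
      -∑ ε, F.c α β ε * F.c α γ ε / 4 := by
  rw [D.leviCivitaBilin_apply _ _ (F.e β), F.leviCivita_standardMetric]
  simp only [map_sum, map_smul, metric_leviCivita_frame, smul_eq_mul, ← Finset.sum_neg_distrib]
  refine Finset.sum_congr rfl fun ε _ => ?_
  rw [F.c_swap_right α γ ε]
  ring

-- A tensor diagonal in the frame is divergence-free because `Λ(e_α)e_α = 0` and `c α γ α = 0`.
-- Hence only the trace condition restricts invariant TT-tensors.
include hA in
lemma divergence_tensorOf (Z : D.p) :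
    D.divergence D.standardMetric (D.tensorOf D.standardMetric A) Z = 0 := by
  have h := D.divergence_congr_of_frame _ _ _ F.expand_one_mul (D.standardMetric ∘ₗ A) Z
  change D.divergence D.standardMetric (fun X Y => (D.standardMetric ∘ₗ A) X Y) Z = 0
  rw [h, neg_eq_zero]
  refine Finset.sum_eq_zero fun α _ => ?_
  rw [one_mul, covDeriv, ← leviCivitaBilin_apply, ← leviCivitaBilin_apply,
    leviCivita_frame_self, F.tensorOf_frame A a hA]
  have h2 : D.standardMetric (F.e α) (D.leviCivitaBilin D.standardMetric (F.e α) Z) = 0 := by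
    conv_lhs => rw [← F.expand Z]
    simp [F.metric_leviCivita_frame, F.c_self_outer]
  simp [h2]

include hA in
lemma covDeriv₂_tensorOf (α β δ : S × Fin 2) :
    D.covDeriv₂ D.standardMetric (fun X Y => (D.standardMetric ∘ₗ A) X Y)
        (F.e α) (F.e α) (F.e β) (F.e δ) =
      ∑ γ, (a γ.1 / 2 - (a β.1 + a δ.1) / 4) * (F.c α β γ * F.c α δ γ) := by
  have h1 : (D.standardMetric ∘ₗ A) (D.leviCivitaBilin D.standardMetric (F.e α) (F.e β))
      (D.leviCivitaBilin D.standardMetric (F.e α) (F.e δ)) =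
      ∑ γ, a γ.1 * (F.c α β γ * F.c α δ γ) / 4 := by
    rw [D.leviCivitaBilin_apply _ _ (F.e δ), F.leviCivita_standardMetric]
    simp only [map_sum, map_smul, F.tensorOf_frame_right A a hA, metric_leviCivita_frame,
      smul_eq_mul]
    refine Finset.sum_congr rfl fun ε _ => ?_
    ring
  simp only [covDeriv₂, covDeriv, ← leviCivitaBilin_apply, leviCivita_frame_self, map_zero,
    LinearMap.zero_apply, F.tensorOf_frame_right A a hA, F.tensorOf_frame A a hA,
    metric_leviCivita_leviCivita_frame]
  rw [h1]
  simp only [mul_zero, sub_zero, neg_zero, zero_sub, neg_neg, Finset.mul_sum, mul_neg,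
    ← Finset.sum_neg_distrib, ← Finset.sum_sub_distrib]
  refine Finset.sum_congr rfl fun ε _ => ?_
  ring

-- Write `N` for `2 ∑ t, ν t s * a t`. The rough Laplacian contributes `(lam * a s - N)/2`, the two
-- Ricci terms `(lam/2 + 2μ) * a s`, and the curvature term `-N/2 - 2μ * a s`; the isotropy constant
-- `μ` cancels.
include hA in
theorem lichnerowicz_tensorOf (A' : Module.End ℝ D.p)
    (hA' : ∀ α, A' (F.e α) = (F.lam * a α.1 - 2 * ∑ t, F.ν t α.1 * a t) • F.e α) (X Y : D.p) :
    D.lichnerowicz D.standardMetric (D.tensorOf D.standardMetric A) X Y =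
      D.standardMetric (A' X) Y := by
  have h := D.lichnerowicz_congr_of_frame _ _ _ F.expand_one_mul (D.standardMetric ∘ₗ A)
  change D.lichnerowicz D.standardMetric (fun X Y => (D.standardMetric ∘ₗ A) X Y) X Y = _
  refine F.bilin_ext (h := D.lichnerowicz D.standardMetric
    (fun X Y => (D.standardMetric ∘ₗ A) X Y)) (k := fun X Y => D.standardMetric (A' X) Y)
    ?_ ?_ ?_ ?_ ?_ X Y
  · intro W
    constructor <;> intros <;>
      simp only [h, covDeriv₂, covDeriv, ← leviCivitaBilin_apply, map_add, map_smul,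
        LinearMap.add_apply, LinearMap.smul_apply, (D.isLinearMap_ricci₁ _ _).map_add,
        (D.isLinearMap_ricci₁ _ _).map_smul, (D.isLinearMap_curvature₂ _ _ _).map_add,
        (D.isLinearMap_curvature₂ _ _ _).map_smul, smul_eq_mul, Finset.mul_sum,
        ← Finset.sum_add_distrib] <;>
      refine Finset.sum_congr rfl fun α _ => ?_ <;> ring
  · intro W
    constructor <;> intros <;>
      simp only [h, covDeriv₂, covDeriv, ← leviCivitaBilin_apply, map_add, map_smul,
        LinearMap.add_apply, LinearMap.smul_apply, (D.isLinearMap_ricci₂ _ _).map_add,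
        (D.isLinearMap_ricci₂ _ _).map_smul, (D.isLinearMap_curvature₃ _ _ _).map_add,
        (D.isLinearMap_curvature₃ _ _ _).map_smul, smul_eq_mul, Finset.mul_sum,
        ← Finset.sum_add_distrib] <;>
      refine Finset.sum_congr rfl fun α _ => ?_ <;> ring
  · intro W
    constructor <;> intros <;> simp
  · intro W
    constructor <;> intros <;> simp
  · intro β δ
    rw [h]
    simp only [one_mul, F.covDeriv₂_tensorOf A a hA, F.ricci_standardMetric,
      F.tensorOf_frame_right A a hA, F.ortho, hA', map_smul,
      LinearMap.smul_apply, smul_eq_mul, Finset.sum_add_distrib, Finset.sum_sub_distrib,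
      Finset.sum_neg_distrib, ← Finset.mul_sum, F.sum_metric_curvature]
    have e1 : ∑ α, ∑ γ, (a γ.1 / 2 - (a β.1 + a δ.1) / 4) * (F.c α β γ * F.c α δ γ) = 
        if β = δ then (∑ γ : S × Fin 2, a γ.1 * F.ν γ.1 β.1) / 2 - a β.1 * F.lam / 2 else 0 := by
      rw [F.sum_sum_c_mul_c (fun γ => a γ.1 / 2 - (a β.1 + a δ.1) / 4)]
      split_ifs with hh
      · subst hh
        rw [← F.sum_ν_eq β.1, Finset.mul_sum, Finset.sum_div, Finset.sum_div,
          ← Finset.sum_sub_distrib]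
        refine Finset.sum_congr rfl fun ε _ => ?_
        ring
      · rfl
    have e2 : 2 * ∑ t, F.ν t β.1 * a t = ∑ γ : S × Fin 2, a γ.1 * F.ν γ.1 β.1 := by
      rw [Fintype.sum_prod_type, Finset.mul_sum]
      simp [mul_comm]
    rw [e1, e2]
    by_cases hh : β = δ
    · subst hh
      simp
      ring
    · simp [hh, Ne.symm hh]

end Tensor

end NormalFrame

end ReductiveDecomposition
end

/-! ### Scalar curvature of diagonal metrics and its second variation. -/

noncomputable section

lemma hasDerivAt_sum_exp {I : Type*} [Fintype I] (k u v : I → ℝ) :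
    HasDerivAt (fun t : ℝ => ∑ i, k i * Real.exp (u i + t * v i))
      (∑ i, k i * (Real.exp (u i) * v i)) 0 := by
  refine HasDerivAt.fun_sum fun i _ => ?_
  have h1 : HasDerivAt (fun t : ℝ => u i + t * v i) (v i) 0 := by
    simpa using ((hasDerivAt_id (0 : ℝ)).mul_const (v i)).const_add (u i)
  simpa using h1.exp.const_mul (k i)

/-- In logarithmic coordinates the scalar curvature is a sum of exponentials of linear forms, so its
Hessian at the origin is the polarized quadratic form with the same coefficients. -/
lemma deriv_deriv_sum_exp {I : Type*} [Fintype I] (k u v : I → ℝ) :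
    deriv (fun s : ℝ => deriv (fun t : ℝ => ∑ i, k i * Real.exp (s * u i + t * v i)) 0) 0 =
      ∑ i, k i * (u i * v i) := by
  have h1 : (fun s : ℝ => deriv (fun t : ℝ => ∑ i, k i * Real.exp (s * u i + t * v i)) 0) =
      fun s : ℝ => ∑ i, k i * v i * Real.exp (0 + s * u i) := by
    funext s
    rw [(hasDerivAt_sum_exp k (fun i => s * u i) v).deriv]
    refine Finset.sum_congr rfl fun i _ => ?_
    rw [zero_add]
    ring
  rw [h1, (hasDerivAt_sum_exp (fun i => k i * v i) (fun _ => 0) u).deriv]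
  refine Finset.sum_congr rfl fun i _ => ?_
  rw [Real.exp_zero]
  ring

namespace ReductiveDecomposition

namespace NormalFrame

variable {L : Type*} [LieRing L] [LieAlgebra ℝ L] {D : ReductiveDecomposition L}
  {S : Type*} [Fintype S] [DecidableEq S] (F : D.NormalFrame S)

lemma sum_c_sq_swap_outer (f : S × Fin 2 → S × Fin 2 → S × Fin 2 → ℝ) :
    ∑ α, ∑ β, ∑ γ, F.c α β γ ^ 2 * f α β γ = ∑ α, ∑ β, ∑ γ, F.c α β γ ^ 2 * f γ β α := by
  rw [Finset.sum_comm]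
  conv_rhs => rw [Finset.sum_comm]
  refine Finset.sum_congr rfl fun β _ => ?_
  rw [Finset.sum_comm]
  refine Finset.sum_congr rfl fun γ _ => Finset.sum_congr rfl fun α _ => ?_
  rw [F.c_swap_outer γ β α, neg_sq]

lemma sum_c_sq_swap_right (f : S × Fin 2 → S × Fin 2 → S × Fin 2 → ℝ) :
    ∑ α, ∑ β, ∑ γ, F.c α β γ ^ 2 * f α β γ = ∑ α, ∑ β, ∑ γ, F.c α β γ ^ 2 * f α γ β := by
  refine Finset.sum_congr rfl fun α _ => ?_
  rw [Finset.sum_comm]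
  refine Finset.sum_congr rfl fun γ _ => Finset.sum_congr rfl fun β _ => ?_
  rw [F.c_swap_right α γ β, neg_sq]

lemma sum_c_sq_mul_right (a : S × Fin 2 → ℝ) :
    ∑ α, ∑ β, ∑ γ, F.c α β γ ^ 2 * a β = F.lam * ∑ β, a β := by
  rw [Finset.sum_comm, Finset.mul_sum]
  refine Finset.sum_congr rfl fun β _ => ?_
  have h := F.sum_sum_c_mul_c_one β β
  rw [if_pos rfl] at h
  rw [← h, Finset.sum_mul]
  refine Finset.sum_congr rfl fun α _ => ?_
  rw [Finset.sum_mul]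
  refine Finset.sum_congr rfl fun γ _ => ?_
  ring

lemma sum_c_sq_mul_mul (a b : S × Fin 2 → ℝ) :
    ∑ α, ∑ β, ∑ γ, F.c α β γ ^ 2 * (a γ * b β) = ∑ β, (∑ γ, a γ * F.ν γ.1 β.1) * b β := by
  rw [Finset.sum_comm]
  refine Finset.sum_congr rfl fun β _ => ?_
  have h := F.sum_sum_c_mul_c a β β
  rw [if_pos rfl] at h
  rw [← h, Finset.sum_mul]
  refine Finset.sum_congr rfl fun α _ => ?_
  rw [Finset.sum_mul]
  refine Finset.sum_congr rfl fun γ _ => ?_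
  ring

lemma sum_c_sq_mul_left (a : S × Fin 2 → ℝ) :
    ∑ α, ∑ β, ∑ γ, F.c α β γ ^ 2 * a α = F.lam * ∑ β, a β := by
  rw [← F.sum_c_sq_mul_right a, F.sum_c_sq_swap_outer (fun α β γ => a β),
    F.sum_c_sq_swap_outer (fun α β γ => a α), F.sum_c_sq_swap_right (fun α β γ => a γ)]

lemma sum_c_sq_mul_last (a : S × Fin 2 → ℝ) :
    ∑ α, ∑ β, ∑ γ, F.c α β γ ^ 2 * a γ = F.lam * ∑ β, a β := by
  rw [← F.sum_c_sq_mul_right a, F.sum_c_sq_swap_right (fun α β γ => a γ)]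

variable [Module.Finite ℝ L]

/-- This has the shape of the Wang–Ziller formula: one inverse term for each frame direction and one
cubic interaction term. Squaring the antisymmetric `c` gives a symmetric weight, which allows the
summation indices to be permuted. -/
theorem scal_of_diagonal (g : LinearMap.BilinForm ℝ D.p) (x : S × Fin 2 → ℝ)
    (hx : ∀ α, x α ≠ 0) (hg : ∀ α v, g (F.e α) v = x α * D.standardMetric (F.e α) v) :
    D.scal g = (F.μ + F.lam / 2) * ∑ β, (x β)⁻¹ -
      1 / 4 * ∑ α, ∑ β, ∑ γ, F.c α β γ ^ 2 * (x γ * (x α)⁻¹ * (x β)⁻¹) := by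
  have hfr := F.frame_of_diagonal g x hx hg
  have hK : ∀ β, ∑ α, killingForm ℝ L (D.lieK (F.e α) (F.e β) : L)
      (D.lieK (F.e β) (F.e α) : L) = F.μ := by
    intro β
    simpa using F.sum_bracketK (fun _ => 1) β β
  have hr : ∀ β, D.ricci g (F.e β) (F.e β) = F.μ + ∑ α, ∑ γ, F.c α β γ ^ 2 *
      (-((x γ ^ 2 - (x α - x β) ^ 2) * (x α)⁻¹ * (x γ)⁻¹) / 4 +
        (x α + x β - x γ) * (x α)⁻¹ / 2) := by
    intro β
    rw [D.ricci_eq_sum_of_frame g F.e _ hfr, ← hK β, ← Finset.sum_add_distrib]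
    refine Finset.sum_congr rfl fun α _ => ?_
    rw [F.diagonal_apply_right g x hg, inv_mul_cancel_left₀ (hx α),
      F.metric_curvature g _ (F.leviCivita_of_diagonal g x hx hg), add_comm]
    congr 1
    refine Finset.sum_congr rfl fun γ _ => ?_
    rw [F.c_self, F.c_cyclic α β γ, F.c_swap_outer α β γ]
    have h1 := hx α
    have h2 := hx γ
    field_simp
    ring
  rw [D.scal_eq_sum_of_frame g F.e _ hfr]
  -- The summand is arranged so that its third and fourth terms cancel under exchanging `α` and `γ`,
  -- and its last two under exchanging `β` and `γ`. The first two give the stated formula.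
  have h1 : ∑ β, (x β)⁻¹ * D.ricci g (F.e β) (F.e β) = F.μ * ∑ β, (x β)⁻¹ +
      ∑ α, ∑ β, ∑ γ, (F.c α β γ ^ 2 * ((x β)⁻¹ / 2)
        - 1 / 4 * (F.c α β γ ^ 2 * (x γ * (x α)⁻¹ * (x β)⁻¹))
        + F.c α β γ ^ 2 * ((x α)⁻¹ / 2 + x α * (x β)⁻¹ * (x γ)⁻¹ / 4)
        - F.c α β γ ^ 2 * ((x γ)⁻¹ / 2 + x γ * (x β)⁻¹ * (x α)⁻¹ / 4)
        + F.c α β γ ^ 2 * (x β * (x α)⁻¹ * (x γ)⁻¹ / 4)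
        - F.c α β γ ^ 2 * (x γ * (x α)⁻¹ * (x β)⁻¹ / 4)) := by
    rw [Finset.sum_comm (f := fun α β => ∑ γ, _), Finset.mul_sum, ← Finset.sum_add_distrib]
    refine Finset.sum_congr rfl fun β _ => ?_
    rw [hr, mul_add, mul_comm F.μ, Finset.mul_sum]
    congr 1
    refine Finset.sum_congr rfl fun α _ => ?_
    rw [Finset.mul_sum]
    refine Finset.sum_congr rfl fun γ _ => ?_
    have h1 := hx α
    have h2 := hx γ
    have h3 := hx β
    field_simp
    ring
  have h2 := F.sum_c_sq_swap_outer fun α β γ => (x α)⁻¹ / 2 + x α * (x β)⁻¹ * (x γ)⁻¹ / 4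
  have h3 := F.sum_c_sq_swap_right fun α β γ => x β * (x α)⁻¹ * (x γ)⁻¹ / 4
  have h4 := F.sum_c_sq_mul_right fun β => (x β)⁻¹ / 2
  rw [h1]
  simp only [Finset.sum_add_distrib, Finset.sum_sub_distrib, ← Finset.mul_sum]
  rw [← Finset.sum_div] at h4
  rw [h2, h3, h4]
  ring

lemma scalExp_of_diagonal (A : Module.End ℝ D.p) (a : S × Fin 2 → ℝ)
    (hA : ∀ α, A (F.e α) = a α • F.e α) :
    D.scalExp D.standardMetric A = (F.μ + F.lam / 2) * ∑ β, Real.exp (-a β) -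
      1 / 4 * ∑ α, ∑ β, ∑ γ, F.c α β γ ^ 2 * Real.exp (a γ - a α - a β) := by
  rw [scalExp, F.scal_of_diagonal _ (fun α => Real.exp (a α)) fun α => (Real.exp_pos _).ne']
  · simp only [Real.exp_sub, Real.exp_neg, div_eq_mul_inv]
  · intro α v
    simp [expEnd_apply_of_apply_eq_smul A _ _ (hA α)]

/-- Coefficients of the exponentials in `scalExp_of_diagonal`. -/
def expCoeff : S × Fin 2 ⊕ (S × Fin 2) × (S × Fin 2) × (S × Fin 2) → ℝ :=
  Sum.elim (fun _ => F.μ + F.lam / 2) fun i => -(1 / 4) * F.c i.1 i.2.1 i.2.2 ^ 2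

/-- Exponents of the exponentials in `scalExp_of_diagonal`. -/
def expWeight (a : S × Fin 2 → ℝ) :
    S × Fin 2 ⊕ (S × Fin 2) × (S × Fin 2) × (S × Fin 2) → ℝ :=
  Sum.elim (fun β => -a β) fun i => a i.2.2 - a i.1 - a i.2.1

lemma scalExp_smul_add_smul (A B : Module.End ℝ D.p) (a b : S → ℝ)
    (hA : ∀ α, A (F.e α) = a α.1 • F.e α) (hB : ∀ α, B (F.e α) = b α.1 • F.e α) (s t : ℝ) :
    D.scalExp D.standardMetric (s • A + t • B) = ∑ i, F.expCoeff i *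
      Real.exp (s * expWeight (fun α => a α.1) i + t * expWeight (fun α => b α.1) i) := by
  rw [F.scalExp_of_diagonal _ fun α => s * a α.1 + t * b α.1, Fintype.sum_sum_type,
    Fintype.sum_prod_type (f := fun i : (S × Fin 2) × (S × Fin 2) × (S × Fin 2) => _)]
  · simp only [Fintype.sum_prod_type (f := fun i : (S × Fin 2) × (S × Fin 2) => _), expCoeff,
      expWeight, Sum.elim_inl, Sum.elim_inr]
    rw [sub_eq_add_neg, Finset.mul_sum, Finset.mul_sum, ← Finset.sum_neg_distrib]
    congr 1
    · refine Finset.sum_congr rfl fun β _ => ?_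
      congr 2
      ring
    · refine Finset.sum_congr rfl fun α _ => ?_
      rw [Finset.mul_sum, ← Finset.sum_neg_distrib]
      refine Finset.sum_congr rfl fun β _ => ?_
      rw [Finset.mul_sum, ← Finset.sum_neg_distrib]
      refine Finset.sum_congr rfl fun γ _ => ?_
      rw [neg_mul, neg_mul, mul_assoc]
      congr 4
      ring
  · intro α
    simp [hA, hB, smul_smul, add_smul]

/-- To first order each part of the exponential sum is a constant multiple of the total of `a`,
because `∑ c²` with one index fixed is `lam` whichever index is fixed. Tracelessness then kills the
derivative. -/
theorem hasDerivAt_scalExp (A : Module.End ℝ D.p) (a : S → ℝ)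
    (hA : ∀ α, A (F.e α) = a α.1 • F.e α) (h0 : ∑ s, a s = 0) :
    HasDerivAt (fun t : ℝ => D.scalExp D.standardMetric (t • A)) 0 0 := by
  have h1 : (fun t : ℝ => D.scalExp D.standardMetric (t • A)) = fun t => ∑ i, F.expCoeff i *
      Real.exp (0 + t * expWeight (fun α => a α.1) i) := by
    funext t
    have h := F.scalExp_smul_add_smul A A a a hA hA 0 t
    simpa using h
  have h2 : ∑ α : S × Fin 2, a α.1 = 0 := by
    rw [Fintype.sum_prod_type]
    simp [← Finset.mul_sum, h0]
  rw [h1]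
  refine (hasDerivAt_sum_exp F.expCoeff (fun _ => 0) _).congr_deriv ?_
  rw [Fintype.sum_sum_type,
    Fintype.sum_prod_type (f := fun i : (S × Fin 2) × (S × Fin 2) × (S × Fin 2) => _)]
  simp only [Fintype.sum_prod_type (f := fun i : (S × Fin 2) × (S × Fin 2) => _), expCoeff,
      expWeight, Sum.elim_inl, Sum.elim_inr, Real.exp_zero, one_mul, mul_assoc, mul_sub,
      ← Finset.mul_sum, Finset.sum_sub_distrib, F.sum_c_sq_mul_last fun α => a α.1,
      F.sum_c_sq_mul_left fun α => a α.1, F.sum_c_sq_mul_right fun α => a α.1,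
      Finset.sum_neg_distrib, h2]
  simp

/-- Expanding `(a_γ - a_α - a_β)(b_γ - b_α - b_β)` gives three diagonal terms, each contributing
`lam`, and six mixed terms that agree up to sign after permuting indices, with signs adding to `-2`.
The two frame vectors per label double the result. Since `lam/2 + 2μ` is twice the Einstein
constant, the Hessian is the form `2ρ - L` on label vectors. -/
theorem hess_eq (A B : Module.End ℝ D.p) (a b : S → ℝ)
    (hA : ∀ α, A (F.e α) = a α.1 • F.e α) (hB : ∀ α, B (F.e α) = b α.1 • F.e α) :
    D.hess D.standardMetric A B = ∑ s, ((F.lam / 2 + 2 * F.μ) * a s -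
      (F.lam * a s - 2 * ∑ t, F.ν t s * a t)) * b s := by
  simp only [hess, F.scalExp_smul_add_smul A B a b hA hB]
  rw [deriv_deriv_sum_exp, Fintype.sum_sum_type,
    Fintype.sum_prod_type (f := fun i : (S × Fin 2) × (S × Fin 2) × (S × Fin 2) => _)]
  have h1 : ∀ α β γ : S × Fin 2, F.c α β γ ^ 2 * ((a γ.1 - a α.1 - a β.1) *
      (b γ.1 - b α.1 - b β.1)) = F.c α β γ ^ 2 * (a γ.1 * b γ.1) + F.c α β γ ^ 2 * (a α.1 * b α.1)
      + F.c α β γ ^ 2 * (a β.1 * b β.1) - F.c α β γ ^ 2 * (a γ.1 * b α.1)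
      - F.c α β γ ^ 2 * (a γ.1 * b β.1) - F.c α β γ ^ 2 * (a α.1 * b γ.1)
      - F.c α β γ ^ 2 * (a β.1 * b γ.1) + F.c α β γ ^ 2 * (a α.1 * b β.1)
      + F.c α β γ ^ 2 * (a β.1 * b α.1) := by
    intro α β γ
    ring
  have e1 := F.sum_c_sq_swap_right fun α β γ => a β.1 * b γ.1
  have e2 := F.sum_c_sq_swap_outer fun α β γ => a α.1 * b β.1
  have e3 := F.sum_c_sq_swap_outer fun α β γ => a β.1 * b α.1
  have e4 := F.sum_c_sq_swap_outer fun α β γ => a γ.1 * b α.1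
  have e5 := F.sum_c_sq_swap_right fun α β γ => a α.1 * b γ.1
  simp only [Fintype.sum_prod_type (f := fun i : (S × Fin 2) × (S × Fin 2) => _), expCoeff,
      expWeight, Sum.elim_inl, Sum.elim_inr, mul_assoc, h1,
      ← Finset.mul_sum, Finset.sum_sub_distrib, Finset.sum_add_distrib,
      F.sum_c_sq_mul_last fun α => a α.1 * b α.1,
      F.sum_c_sq_mul_left fun α => a α.1 * b α.1, F.sum_c_sq_mul_right fun α => a α.1 * b α.1,
      neg_mul_neg]
  rw [e4, e5, e3, e1, e2, F.sum_c_sq_mul_mul (fun α => a α.1) fun α => b α.1]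
  simp only [Fintype.sum_prod_type, Finset.sum_const, Finset.card_univ, Fintype.card_fin,
    nsmul_eq_mul, Finset.mul_sum, ← Finset.sum_add_distrib, ← Finset.sum_sub_distrib]
  refine Finset.sum_congr rfl fun s _ => ?_
  simp only [Nat.cast_ofNat, mul_comm (F.ν _ s)]
  ring

end NormalFrame

end ReductiveDecomposition
end

/-! ### The Killing form of the orthogonal Lie algebra. -/

noncomputable section

namespace SO2nFlag

open Matrix ReductiveDecomposition
open scoped Kronecker

attribute [local instance] LieRing.ofAssociativeRing

lemma trace_end_matrix {m : Type*} [Fintype m] [DecidableEq m] (f : Module.End ℝ (Matrix m m ℝ)) :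
    LinearMap.trace ℝ _ f = ∑ i, ∑ j, f (Matrix.single i j 1) i j := by
  rw [LinearMap.trace_eq_matrix_trace ℝ (Matrix.stdBasis ℝ m m), Matrix.trace,
    Fintype.sum_prod_type]
  refine Finset.sum_congr rfl fun i _ => Finset.sum_congr rfl fun j _ => ?_
  rw [Matrix.diag_apply, LinearMap.toMatrix_apply, Matrix.stdBasis_eq_single]
  rfl

lemma mul_single_mul_apply {m : Type*} [Fintype m] [DecidableEq m] (M N : Matrix m m ℝ)
    (i j a b : m) : (M * Matrix.single i j 1 * N : Matrix m m ℝ) a b = M a i * N j b := by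
  rw [Matrix.mul_apply, Finset.sum_eq_single j]
  · simp
  · intro k _ hk
    simp [Matrix.mul_single_apply_of_ne, hk]
  · simp

lemma so_transpose {m : Type*} [Fintype m] [DecidableEq m]
    (X : LieAlgebra.Orthogonal.so m ℝ) : X.1ᵀ = -X.1 :=
  (LieAlgebra.Orthogonal.mem_so _ _ _).1 X.2

/-- The Killing form of `𝔰𝔬(m)`. -/
lemma killingForm_so {m : Type*} [Fintype m] [DecidableEq m]
    (X Y : LieAlgebra.Orthogonal.so m ℝ) :
    killingForm ℝ (LieAlgebra.Orthogonal.so m ℝ) X Y =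
      ((Fintype.card m : ℝ) - 2) * (X.1 * Y.1).trace := by
  -- This is `ad X ∘ ad Y` precomposed with the skew projection `Z ↦ (Z - Zᵀ)/2`. Its range consists
  -- of skew matrices, so its trace on all matrices is the trace on `𝔰𝔬`, and the standard basis
  -- computes it. The factors `1` put every term in the form `M * Z * N` required by `hT`.
  let f : Module.End ℝ (Matrix m m ℝ) :=
    { toFun := fun Z => (1 / 2 : ℝ) • (X.1 * Y.1 * (Z - Zᵀ) * 1 - X.1 * (Z - Zᵀ) * Y.1
        - Y.1 * (Z - Zᵀ) * X.1 + 1 * (Z - Zᵀ) * (Y.1 * X.1))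
      map_add' := fun Z W => by
        simp only [transpose_add, Matrix.mul_add, Matrix.add_mul, Matrix.mul_sub, Matrix.sub_mul]
        module
      map_smul' := fun c Z => by
        simp only [transpose_smul, ← smul_sub, Matrix.mul_smul, Matrix.smul_mul, RingHom.id_apply]
        module }
  have hX := so_transpose X
  have hY := so_transpose Y
  have hf : ∀ Z, f Z ∈ (LieAlgebra.Orthogonal.so m ℝ).toSubmodule := by
    intro Z
    change _ ∈ LieAlgebra.Orthogonal.so m ℝ
    rw [LieAlgebra.Orthogonal.mem_so]
    simp only [f, LinearMap.coe_mk, AddHom.coe_mk, transpose_smul, transpose_add, transpose_sub,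
      transpose_mul, hX, hY, transpose_transpose, Matrix.mul_one, Matrix.one_mul]
    rw [← smul_neg]
    congr 1
    noncomm_ring
  have h1 : killingForm ℝ (LieAlgebra.Orthogonal.so m ℝ) X Y = LinearMap.trace ℝ _ f := by
    rw [LieModule.traceForm_apply_apply, ← LinearMap.trace_restrict_eq_of_forall_mem _ f hf]
    congr 1
    refine LinearMap.ext fun Z => Subtype.ext ?_
    have hZ := so_transpose Z
    change X.1 * (Y.1 * Z.1 - Z.1 * Y.1) - (Y.1 * Z.1 - Z.1 * Y.1) * X.1 =
      (1 / 2 : ℝ) • (X.1 * Y.1 * (Z.1 - Z.1ᵀ) * 1 - X.1 * (Z.1 - Z.1ᵀ) * Y.1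
        - Y.1 * (Z.1 - Z.1ᵀ) * X.1 + 1 * (Z.1 - Z.1ᵀ) * (Y.1 * X.1))
    rw [hZ, sub_neg_eq_add, ← two_smul ℝ Z.1]
    simp only [Matrix.mul_smul, Matrix.smul_mul, Matrix.mul_one, Matrix.one_mul, Matrix.mul_sub,
      Matrix.sub_mul, Matrix.mul_assoc]
    module
  have hX' : ∀ x y, X.1 y x = -X.1 x y := fun x y => congrFun (congrFun hX x) y
  have hY' : ∀ x y, Y.1 y x = -Y.1 x y := fun x y => congrFun (congrFun hY x) y
  have hT : ∀ M N : Matrix m m ℝ, ∀ i j,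
      (M * (Matrix.single i j 1 - Matrix.single j i 1) * N : Matrix m m ℝ) i j =
        M i i * N j j - M i j * N i j := by
    intro M N i j
    rw [Matrix.mul_sub, Matrix.sub_mul, Matrix.sub_apply, mul_single_mul_apply,
      mul_single_mul_apply]
  rw [h1, trace_end_matrix]
  simp only [f, LinearMap.coe_mk, AddHom.coe_mk, transpose_single, Matrix.smul_apply,
    Matrix.add_apply, Matrix.sub_apply, hT, smul_eq_mul]
  have hX0 : ∀ i, X.1 i i = 0 := fun i => by linarith [hX' i i]
  have hY0 : ∀ i, Y.1 i i = 0 := fun i => by linarith [hY' i i]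
  have e1 : (X.1 * Y.1).trace = ∑ i, (X.1 * Y.1) i i := rfl
  have e2 : (X.1 * Y.1).trace = ∑ i, (Y.1 * X.1) i i := Matrix.trace_mul_comm _ _
  have e3 : (X.1 * Y.1).trace = -∑ i, ∑ j, X.1 i j * Y.1 i j := by
    simp only [e1, Matrix.mul_apply, ← Finset.sum_neg_distrib]
    refine Finset.sum_congr rfl fun i _ => Finset.sum_congr rfl fun j _ => ?_
    rw [hY' i j]
    ring
  simp only [hX0, hY0, Matrix.one_apply_eq, mul_one, one_mul, zero_mul, zero_sub, sub_neg_eq_add,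
    Matrix.one_apply, mul_ite, ite_mul, mul_zero, ← Finset.mul_sum, Finset.sum_add_distrib,
    Finset.sum_sub_distrib, Finset.sum_ite_eq, Finset.mem_univ, if_true, Finset.sum_const,
    Finset.card_univ, nsmul_eq_mul, mul_comm (Y.1 _ _) (X.1 _ _)]
  rw [← e1, ← e2]
  linarith

end SO2nFlag
end

/-! ### Elementary skew matrices and coordinate-plane projections. -/

noncomputable section

namespace ReductiveDecomposition

variable {L : Type*} [LieRing L] [LieAlgebra ℝ L] (D : ReductiveDecomposition L)

lemma lieP_of_mem_p {X Y : D.p} (h : ⁅(X : L), (Y : L)⁆ ∈ D.p) : D.lieP X Y = ⟨_, h⟩ :=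
  Submodule.projectionOnto_apply_of_mem_left D.isCompl h

lemma lieP_of_mem_k {X Y : D.p} (h : ⁅(X : L), (Y : L)⁆ ∈ D.k) : D.lieP X Y = 0 :=
  Submodule.projectionOnto_apply_of_mem_right D.isCompl h

lemma lieK_of_mem_k {X Y : D.p} (h : ⁅(X : L), (Y : L)⁆ ∈ D.k) : D.lieK X Y = ⟨_, h⟩ :=
  Submodule.projectionOnto_apply_of_mem_left D.isCompl.symm h

lemma lieK_of_mem_p {X Y : D.p} (h : ⁅(X : L), (Y : L)⁆ ∈ D.p) : D.lieK X Y = 0 :=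
  Submodule.projectionOnto_apply_of_mem_right D.isCompl.symm h

end ReductiveDecomposition

namespace SO2nFlag

open Matrix ReductiveDecomposition
open scoped Kronecker

attribute [local instance] LieRing.ofAssociativeRing

variable {n : ℕ}

lemma killingForm_so2n (X Y : so2n n) :
    killingForm ℝ (so2n n) X Y = (2 * (n : ℝ) - 2) * (X.1 * Y.1).trace := by
  rw [killingForm_so]
  simp

lemma coe_lie (X Y : so2n n) : (⁅X, Y⁆ : so2n n).1 = X.1 * Y.1 - Y.1 * X.1 := rfl

lemma so2n_apply (X : so2n n) (x y : Idx n) : X.1 y x = -X.1 x y :=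
  congrFun (congrFun (so_transpose X) x) y

lemma trace_mul_self (X : so2n n) : (X.1 * X.1).trace = -∑ x, ∑ y, X.1 x y ^ 2 := by
  simp only [Matrix.trace, Matrix.diag_apply, Matrix.mul_apply, ← Finset.sum_neg_distrib]
  refine Finset.sum_congr rfl fun x _ => Finset.sum_congr rfl fun y _ => ?_
  rw [so2n_apply X x y]
  ring

lemma killingForm_self_neg (hn : 2 ≤ n) (X : so2n n) (hX : X ≠ 0) :
    killingForm ℝ (so2n n) X X < 0 := by
  rw [killingForm_so2n, trace_mul_self]
  have h1 : (2 : ℝ) ≤ n := by exact_mod_cast hn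
  have h2 : 0 < ∑ x, ∑ y, X.1 x y ^ 2 := by
    obtain ⟨x, y, hxy⟩ : ∃ x y, X.1 x y ≠ 0 := by
      by_contra! h
      exact hX (Subtype.ext (Matrix.ext h))
    refine Finset.sum_pos' (fun x _ => Finset.sum_nonneg fun y _ => sq_nonneg _)
      ⟨x, Finset.mem_univ x, Finset.sum_pos' (fun y _ => sq_nonneg _) ⟨y, Finset.mem_univ y, ?_⟩⟩
    positivity
  nlinarith

lemma killingForm_k_p (Z : (decomposition n).k) (X : (decomposition n).p) :
    killingForm ℝ (so2n n) Z X = 0 := by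
  rw [killingForm_so2n, Matrix.trace, Finset.sum_eq_zero, mul_zero]
  rintro ⟨a, i⟩ _
  rw [Matrix.diag_apply, Matrix.mul_apply]
  refine Finset.sum_eq_zero ?_
  rintro ⟨b, j⟩ _
  by_cases h : i = j
  · subst h
    rw [X.2 b a i, mul_zero]
  · rw [Z.2 a b i j h, zero_mul]

/-- For an element orthogonal to `𝔨`, the `𝔨`-component is orthogonal to itself, hence zero because
the Killing form is negative definite for `n ≥ 2`. -/
theorem p_eq_orthogonal (hn : 2 ≤ n) : (decomposition n).p =
    (killingForm ℝ (so2n n)).orthogonal (decomposition n).k.toSubmodule := by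
  refine le_antisymm ?_ ?_
  · intro X hX Z hZ
    exact killingForm_k_p ⟨Z, hZ⟩ ⟨X, hX⟩
  · intro X hX
    have hc := (decomposition n).isCompl.sup_eq_top
    obtain ⟨P, hP, Z, hZ, rfl⟩ := Submodule.mem_sup.1 (hc ▸ Submodule.mem_top (x := X))
    have h1 : killingForm ℝ (so2n n) Z (P + Z) = 0 := hX Z hZ
    rw [map_add, killingForm_k_p ⟨Z, hZ⟩ ⟨P, hP⟩, zero_add] at h1
    have h2 : Z = 0 := by
      by_contra h
      exact (killingForm_self_neg hn Z h).ne h1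
    rw [h2, add_zero]
    exact hP

theorem gB_pos (hn : 2 ≤ n) (X : (decomposition n).p) (hX : X ≠ 0) : 0 < gB n X X := by
  rw [standardMetric_apply, neg_pos]
  exact killingForm_self_neg hn _ fun h => hX (Subtype.ext h)

/-! #### Elementary elements of `𝔭` -/

/-- The skew-symmetric matrix with block `z` at `(i, j)` and block `-zᵀ` at `(j, i)`. -/
def pairMatrix (i j : Fin n) (z : Matrix (Fin 2) (Fin 2) ℝ) : Matrix (Idx n) (Idx n) ℝ :=
  z ⊗ₖ Matrix.single i j 1 - zᵀ ⊗ₖ Matrix.single j i 1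

lemma pairMatrix_apply (i j : Fin n) (z : Matrix (Fin 2) (Fin 2) ℝ) (a b : Fin 2) (k l : Fin n) :
    pairMatrix i j z (a, k) (b, l) =
      (if i = k ∧ j = l then z a b else 0) - if j = k ∧ i = l then z b a else 0 := by
  simp [pairMatrix, Matrix.kroneckerMap_apply, Matrix.single_apply]

lemma pairMatrix_apply_eq_zero {i j : Fin n} (z : Matrix (Fin 2) (Fin 2) ℝ) {x y : Idx n}
    (h : ({x.2, y.2} : Finset (Fin n)) ≠ {i, j}) : pairMatrix i j z x y = 0 := by
  obtain ⟨a, k⟩ := x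
  obtain ⟨b, l⟩ := y
  rw [pairMatrix_apply, if_neg, if_neg, sub_zero]
  · rintro ⟨rfl, rfl⟩
    exact h (Finset.pair_comm _ _)
  · rintro ⟨rfl, rfl⟩
    exact h rfl

lemma pairMatrix_transpose (i j : Fin n) (z : Matrix (Fin 2) (Fin 2) ℝ) :
    (pairMatrix i j z)ᵀ = -pairMatrix i j z := by
  ext ⟨a, k⟩ ⟨b, l⟩
  rw [Matrix.transpose_apply, Matrix.neg_apply, pairMatrix_apply, pairMatrix_apply]
  simp only [and_comm, neg_sub]

lemma pairMatrix_mul {i j : Fin n} (h : i ≠ j) (z w : Matrix (Fin 2) (Fin 2) ℝ) :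
    pairMatrix i j z * pairMatrix i j w =
      -((z * wᵀ) ⊗ₖ Matrix.single i i 1 + (zᵀ * w) ⊗ₖ Matrix.single j j 1) := by
  simp only [pairMatrix, Matrix.mul_sub, Matrix.sub_mul, ← Matrix.mul_kronecker_mul,
    Matrix.single_mul_single_same, Matrix.single_mul_single_of_ne _ _ _ _ h,
    Matrix.single_mul_single_of_ne _ _ _ _ h.symm, Matrix.kronecker_zero, mul_one]
  abel

/-- The orthogonal projection onto the coordinate planes in `S`. -/
def planeProj (S : Finset (Fin n)) : Matrix (Idx n) (Idx n) ℝ :=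
  Matrix.diagonal fun x => if x.2 ∈ S then 1 else 0

/-- An orthogonal block makes the elementary matrix a complex structure on the four-dimensional
space spanned by the planes `i` and `j`. All bracket computations rest on this. -/
lemma pairMatrix_mul_self {i j : Fin n} (h : i ≠ j) (z : Matrix (Fin 2) (Fin 2) ℝ)
    (hz : z * zᵀ = 1) : pairMatrix i j z * pairMatrix i j z = -planeProj {i, j} := by
  rw [pairMatrix_mul h, hz, mul_eq_one_comm.1 hz]
  congr 1
  ext ⟨a, k⟩ ⟨b, l⟩
  simp only [planeProj, Matrix.add_apply, Matrix.kroneckerMap_apply, Matrix.single_apply,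
    Matrix.diagonal_apply, Matrix.one_apply, Prod.mk.injEq, Finset.mem_insert,
    Finset.mem_singleton]
  by_cases ha : a = b
  · by_cases hk : k = l
    · subst hk
      by_cases h1 : i = k
      · subst h1
        simp [ha, h.symm]
      · simp [ha, h1, Ne.symm h1, eq_comm]
    · have h1 : ¬(i = k ∧ i = l) := fun h => hk (h.1.symm.trans h.2)
      have h2 : ¬(j = k ∧ j = l) := fun h => hk (h.1.symm.trans h.2)
      simp [hk, h1, h2]
  · simp [ha]

lemma planeProj_mul_apply (S : Finset (Fin n)) (M : Matrix (Idx n) (Idx n) ℝ) (x y : Idx n) :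
    (planeProj S * M) x y = if x.2 ∈ S then M x y else 0 := by
  simp [planeProj, Matrix.diagonal_mul]

lemma mul_planeProj_apply (S : Finset (Fin n)) (M : Matrix (Idx n) (Idx n) ℝ) (x y : Idx n) :
    (M * planeProj S) x y = if y.2 ∈ S then M x y else 0 := by
  simp [planeProj, Matrix.mul_diagonal]

lemma planeProj_mul_pairMatrix (i j : Fin n) (z : Matrix (Fin 2) (Fin 2) ℝ) :
    planeProj {i, j} * pairMatrix i j z = pairMatrix i j z := by
  ext x y
  rw [planeProj_mul_apply]
  split_ifs with h
  · rfl
  · rw [pairMatrix_apply_eq_zero]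
    intro h'
    exact h (h' ▸ Finset.mem_insert_self _ _)

lemma pairMatrix_mul_planeProj (i j : Fin n) (z : Matrix (Fin 2) (Fin 2) ℝ) :
    pairMatrix i j z * planeProj {i, j} = pairMatrix i j z := by
  ext x y
  rw [mul_planeProj_apply]
  split_ifs with h
  · rfl
  · rw [pairMatrix_apply_eq_zero]
    intro h'
    exact h (h' ▸ Finset.mem_insert_of_mem (Finset.mem_singleton_self _))

lemma card_inter_pair {S : Finset (Fin n)} {k l : Fin n} (h : k ≠ l) :
    (S ∩ {k, l}).card = (if k ∈ S then 1 else 0) + if l ∈ S then 1 else 0 := by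
  rw [Finset.inter_comm, ← Finset.filter_mem_eq_inter, Finset.card_filter, Finset.sum_pair h]

/-- Exactly one of `k`, `l` lies in `S`, so the matrix exchanges the planes in `S` with those
outside: it is off-diagonal for the splitting defined by the projection. -/
lemma planeProj_mul_add_mul_planeProj {S : Finset (Fin n)} {k l : Fin n} (h : k ≠ l)
    (hS : (S ∩ {k, l}).card = 1) (z : Matrix (Fin 2) (Fin 2) ℝ) :
    planeProj S * pairMatrix k l z + pairMatrix k l z * planeProj S = pairMatrix k l z := by
  rw [card_inter_pair h] at hS
  ext ⟨a, x⟩ ⟨b, y⟩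
  rw [Matrix.add_apply, planeProj_mul_apply, mul_planeProj_apply]
  by_cases hxy : ({x, y} : Finset (Fin n)) = {k, l}
  · have hne : x ≠ y := by
      rintro rfl
      have := congrArg Finset.card hxy
      rw [Finset.card_pair h] at this
      simp at this
    rw [← card_inter_pair h, ← hxy, card_inter_pair hne] at hS
    simp only
    split_ifs at hS ⊢ <;> simp_all
  · rw [pairMatrix_apply_eq_zero _ hxy]
    simp

lemma planeProj_mul_mul_planeProj {S : Finset (Fin n)} {k l : Fin n} (h : k ≠ l)
    (hS : (S ∩ {k, l}).card = 1) (z : Matrix (Fin 2) (Fin 2) ℝ) :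
    planeProj S * pairMatrix k l z * planeProj S = 0 := by
  have h1 := congrArg (planeProj S * ·) (planeProj_mul_add_mul_planeProj h hS z)
  have h2 : planeProj S * planeProj S = planeProj S := by
    simp [planeProj, Matrix.diagonal_mul_diagonal]
  simp only [Matrix.mul_add, ← Matrix.mul_assoc, h2] at h1
  simpa using h1

lemma planeProj_mul_pairMatrix_of_disjoint {S : Finset (Fin n)} {k l : Fin n} (h : k ≠ l)
    (hS : (S ∩ {k, l}).card = 0) (z : Matrix (Fin 2) (Fin 2) ℝ) :
    planeProj S * pairMatrix k l z = 0 ∧ pairMatrix k l z * planeProj S = 0 := by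
  rw [card_inter_pair h] at hS
  have hk : k ∉ S := by
    intro hk
    simp [hk] at hS
  have hl : l ∉ S := by
    intro hk
    simp [hk] at hS
  constructor
  · ext ⟨a, x⟩ ⟨b, y⟩
    rw [planeProj_mul_apply, pairMatrix_apply]
    have h1 : x ∈ S → k ≠ x := fun hx hk' => hk (hk' ▸ hx)
    have h2 : x ∈ S → l ≠ x := fun hx hk' => hl (hk' ▸ hx)
    by_cases hx : x ∈ S <;> simp [hx, h1, h2]
  · ext ⟨a, x⟩ ⟨b, y⟩
    rw [mul_planeProj_apply, pairMatrix_apply]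
    have h1 : y ∈ S → k ≠ y := fun hx hk' => hk (hk' ▸ hx)
    have h2 : y ∈ S → l ≠ y := fun hx hk' => hl (hk' ▸ hx)
    by_cases hx : y ∈ S <;> simp [hx, h1, h2]

/-- Products of elementary elements of different pairs have no diagonal blocks. -/
lemma pairMatrix_mul_apply_same {i j k l : Fin n} (h : ({i, j} : Finset (Fin n)) ≠ {k, l})
    (z w : Matrix (Fin 2) (Fin 2) ℝ) (a b : Fin 2) (m : Fin n) :
    (pairMatrix i j z * pairMatrix k l w) (a, m) (b, m) = 0 := by
  rw [Matrix.mul_apply]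
  refine Finset.sum_eq_zero fun x _ => ?_
  by_cases h1 : ({m, x.2} : Finset (Fin n)) = {i, j}
  · rw [pairMatrix_apply_eq_zero w, mul_zero]
    intro h2
    exact h (h1.symm.trans ((Finset.pair_comm _ _).trans h2))
  · rw [pairMatrix_apply_eq_zero z h1, zero_mul]

/-- Products of elementary elements of the same pair are block diagonal. -/
lemma pairMatrix_mul_apply_of_ne {i j : Fin n} (h : i ≠ j) (z w : Matrix (Fin 2) (Fin 2) ℝ)
    (a b : Fin 2) {m p : Fin n} (hm : m ≠ p) :
    (pairMatrix i j z * pairMatrix i j w) (a, m) (b, p) = 0 := by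
  rw [pairMatrix_mul h]
  have h1 : ¬(i = m ∧ i = p) := fun h => hm (h.1.symm.trans h.2)
  have h2 : ¬(j = m ∧ j = p) := fun h => hm (h.1.symm.trans h.2)
  simp [Matrix.kroneckerMap_apply, h1, h2]

lemma trace_pairMatrix_mul (i j : Fin n) (z : Matrix (Fin 2) (Fin 2) ℝ) (X : so2n n) :
    (pairMatrix i j z * X.1).trace = -2 * ∑ a, ∑ b, z a b * X.1 (a, i) (b, j) := by
  have h1 : ∀ (w : Matrix (Fin 2) (Fin 2) ℝ) (k l : Fin n),
      ((w ⊗ₖ Matrix.single k l 1) * X.1).trace = ∑ a, ∑ b, w a b * X.1 (b, l) (a, k) := by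
    intro w k l
    simp only [Matrix.trace, Matrix.diag_apply, Matrix.mul_apply, Fintype.sum_prod_type,
      Matrix.kroneckerMap_apply, Matrix.single_apply]
    refine Finset.sum_congr rfl fun a _ => ?_
    rw [Finset.sum_eq_single k]
    · refine Finset.sum_congr rfl fun b _ => ?_
      rw [Finset.sum_eq_single l] <;> simp +contextual [eq_comm]
    · intro m _ hm
      simp [Ne.symm hm]
    · simp
  rw [pairMatrix, Matrix.sub_mul, Matrix.trace_sub, h1, h1]
  simp only [Matrix.transpose_apply]
  rw [Finset.sum_comm (f := fun a b => z b a * _), neg_mul, two_mul, neg_add, sub_eq_add_neg]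
  congr 1
  simp only [← Finset.sum_neg_distrib]
  refine Finset.sum_congr rfl fun a _ => Finset.sum_congr rfl fun b _ => ?_
  rw [so2n_apply X (a, i) (b, j)]
  ring

lemma blockDiagonal_mul_kronecker_single (M : Fin n → Matrix (Fin 2) (Fin 2) ℝ)
    (z : Matrix (Fin 2) (Fin 2) ℝ) (i j : Fin n) :
    blockDiagonal M * (z ⊗ₖ Matrix.single i j (1 : ℝ)) =
      (M i * z) ⊗ₖ Matrix.single i j (1 : ℝ) := by
  ext ⟨a, k⟩ ⟨b, l⟩
  rw [Matrix.mul_apply, Fintype.sum_prod_type, Matrix.kroneckerMap_apply, Matrix.mul_apply,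
    Finset.sum_mul]
  refine Finset.sum_congr rfl fun c _ => ?_
  rw [Finset.sum_eq_single k]
  · rw [blockDiagonal_apply_eq, Matrix.kroneckerMap_apply, Matrix.single_apply]
    by_cases h : i = k
    · subst h
      ring
    · simp [h]
  · intro m _ hm
    rw [blockDiagonal_apply_ne _ _ _ (Ne.symm hm), zero_mul]
  · simp

lemma kronecker_single_mul_blockDiagonal (M : Fin n → Matrix (Fin 2) (Fin 2) ℝ)
    (z : Matrix (Fin 2) (Fin 2) ℝ) (i j : Fin n) :
    (z ⊗ₖ Matrix.single i j (1 : ℝ)) * blockDiagonal M =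
      (z * M j) ⊗ₖ Matrix.single i j (1 : ℝ) := by
  ext ⟨a, k⟩ ⟨b, l⟩
  rw [Matrix.mul_apply, Fintype.sum_prod_type, Matrix.kroneckerMap_apply, Matrix.mul_apply,
    Finset.sum_mul]
  refine Finset.sum_congr rfl fun c _ => ?_
  rw [Finset.sum_eq_single l]
  · rw [blockDiagonal_apply_eq, Matrix.kroneckerMap_apply, Matrix.single_apply]
    by_cases h : j = l
    · subst h
      ring
    · simp [h]
  · intro m _ hm
    rw [blockDiagonal_apply_ne _ _ _ hm, mul_zero]
  · simp

/-- The rotation of the plane by the angle `φ`. -/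
def rot (φ : ℝ) : Matrix (Fin 2) (Fin 2) ℝ := !![Real.cos φ, -Real.sin φ; Real.sin φ, Real.cos φ]

lemma rotMatrix_mul_pairMatrix_mul (θ : Fin n → ℝ) (i j : Fin n)
    (z : Matrix (Fin 2) (Fin 2) ℝ) :
    rotMatrix θ * pairMatrix i j z * (rotMatrix θ)ᵀ =
      pairMatrix i j (rot (θ i) * z * (rot (θ j))ᵀ) := by
  rw [rotMatrix, blockDiagonal_transpose, pairMatrix, Matrix.mul_sub, Matrix.sub_mul,
    blockDiagonal_mul_kronecker_single, blockDiagonal_mul_kronecker_single,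
    kronecker_single_mul_blockDiagonal, kronecker_single_mul_blockDiagonal, pairMatrix]
  simp only [Matrix.transpose_mul, Matrix.transpose_transpose, Matrix.mul_assoc]
  rfl

end SO2nFlag
end

/-! ### Brackets of elementary elements and the orthonormal frame. -/

noncomputable section

namespace SO2nFlag

open Matrix ReductiveDecomposition
open scoped Kronecker

attribute [local instance] LieRing.ofAssociativeRing

variable {n : ℕ}

/-- Double brackets are simpler than single ones here: `A * A` is minus a projection for elementary
`A`, so only `A * B * A` depends on the relative position of the two pairs. -/
lemma double_commutator {m : Type*} [Fintype m] (A B : Matrix m m ℝ) :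
    A * (A * B - B * A) - (A * B - B * A) * A =
      A * A * B + B * (A * A) - (2 : ℝ) • (A * B * A) := by
  rw [two_smul]
  noncomm_ring

lemma mul_mul_eq_zero_of_proj {m : Type*} [Fintype m] {A B P : Matrix m m ℝ} (h₁ : A * P = A)
    (h₂ : P * A = A) (h : P * B * P = 0) : A * B * A = 0 := by
  calc A * B * A = A * P * B * (P * A) := by rw [h₁, h₂]
    _ = A * (P * B * P) * A := by simp only [Matrix.mul_assoc]
    _ = 0 := by rw [h, Matrix.mul_zero, Matrix.zero_mul]

lemma commutator_eq_zero_of_proj {m : Type*} [Fintype m] {A B P : Matrix m m ℝ} (h₁ : A * P = A)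
    (h₂ : P * A = A) (h : P * B = 0) (h' : B * P = 0) : A * B - B * A = 0 := by
  calc A * B - B * A = A * P * B - B * (P * A) := by rw [h₁, h₂]
    _ = A * (P * B) - B * P * A := by simp only [Matrix.mul_assoc]
    _ = 0 := by rw [h, h', Matrix.mul_zero, Matrix.zero_mul, sub_zero]

lemma exists_planes (S : Pairs n) : ∃ i j, i ≠ j ∧ S.1 = {i, j} := Finset.card_eq_two.1 S.2

/-- The first plane of a pair, with respect to a chosen orientation. -/
def firstPlane (S : Pairs n) : Fin n := (exists_planes S).choose

/-- The second plane of a pair, with respect to a chosen orientation. -/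
def secondPlane (S : Pairs n) : Fin n := (exists_planes S).choose_spec.choose

lemma firstPlane_ne (S : Pairs n) : firstPlane S ≠ secondPlane S :=
  (exists_planes S).choose_spec.choose_spec.1

lemma planes_eq (S : Pairs n) : S.1 = {firstPlane S, secondPlane S} :=
  (exists_planes S).choose_spec.choose_spec.2

/-- The pair that underlies an isotropy summand. -/
def pairOf (s : Pairs n ⊕ Pairs n) : Pairs n := s.elim id id

/-- The blocks that span an isotropy summand. -/
def block : Pairs n ⊕ Pairs n → Fin 2 → Matrix (Fin 2) (Fin 2) ℝ :=
  Sum.elim (fun _ => ![1, !![0, -1; 1, 0]]) fun _ => ![!![1, 0; 0, -1], !![0, 1; 1, 0]]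

lemma block_mul_transpose (s : Pairs n ⊕ Pairs n) (r : Fin 2) : block s r * (block s r)ᵀ = 1 := by
  rcases s with s | s <;> fin_cases r <;> ext a b <;> fin_cases a <;> fin_cases b <;>
    simp [block, Matrix.mul_apply]

/-- The elementary elements that span the isotropy summands. -/
def elt (α : (Pairs n ⊕ Pairs n) × Fin 2) : so2n n :=
  ⟨pairMatrix (firstPlane (pairOf α.1)) (secondPlane (pairOf α.1)) (block α.1 α.2), by
    rw [LieAlgebra.Orthogonal.mem_so, pairMatrix_transpose]⟩

lemma coe_elt {α : (Pairs n ⊕ Pairs n) × Fin 2} {S : Pairs n} (h : pairOf α.1 = S) :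
    (elt α).1 = pairMatrix (firstPlane S) (secondPlane S) (block α.1 α.2) := by
  rw [← h]
  rfl

lemma elt_apply_eq_zero {α : (Pairs n ⊕ Pairs n) × Fin 2} {x y : Idx n}
    (h : ({x.2, y.2} : Finset (Fin n)) ≠ (pairOf α.1).1) : (elt α).1 x y = 0 :=
  pairMatrix_apply_eq_zero _ (planes_eq (pairOf α.1) ▸ h)

lemma elt_mem_p (α : (Pairs n ⊕ Pairs n) × Fin 2) : elt α ∈ (decomposition n).p := by
  intro a b i
  apply elt_apply_eq_zero
  intro h
  have := (pairOf α.1).2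
  rw [← h] at this
  simp at this

lemma elt_mul_self (α : (Pairs n ⊕ Pairs n) × Fin 2) :
    (elt α).1 * (elt α).1 = -planeProj (pairOf α.1).1 := by
  rw [planes_eq (pairOf α.1)]
  exact pairMatrix_mul_self (firstPlane_ne _) _ (block_mul_transpose _ _)

lemma planeProj_mul_elt (α : (Pairs n ⊕ Pairs n) × Fin 2) :
    planeProj (pairOf α.1).1 * (elt α).1 = (elt α).1 := by
  rw [planes_eq (pairOf α.1)]
  exact planeProj_mul_pairMatrix _ _ _

lemma elt_mul_planeProj (α : (Pairs n ⊕ Pairs n) × Fin 2) :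
    (elt α).1 * planeProj (pairOf α.1).1 = (elt α).1 := by
  rw [planes_eq (pairOf α.1)]
  exact pairMatrix_mul_planeProj _ _ _

/-- With `P` the projection of the pair of `α`, `A²B + BA² = -(PB + BP) = -B` and `ABA = A(PBP)A =
0`, because `B` is off-diagonal for `P`. -/
lemma lie_lie_elt_of_adj {α β : (Pairs n ⊕ Pairs n) × Fin 2}
    (h : ((pairOf α.1).1 ∩ (pairOf β.1).1).card = 1) :
    ⁅elt α, ⁅elt α, elt β⁆⁆ = -elt β := by
  have hz := elt_mul_self α
  have h1 := elt_mul_planeProj α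
  have h2 := planeProj_mul_elt α
  rw [planes_eq (pairOf β.1)] at h
  have h3 : planeProj (pairOf α.1).1 * (elt β).1 + (elt β).1 * planeProj (pairOf α.1).1 =
    (elt β).1 := planeProj_mul_add_mul_planeProj (firstPlane_ne _) h _
  have h4 : planeProj (pairOf α.1).1 * (elt β).1 * planeProj (pairOf α.1).1 = 0 :=
    planeProj_mul_mul_planeProj (firstPlane_ne _) h _
  refine Subtype.ext ?_
  rw [coe_lie, coe_lie, double_commutator, mul_mul_eq_zero_of_proj h1 h2 h4, hz, smul_zero,
    sub_zero, Matrix.neg_mul, Matrix.mul_neg, ← neg_add, h3]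
  rfl

lemma lie_elt_of_disjoint {α β : (Pairs n ⊕ Pairs n) × Fin 2}
    (h : ((pairOf α.1).1 ∩ (pairOf β.1).1).card = 0) : ⁅elt α, elt β⁆ = 0 := by
  rw [planes_eq (pairOf β.1)] at h
  obtain ⟨h1, h2⟩ := planeProj_mul_pairMatrix_of_disjoint (firstPlane_ne _) h (block β.1 β.2)
  refine Subtype.ext ?_
  rw [coe_lie]
  exact commutator_eq_zero_of_proj (elt_mul_planeProj α) (planeProj_mul_elt α) h1 h2

lemma lie_elt_mem_p {α β : (Pairs n ⊕ Pairs n) × Fin 2} (h : pairOf α.1 ≠ pairOf β.1) :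
    ⁅elt α, elt β⁆ ∈ (decomposition n).p := by
  have h' : (pairOf α.1).1 ≠ (pairOf β.1).1 := fun h1 => h (Subtype.ext h1)
  rw [planes_eq (pairOf α.1), planes_eq (pairOf β.1)] at h'
  intro a b i
  rw [coe_lie, Matrix.sub_apply]
  change (pairMatrix _ _ _ * pairMatrix _ _ _ : Matrix (Idx n) (Idx n) ℝ) _ _ -
    (pairMatrix _ _ _ * pairMatrix _ _ _ : Matrix (Idx n) (Idx n) ℝ) _ _ = 0
  rw [pairMatrix_mul_apply_same h', pairMatrix_mul_apply_same h'.symm, sub_zero]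

lemma lie_elt_mem_k {α β : (Pairs n ⊕ Pairs n) × Fin 2} (h : pairOf α.1 = pairOf β.1) :
    ⁅elt α, elt β⁆ ∈ (decomposition n).k := by
  intro a b i j hij
  rw [coe_lie, Matrix.sub_apply, coe_elt h, coe_elt (α := β) rfl,
    pairMatrix_mul_apply_of_ne (firstPlane_ne _) _ _ _ _ hij,
    pairMatrix_mul_apply_of_ne (firstPlane_ne _) _ _ _ _ hij, sub_zero]

/-- One block is a rotation and the other a reflection. The products `z * wᵀ` and `zᵀ * w` are then
reflections, hence symmetric, and the two matrices commute. -/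
lemma elt_mul_elt_of_label_ne {α β : (Pairs n ⊕ Pairs n) × Fin 2} (h : pairOf α.1 = pairOf β.1)
    (h' : α.1 ≠ β.1) : ⁅elt α, elt β⁆ = 0 := by
  refine Subtype.ext ?_
  rw [coe_lie, coe_elt h, coe_elt (α := β) rfl, pairMatrix_mul (firstPlane_ne _),
    pairMatrix_mul (firstPlane_ne _)]
  have h1 : block α.1 α.2 * (block β.1 β.2)ᵀ = block β.1 β.2 * (block α.1 α.2)ᵀ ∧
      (block α.1 α.2)ᵀ * block β.1 β.2 = (block β.1 β.2)ᵀ * block α.1 α.2 := by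
    obtain ⟨s | s, r⟩ := α <;> obtain ⟨t | t, q⟩ := β
    · exact absurd (congrArg Sum.inl h) h'
    · constructor <;> fin_cases r <;> fin_cases q <;> ext a b <;> fin_cases a <;> fin_cases b <;>
        simp [block, Matrix.mul_apply]
    · constructor <;> fin_cases r <;> fin_cases q <;> ext a b <;> fin_cases a <;> fin_cases b <;>
        simp [block, Matrix.mul_apply]
    · exact absurd (congrArg Sum.inr h) h'
  rw [h1.1, h1.2, sub_self]
  rfl

/-- The two blocks of one summand have skew products, so the elements anticommute. Thus `ABA = -BA²
= B`, and the three terms of the double bracket add up to `-4B`. -/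
lemma lie_lie_elt_of_label_eq {α β : (Pairs n ⊕ Pairs n) × Fin 2} (h : α.1 = β.1) (h' : α ≠ β) :
    ⁅elt α, ⁅elt α, elt β⁆⁆ = (-4 : ℝ) • elt β := by
  have hz := elt_mul_self α
  have h2 : planeProj (pairOf α.1).1 * (elt β).1 = (elt β).1 := h ▸ planeProj_mul_elt β
  have h3 : (elt β).1 * planeProj (pairOf α.1).1 = (elt β).1 := h ▸ elt_mul_planeProj β
  have h1 : (elt α).1 * (elt β).1 = -((elt β).1 * (elt α).1) := by
    rw [coe_elt (α := α) (S := pairOf β.1) (by rw [h]), coe_elt (α := β) rfl,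
      pairMatrix_mul (firstPlane_ne _), pairMatrix_mul (firstPlane_ne _)]
    have h1 : block α.1 α.2 * (block β.1 β.2)ᵀ = -(block β.1 β.2 * (block α.1 α.2)ᵀ) ∧
        (block α.1 α.2)ᵀ * block β.1 β.2 = -((block β.1 β.2)ᵀ * block α.1 α.2) := by
      obtain ⟨s, r⟩ := α
      obtain ⟨t, q⟩ := β
      obtain rfl : s = t := h
      have hrq : r ≠ q := fun hh => h' (by rw [hh])
      rcases s with s | s
      · constructor <;> fin_cases r <;> fin_cases q <;> (try exact absurd rfl hrq) <;> ext a b <;>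
          fin_cases a <;> fin_cases b <;> simp [block, Matrix.mul_apply]
      · constructor <;> fin_cases r <;> fin_cases q <;> (try exact absurd rfl hrq) <;> ext a b <;>
          fin_cases a <;> fin_cases b <;>
          simp [block, Matrix.mul_apply, Matrix.vecMul, dotProduct]
    rw [h1.1, h1.2]
    ext
    simp [Matrix.kroneckerMap_apply]
    ring
  refine Subtype.ext ?_
  rw [coe_lie, coe_lie, double_commutator, h1, Matrix.neg_mul, Matrix.mul_assoc (elt β).1, hz,
    Matrix.neg_mul, Matrix.mul_neg, h2, h3]
  change _ = (-4 : ℝ) • (elt β).1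
  module

/-! #### The orthonormal frame -/

/-- The factor that normalizes the elementary elements. -/
def normFactor (n : ℕ) : ℝ := √(1 / (8 * ((n : ℝ) - 1)))

/-- The number `8(n-1)` is the squared `g_B`-length of an elementary element: `2n - 2` times the
trace of a projection of rank four. -/
lemma normFactor_mul_self (hn : 2 ≤ n) :
    normFactor n * normFactor n = 1 / (8 * ((n : ℝ) - 1)) := by
  have h : (2 : ℝ) ≤ n := by exact_mod_cast hn
  exact Real.mul_self_sqrt (by apply one_div_nonneg.2; linarith)

/-- The normalized elementary elements of `𝔭`. -/
def frameVec (α : (Pairs n ⊕ Pairs n) × Fin 2) : (decomposition n).p :=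
  normFactor n • ⟨elt α, elt_mem_p α⟩

lemma coe_frameVec (α : (Pairs n ⊕ Pairs n) × Fin 2) :
    (frameVec α : so2n n) = normFactor n • elt α := rfl

lemma frameVec_apply (α : (Pairs n ⊕ Pairs n) × Fin 2) (x y : Idx n) :
    (frameVec α : so2n n).1 x y = normFactor n * (elt α).1 x y := rfl

lemma gB_frameVec (α : (Pairs n ⊕ Pairs n) × Fin 2) (X : (decomposition n).p) :
    gB n (frameVec α) X = 4 * ((n : ℝ) - 1) * normFactor n * ∑ a, ∑ b, block α.1 α.2 a b *
      X.1.1 (a, firstPlane (pairOf α.1)) (b, secondPlane (pairOf α.1)) := by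
  rw [standardMetric_apply, killingForm_so2n, coe_frameVec]
  change -(_ * (normFactor n • (elt α).1 * X.1.1).trace) = _
  rw [Matrix.smul_mul, Matrix.trace_smul, elt, trace_pairMatrix_mul, smul_eq_mul]
  ring

lemma frameVec_apply_planes (α β : (Pairs n ⊕ Pairs n) × Fin 2) (a b : Fin 2)
    (h : pairOf α.1 = pairOf β.1) :
    (frameVec β : so2n n).1 (a, firstPlane (pairOf α.1)) (b, secondPlane (pairOf α.1)) =
      normFactor n * block β.1 β.2 a b := by
  rw [frameVec_apply, h, elt]
  simp only
  rw [pairMatrix_apply]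
  simp [(firstPlane_ne (pairOf β.1)).symm]

lemma frameVec_ortho (hn : 2 ≤ n) (α β : (Pairs n ⊕ Pairs n) × Fin 2) :
    gB n (frameVec α) (frameVec β) = if α = β then 1 else 0 := by
  have h2 : (2 : ℝ) ≤ n := by exact_mod_cast hn
  rw [gB_frameVec]
  by_cases h : pairOf α.1 = pairOf β.1
  · simp only [frameVec_apply_planes α β _ _ h]
    have h3 : 4 * ((n : ℝ) - 1) * normFactor n * ∑ a, ∑ b, block α.1 α.2 a b *
        (normFactor n * block β.1 β.2 a b) =
        (∑ a, ∑ b, block α.1 α.2 a b * block β.1 β.2 a b) / 2 := by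
      have h4 : (n : ℝ) - 1 ≠ 0 := by linarith
      calc _ = 4 * ((n : ℝ) - 1) * (normFactor n * normFactor n) *
          ∑ a, ∑ b, block α.1 α.2 a b * block β.1 β.2 a b := by
            simp only [Finset.mul_sum]
            refine Finset.sum_congr rfl fun a _ => Finset.sum_congr rfl fun b _ => ?_
            ring
        _ = _ := by
          rw [normFactor_mul_self hn]
          field_simp
          ring
    rw [h3]
    obtain ⟨s, r⟩ := α
    obtain ⟨t, q⟩ := β
    rcases s with s | s <;> rcases t with t | t <;> obtain rfl : s = t := h <;>
      fin_cases r <;> fin_cases q <;> simp [block, Fin.sum_univ_two]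
  · rw [if_neg (fun hh => h (by rw [hh])), Finset.sum_eq_zero, mul_zero]
    intro a _
    refine Finset.sum_eq_zero fun b _ => ?_
    rw [frameVec_apply, elt_apply_eq_zero, mul_zero, mul_zero]
    rw [← planes_eq]
    exact fun hh => h (Subtype.ext hh)

/-- The four blocks of a pair form an orthogonal basis of the `2 × 2` matrices with squared length
two; this is the resulting completeness relation. -/
lemma sum_block_mul_block (s : Pairs n ⊕ Pairs n) (x : Matrix (Fin 2) (Fin 2) ℝ) (a b : Fin 2) :
    ∑ r, ((∑ c, ∑ d, block (Sum.inl (pairOf s)) r c d * x c d) * block (Sum.inl (pairOf s)) r a b +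
      (∑ c, ∑ d, block (Sum.inr (pairOf s)) r c d * x c d) * block (Sum.inr (pairOf s)) r a b) =
      2 * x a b := by
  fin_cases a <;> fin_cases b <;> simp [block, Fin.sum_univ_two] <;> ring

/-- Matrix entries as linear functionals on `𝔭`. -/
def entry (x y : Idx n) : (decomposition n).p →ₗ[ℝ] ℝ where
  toFun X := X.1.1 x y
  map_add' _ _ := rfl
  map_smul' _ _ := rfl

lemma entry_apply (x y : Idx n) (X : (decomposition n).p) : entry x y X = X.1.1 x y := rfl

lemma ext_entry {X Y : (decomposition n).p}
    (h : ∀ a b k l, k ≠ l → entry (a, k) (b, l) X = entry (a, k) (b, l) Y) : X = Y := by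
  refine Subtype.ext (Subtype.ext (Matrix.ext ?_))
  rintro ⟨a, k⟩ ⟨b, l⟩
  by_cases hkl : k = l
  · subst hkl
    rw [X.2 a b k, Y.2 a b k]
  · exact h a b k l hkl

lemma entry_frameVec_planes (α : (Pairs n ⊕ Pairs n) × Fin 2) (a b : Fin 2) :
    entry (a, firstPlane (pairOf α.1)) (b, secondPlane (pairOf α.1)) (frameVec α) =
      normFactor n * block α.1 α.2 a b :=
  frameVec_apply_planes α α a b rfl

lemma entry_swap (x y : Idx n) (X : (decomposition n).p) : entry y x X = -entry x y X :=
  so2n_apply X.1 x y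

lemma entry_sum_pair (hn : 2 ≤ n) (X : (decomposition n).p) (S : Pairs n) (a b : Fin 2) :
    ∑ r, gB n (frameVec (Sum.inl S, r)) X *
        entry (a, firstPlane S) (b, secondPlane S) (frameVec (Sum.inl S, r)) +
      ∑ r, gB n (frameVec (Sum.inr S, r)) X *
        entry (a, firstPlane S) (b, secondPlane S) (frameVec (Sum.inr S, r)) =
      entry (a, firstPlane S) (b, secondPlane S) X := by
  have h2 : (2 : ℝ) ≤ n := by exact_mod_cast hn
  have h4 : (n : ℝ) - 1 ≠ 0 := by linarith
  have h1 := fun r => entry_frameVec_planes (n := n) (Sum.inl S, r) a b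
  have h3 := fun r => entry_frameVec_planes (n := n) (Sum.inr S, r) a b
  have h5 := sum_block_mul_block (Sum.inl S)
    (Matrix.of fun c d => X.1.1 (c, firstPlane S) (d, secondPlane S)) a b
  simp only [pairOf, Sum.elim_inl, Sum.elim_inr, id, Matrix.of_apply] at h1 h3 h5
  simp only [h1, h3, gB_frameVec, pairOf, Sum.elim_inl, Sum.elim_inr, id, ← Finset.sum_add_distrib]
  rw [entry_apply]
  calc _ = 4 * ((n : ℝ) - 1) * (normFactor n * normFactor n) *
      (2 * X.1.1 (a, firstPlane S) (b, secondPlane S)) := by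
        rw [← h5, Finset.mul_sum]
        refine Finset.sum_congr rfl fun r _ => ?_
        ring
    _ = _ := by
      rw [normFactor_mul_self hn]
      field_simp
      ring

lemma frameVec_expand (hn : 2 ≤ n) (X : (decomposition n).p) :
    ∑ α, gB n (frameVec α) X • frameVec α = X := by
  have key : ∀ (S : Pairs n) (a b : Fin 2),
      entry (a, firstPlane S) (b, secondPlane S) (∑ α, gB n (frameVec α) X • frameVec α) =
        entry (a, firstPlane S) (b, secondPlane S) X := by
    intro S a b
    have h0 : ∀ s : Pairs n ⊕ Pairs n, pairOf s ≠ S → ∀ r,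
        entry (a, firstPlane S) (b, secondPlane S) (frameVec (s, r)) = 0 := by
      intro s hs r
      rw [entry_apply, frameVec_apply, elt_apply_eq_zero, mul_zero]
      rw [← planes_eq]
      exact fun hh => hs (Subtype.ext hh.symm)
    rw [map_sum, Fintype.sum_prod_type, Fintype.sum_sum_type, Finset.sum_eq_single S,
      Finset.sum_eq_single S]
    · simp only [map_smul, smul_eq_mul]
      exact entry_sum_pair hn X S a b
    · intro T _ hT
      simp [h0 (Sum.inr T) hT]
    · simp
    · intro T _ hT
      simp [h0 (Sum.inl T) hT]
    · simp
  refine ext_entry fun a b k l hkl => ?_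
  -- The orientation chosen for this pair may be `(k, l)` or `(l, k)`; skew-symmetry of the entries
  -- reduces the second case to the first.
  let S : Pairs n := ⟨{k, l}, Finset.card_pair hkl⟩
  have hS : ({k, l} : Finset (Fin n)) = {firstPlane S, secondPlane S} := planes_eq S
  have hk : k = firstPlane S ∧ l = secondPlane S ∨ k = secondPlane S ∧ l = firstPlane S := by
    have h1 : k ∈ ({firstPlane S, secondPlane S} : Finset (Fin n)) := by rw [← hS]; simp
    have h2 : l ∈ ({firstPlane S, secondPlane S} : Finset (Fin n)) := by rw [← hS]; simp
    simp only [Finset.mem_insert, Finset.mem_singleton] at h1 h2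
    rcases h1 with h1 | h1 <;> rcases h2 with h2 | h2
    · exact absurd (h1.trans h2.symm) hkl
    · exact Or.inl ⟨h1, h2⟩
    · exact Or.inr ⟨h1, h2⟩
    · exact absurd (h1.trans h2.symm) hkl
  generalize S = T at hk
  rcases hk with ⟨rfl, rfl⟩ | ⟨rfl, rfl⟩
  · exact key T a b
  · rw [entry_swap, key T b a, ← entry_swap]

end SO2nFlag
end

/-! ### Spectrum of the Johnson graph and of the Lichnerowicz matrix. -/

noncomputable section

namespace SO2nFlag

open Matrix Polynomial

variable {n : ℕ}

/-- The incidence matrix of points and pairs. -/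
def incidence (n : ℕ) : Matrix (Fin n) (Pairs n) ℝ := Matrix.of fun i S => if i ∈ S.1 then 1 else 0

lemma incidence_apply (i : Fin n) (S : Pairs n) : incidence n i S = if i ∈ S.1 then 1 else 0 := rfl

lemma transpose_incidence_mul :
    (incidence n)ᵀ * incidence n = (johnsonGraph n 2 1).adjMatrix ℝ + (2 : ℝ) • 1 := by
  ext S T
  have h1 : ((incidence n)ᵀ * incidence n) S T = ((S.1 ∩ T.1).card : ℝ) := by
    rw [Matrix.mul_apply, ← Finset.filter_mem_eq_inter, Finset.card_filter, Nat.cast_sum]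
    simp only [Matrix.transpose_apply, incidence_apply, mul_ite, mul_one, mul_zero]
    rw [← Finset.sum_filter_add_sum_filter_not Finset.univ (· ∈ S.1)]
    rw [Finset.sum_eq_zero (s := Finset.univ.filter (· ∉ S.1))]
    · rw [add_zero]
      have h : Finset.univ.filter (· ∈ S.1) = S.1 := by ext; simp
      rw [h]
      refine Finset.sum_congr rfl fun i hi => ?_
      simp [hi]
    · intro i hi
      simp [(Finset.mem_filter.1 hi).2]
  rw [h1, Matrix.add_apply, SimpleGraph.adjMatrix_apply, Matrix.smul_apply, Matrix.one_apply]
  by_cases hST : S = T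
  · subst hST
    simp [S.2]
  · have h2 : (S.1 ∩ T.1).card ≤ 2 := (Finset.card_le_card Finset.inter_subset_left).trans S.2.le
    have h3 : (S.1 ∩ T.1).card ≠ 2 := by
      intro h
      have e1 := Finset.eq_of_subset_of_card_le (Finset.inter_subset_left (s₁ := S.1) (s₂ := T.1))
        (by rw [h, S.2])
      have e2 := Finset.eq_of_subset_of_card_le (Finset.inter_subset_right (s₁ := S.1) (s₂ := T.1))
        (by rw [h, T.2])
      exact hST (Subtype.ext (e1.symm.trans e2))
    have h4 : (johnsonGraph n 2 1).Adj S T ↔ (S.1 ∩ T.1).card = 1 := by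
      simp [johnsonGraph, hST]
    simp only [h4, hST, if_false, smul_zero, add_zero]
    split_ifs with h5
    · simp [h5]
    · have : (S.1 ∩ T.1).card = 0 := by omega
      simp [this]

lemma sum_incidence_points (S : Pairs n) : ∑ i, incidence n i S = 2 := by
  simp [incidence_apply, S.2]

lemma sum_incidence_mul_of_ne {i j : Fin n} (h : i ≠ j) :
    ∑ S, incidence n i S * incidence n j S = 1 := by
  rw [Finset.sum_eq_single ⟨{i, j}, Finset.card_pair h⟩]
  · simp [incidence_apply]
  · intro S _ hS
    simp only [incidence_apply, mul_ite, mul_one, mul_zero]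
    split_ifs with h1 h2
    · refine absurd (Subtype.ext ?_) hS
      refine (Finset.eq_of_subset_of_card_le ?_ ?_).symm
      · intro k hk
        simp only [Finset.mem_insert, Finset.mem_singleton] at hk
        rcases hk with rfl | rfl <;> assumption
      · rw [S.2, Finset.card_pair h]
    · rfl
    · rfl
  · simp

/-- Double counting: if `d` is the number of pairs through `i`, summing the common pairs of `i` and
`j` over all `j` gives `2d` pair by pair and `d + (n - 1)` point by point. -/
lemma sum_incidence_pairs (i : Fin n) : ∑ S, incidence n i S = (n : ℝ) - 1 := by
  have h1 : ∀ S, incidence n i S * incidence n i S = incidence n i S := by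
    intro S
    simp [incidence_apply]
  have h2 : ∑ j, ∑ S, incidence n i S * incidence n j S = 2 * ∑ S, incidence n i S := by
    rw [Finset.sum_comm, Finset.mul_sum]
    refine Finset.sum_congr rfl fun S _ => ?_
    rw [← Finset.mul_sum, sum_incidence_points, mul_comm]
  have h3 : ∑ j, ∑ S, incidence n i S * incidence n j S =
      ∑ S, incidence n i S + ((n : ℝ) - 1) := by
    rw [← Finset.add_sum_erase _ _ (Finset.mem_univ i), Finset.sum_congr rfl fun S _ => h1 S]
    congr 1
    rw [Finset.sum_congr rfl fun j hj => sum_incidence_mul_of_ne (Finset.ne_of_mem_erase hj).symm]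
    have : 1 ≤ n := Fin.pos i
    simp [Finset.card_erase_of_mem, Nat.cast_sub this]
  linarith

lemma incidence_mul_transpose :
    incidence n * (incidence n)ᵀ = ((n : ℝ) - 2) • 1 + Matrix.of fun _ _ => 1 := by
  ext i j
  rw [Matrix.mul_apply, Matrix.add_apply, Matrix.smul_apply, Matrix.one_apply]
  simp only [Matrix.transpose_apply, Matrix.of_apply]
  split_ifs with h
  · subst h
    have h1 : ∀ S, incidence n i S * incidence n i S = incidence n i S := by
      intro S
      simp [incidence_apply]
    rw [Finset.sum_congr rfl fun S _ => h1 S, sum_incidence_pairs, smul_eq_mul]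
    ring
  · rw [sum_incidence_mul_of_ne h]
    simp

lemma sum_adjMatrix_johnson (S : Pairs n) :
    ∑ T, (johnsonGraph n 2 1).adjMatrix ℝ T S = 2 * ((n : ℝ) - 2) := by
  have h1 : ∀ T, (johnsonGraph n 2 1).adjMatrix ℝ T S =
      ∑ i, incidence n i T * incidence n i S - if T = S then 2 else 0 := by
    intro T
    have h := congrFun (congrFun (transpose_incidence_mul (n := n)) T) S
    rw [Matrix.mul_apply, Matrix.add_apply, Matrix.smul_apply, Matrix.one_apply] at h
    simp only [Matrix.transpose_apply] at h
    rw [h]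
    simp
  simp only [h1, Finset.sum_sub_distrib, Finset.sum_ite_eq', Finset.mem_univ, if_true]
  rw [Finset.sum_comm]
  simp only [← Finset.sum_mul, sum_incidence_pairs, ← Finset.mul_sum, sum_incidence_points]
  ring

lemma card_pairs : Fintype.card (Pairs n) = n * (n - 1) / 2 := by
  rw [← Nat.choose_two_right, Fintype.card_finset_len, Fintype.card_fin]

lemma eval_charpoly_smul_add {m : Type*} [Fintype m] [DecidableEq m] (N : Matrix m m ℝ)
    {c : ℝ} (hc : c ≠ 0) (d x : ℝ) :
    (c • N + d • 1).charpoly.eval x = c ^ Fintype.card m * N.charpoly.eval ((x - d) / c) := by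
  rw [Matrix.eval_charpoly, Matrix.eval_charpoly, ← Matrix.det_smul]
  congr 1
  simp only [← Matrix.smul_one_eq_diagonal, Matrix.scalar_apply, smul_sub, smul_smul,
    mul_div_cancel₀ _ hc]
  module

lemma charpoly_incidence_mul_transpose (hn : 1 ≤ n) (x : ℝ) :
    (incidence n * (incidence n)ᵀ).charpoly.eval x =
      (x - (2 * (n : ℝ) - 2)) * (x - ((n : ℝ) - 2)) ^ (n - 1) := by
  have h1 : incidence n * (incidence n)ᵀ =
      (1 : ℝ) • Matrix.vecMulVec (fun _ : Fin n => 1) (fun _ => 1) + ((n : ℝ) - 2) • 1 := by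
    rw [incidence_mul_transpose, one_smul, add_comm]
    congr 1
    ext
    simp [Matrix.vecMulVec]
  rw [h1, eval_charpoly_smul_add _ one_ne_zero, Matrix.charpoly_vecMulVec]
  obtain ⟨k, rfl⟩ : ∃ k, n = k + 1 := ⟨n - 1, by omega⟩
  simp [dotProduct, pow_succ]
  ring

/-- Swapping the factors reduces to the `n × n` matrix `NNᵀ`, a rank-one matrix plus a scalar. The
swap contributes a power of `x` with exponent `n(n-1)/2 - n = n(n-3)/2`, which needs `n ≥ 3`. -/
lemma charpoly_transpose_incidence_mul (hn : 3 ≤ n) (x : ℝ) :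
    ((incidence n)ᵀ * incidence n).charpoly.eval x =
      x ^ (n * (n - 3) / 2) * ((x - (2 * (n : ℝ) - 2)) * (x - ((n : ℝ) - 2)) ^ (n - 1)) := by
  have h1 : n * (n - 1) / 2 = n * (n - 3) / 2 + n := by
    obtain ⟨k, rfl⟩ : ∃ k, n = k + 3 := ⟨n - 3, by omega⟩
    have : (k + 3) * (k + 3 - 1) = (k + 3) * (k + 3 - 3) + 2 * (k + 3) := by
      simp only [Nat.add_sub_cancel, show k + 3 - 1 = k + 2 by omega]
      ring
    rw [this, Nat.add_mul_div_left _ _ two_pos]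
  rw [Matrix.charpoly_mul_comm_of_le, Polynomial.eval_mul,
    charpoly_incidence_mul_transpose (by omega), card_pairs, Fintype.card_fin, h1]
  · simp
  · rw [card_pairs, Fintype.card_fin, h1]
    omega

/-- The block matrix factors through one copy of the index set; reversing the factorization leaves
`A + A`. -/
lemma charpoly_fromBlocks_self {m : Type*} [Fintype m] [DecidableEq m] (A : Matrix m m ℝ) :
    (Matrix.fromBlocks A A A A).charpoly = X ^ Fintype.card m * ((2 : ℝ) • A).charpoly := by
  have h1 : Matrix.fromBlocks A A A A =
      Matrix.fromRows (1 : Matrix m m ℝ) (1 : Matrix m m ℝ) * Matrix.fromCols A A := by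
    rw [Matrix.fromRows_mul_fromCols]
    simp
  have h2 : Matrix.fromCols A A * Matrix.fromRows (1 : Matrix m m ℝ) (1 : Matrix m m ℝ) =
      (2 : ℝ) • A := by
    rw [Matrix.fromCols_mul_fromRows, Matrix.mul_one, two_smul]
  rw [h1, Matrix.charpoly_mul_comm_of_le _ _ (by simp), h2, Fintype.card_sum, Nat.add_sub_cancel]

/-- The matrix of the Lichnerowicz Laplacian. -/
def lichMatrix (n : ℕ) : Matrix (Pairs n ⊕ Pairs n) (Pairs n ⊕ Pairs n) ℝ :=
  (1 / (4 * ((n : ℝ) - 1))) • ((4 * ((n : ℝ) - 2)) • 1 -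
    Matrix.fromBlocks ((johnsonGraph n 2 1).adjMatrix ℝ) ((johnsonGraph n 2 1).adjMatrix ℝ)
      ((johnsonGraph n 2 1).adjMatrix ℝ) ((johnsonGraph n 2 1).adjMatrix ℝ))

lemma lichMatrix_apply (s t : Pairs n ⊕ Pairs n) :
    lichMatrix n s t = 1 / (4 * ((n : ℝ) - 1)) * (4 * ((n : ℝ) - 2) * (if s = t then 1 else 0) -
      (johnsonGraph n 2 1).adjMatrix ℝ (s.elim id id) (t.elim id id)) := by
  rw [lichMatrix, Matrix.smul_apply, Matrix.sub_apply, Matrix.smul_apply, Matrix.one_apply]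
  rcases s with s | s <;> rcases t with t | t <;> rfl

lemma lichMatrix_comm (s t : Pairs n ⊕ Pairs n) : lichMatrix n s t = lichMatrix n t s := by
  rw [lichMatrix_apply, lichMatrix_apply, ← (johnsonGraph n 2 1).isSymm_adjMatrix.apply]
  simp only [eq_comm]

theorem charpoly_lichMatrix (hn : 3 ≤ n) : (lichMatrix n).charpoly =
    X * (X - C ((n : ℝ) / (2 * ((n : ℝ) - 1)))) ^ (n - 1) * (X - C 1) ^ (n * (n - 3) / 2) *
      (X - C (((n : ℝ) - 2) / ((n : ℝ) - 1))) ^ (n * (n - 1) / 2) := by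
  have h3 : (3 : ℝ) ≤ n := by exact_mod_cast hn
  have h1 : (n : ℝ) - 1 ≠ 0 := by linarith
  set c : ℝ := 1 / (4 * ((n : ℝ) - 1)) with hc
  have hc0 : c ≠ 0 := by
    rw [hc]
    positivity
  set A : Matrix (Pairs n) (Pairs n) ℝ := (johnsonGraph n 2 1).adjMatrix ℝ with hA
  have hA2 : (2 : ℝ) • A = (2 : ℝ) • ((incidence n)ᵀ * incidence n) + (-4 : ℝ) • 1 := by
    rw [transpose_incidence_mul]
    module
  have hM : lichMatrix n = (-c) • Matrix.fromBlocks A A A A + (c * (4 * ((n : ℝ) - 2))) • 1 := by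
    rw [lichMatrix]
    module
  have hN : n * (n - 1) / 2 = n * (n - 3) / 2 + 1 + (n - 1) := by
    obtain ⟨k, rfl⟩ : ∃ k, n = k + 3 := ⟨n - 3, by omega⟩
    have : (k + 3) * (k + 3 - 1) = (k + 3) * (k + 3 - 3) + 2 * (k + 3) := by
      simp only [Nat.add_sub_cancel, show k + 3 - 1 = k + 2 by omega]
      ring
    rw [this, Nat.add_mul_div_left _ _ two_pos]
    omega
  refine Polynomial.funext fun x => ?_
  rw [hM, eval_charpoly_smul_add _ (neg_ne_zero.2 hc0), charpoly_fromBlocks_self,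
    Polynomial.eval_mul, hA2, eval_charpoly_smul_add _ two_ne_zero,
    charpoly_transpose_incidence_mul hn]
  simp only [Fintype.card_sum, card_pairs, Polynomial.eval_pow,
    Polynomial.eval_mul, Polynomial.eval_sub, Polynomial.eval_X, Polynomial.eval_C]
  set y := (x - c * (4 * ((n : ℝ) - 2))) / -c with hy
  -- Each linear factor of the target is `-c`, and apart from the first also `2`, times a factor of
  -- the polynomial already computed at `y` or `(y + 4)/2`. The count `hN` then balances the powers
  -- of these constants.
  have e1 : x - ((n : ℝ) - 2) / ((n : ℝ) - 1) = -c * y := by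
    rw [hy, hc]
    field_simp
  have e2 : x - 1 = -c * (2 * ((y - -4) / 2)) := by
    rw [hy, hc]
    field_simp
    ring
  have e3 : x = -c * (2 * ((y - -4) / 2 - (2 * (n : ℝ) - 2))) := by
    rw [hy, hc]
    field_simp
    ring
  have e4 : x - (n : ℝ) / (2 * ((n : ℝ) - 1)) =
      -c * (2 * ((y - -4) / 2 - ((n : ℝ) - 2))) := by
    rw [hy, hc]
    field_simp
    ring
  rw [e1, e2, e4]
  generalize (y - -4) / 2 = w at *
  conv_rhs => rw [e3]
  rw [hN]
  simp only [mul_pow, pow_add]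
  ring

/-- Symmetry gives `B(g^(k+1) v, g^(k+1) v) = B(g^k v, g^(k+2) v)`, so definiteness lowers the
vanishing exponent until it reaches one. -/
lemma apply_eq_zero_of_pow_apply_eq_zero {V : Type*} [AddCommGroup V] [Module ℝ V]
    (B : LinearMap.BilinForm ℝ V) (hB : ∀ v, B v v = 0 → v = 0) (g : Module.End ℝ V)
    (hg : ∀ v w, B (g v) w = B v (g w)) (k : ℕ) (v : V) (h : (g ^ k) v = 0) : g v = 0 := by
  induction k with
  | zero =>
    obtain rfl : v = 0 := by simpa using h
    exact map_zero g
  | succ k ih =>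
    rcases k with _ | k
    · simpa using h
    · refine ih (hB _ ?_)
      have h1 : (g ^ (k + 1)) v = g ((g ^ k) v) := by rw [pow_succ', Module.End.mul_apply]
      have h2 : g ((g ^ (k + 1)) v) = 0 := by rw [← h, pow_succ' g (k + 1), Module.End.mul_apply]
      conv_lhs => rw [h1, hg, ← h1, h2]
      simp

/-- A symmetric matrix has no nontrivial Jordan blocks, so generalized eigenspaces are eigenspaces.
Nullity and coindex can then be read off the characteristic polynomial. -/
lemma finrank_eigenspace_eq_rootMultiplicity {V ι : Type*} [AddCommGroup V] [Module ℝ V]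
    [Module.Finite ℝ V] [Fintype ι] [DecidableEq ι] (b : Module.Basis ι ℝ V) (f : Module.End ℝ V)
    (h : ∀ i j, LinearMap.toMatrix b b f i j = LinearMap.toMatrix b b f j i) (μ : ℝ) :
    Module.finrank ℝ (f.eigenspace μ) = f.charpoly.rootMultiplicity μ := by
  rw [← LinearMap.finrank_maxGenEigenspace_eq]
  suffices h' : f.eigenspace μ = f.maxGenEigenspace μ by rw [h']
  refine le_antisymm (f.genEigenspace_le_maximal μ 1) ?_
  intro v hv
  obtain ⟨k, hk⟩ := Module.End.mem_maxGenEigenspace _ _ _ |>.1 hv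
  have hs : ∀ v w, Matrix.toBilin b 1 v w = ∑ i, b.repr v i * b.repr w i := by
    intro v w
    simp [Matrix.toBilin_apply, Matrix.one_apply]
  have hf : ∀ v i, b.repr (f v) i = ∑ j, LinearMap.toMatrix b b f i j * b.repr v j := by
    intro v i
    rw [← LinearMap.toMatrix_mulVec_repr b b f v]
    rfl
  have h1 := apply_eq_zero_of_pow_apply_eq_zero (Matrix.toBilin b 1) ?_ (f - μ • 1) ?_ k v hk
  · rw [Module.End.mem_eigenspace_iff]
    simpa [sub_eq_zero] using h1
  · intro v hv
    rw [hs] at hv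
    refine b.repr.injective (Finsupp.ext fun i => ?_)
    have := (Finset.sum_eq_zero_iff_of_nonneg fun i _ => mul_self_nonneg (b.repr v i)).1 hv i
      (Finset.mem_univ i)
    simpa using this
  · intro v w
    have h2 : Matrix.toBilin b 1 (f v) w = Matrix.toBilin b 1 v (f w) := by
      simp only [hs, hf, Finset.sum_mul, Finset.mul_sum]
      rw [Finset.sum_comm]
      refine Finset.sum_congr rfl fun i _ => Finset.sum_congr rfl fun j _ => ?_
      rw [h]
      ring
    simp only [LinearMap.sub_apply, LinearMap.smul_apply, Module.End.one_apply, map_sub, map_smul,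
      h2]

/-- With `w = Nz` and `q = Nᵀw`, tracelessness removes the all-ones part of `NNᵀ`, so `|q|² =
(n-2)|w|²`. Expanding `0 ≤ |(n-2)z - q|²` gives `n - 2` times the claim. -/
lemma dotProduct_mulVec_incidence_le (hn : 2 ≤ n) (z : Pairs n → ℝ) (hz : ∑ S, z S = 0) :
    (incidence n *ᵥ z) ⬝ᵥ (incidence n *ᵥ z) ≤ ((n : ℝ) - 2) * (z ⬝ᵥ z) := by
  have h2 : (2 : ℝ) ≤ n := by exact_mod_cast hn
  set w := incidence n *ᵥ z with hw
  set q := (incidence n)ᵀ *ᵥ w with hq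
  have h1 : ∑ i, w i = 0 := by
    simp only [hw, Matrix.mulVec, dotProduct]
    rw [Finset.sum_comm]
    simp only [← Finset.sum_mul, sum_incidence_points, ← Finset.mul_sum, hz, mul_zero]
  have h3 : z ⬝ᵥ q = w ⬝ᵥ w := by
    rw [hq, Matrix.dotProduct_mulVec, Matrix.vecMul_transpose]
  have h4 : q ⬝ᵥ q = ((n : ℝ) - 2) * (w ⬝ᵥ w) := by
    conv_lhs => rw [hq, Matrix.dotProduct_mulVec, Matrix.vecMul_transpose, Matrix.mulVec_mulVec,
      incidence_mul_transpose, Matrix.add_mulVec, Matrix.smul_mulVec, Matrix.one_mulVec]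
    have h5 : (Matrix.of fun _ _ : Fin n => (1 : ℝ)) *ᵥ w = 0 := by
      ext i
      simp [Matrix.mulVec, dotProduct, h1]
    rw [h5, add_zero, smul_dotProduct, smul_eq_mul]
  have h6 : 0 ≤ (((n : ℝ) - 2) • z - q) ⬝ᵥ (((n : ℝ) - 2) • z - q) :=
    Finset.sum_nonneg fun i _ => mul_self_nonneg _
  rw [sub_dotProduct, dotProduct_sub, dotProduct_sub, smul_dotProduct, smul_dotProduct,
    dotProduct_smul, dotProduct_smul, dotProduct_comm q z, h3, h4] at h6
  simp only [smul_eq_mul] at h6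
  -- For `n = 2` the factor `n - 2` cannot be cancelled; there `q = 0` forces `w ⬝ᵥ w = z ⬝ᵥ q = 0`.
  rcases h2.eq_or_lt with h2 | h2
  · have h7 : q ⬝ᵥ q = 0 := by rw [h4, ← h2]; ring
    have h8 : q = 0 := dotProduct_self_eq_zero.1 h7
    rw [← h3, h8, dotProduct_zero, ← h2]
    simp
  · nlinarith

lemma dotProduct_lichMatrix_mulVec (y : Pairs n ⊕ Pairs n → ℝ) :
    y ⬝ᵥ (lichMatrix n *ᵥ y) = 1 / (4 * ((n : ℝ) - 1)) * (4 * ((n : ℝ) - 2) * (y ⬝ᵥ y) -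
      ((incidence n *ᵥ (y ∘ Sum.inl + y ∘ Sum.inr)) ⬝ᵥ
        (incidence n *ᵥ (y ∘ Sum.inl + y ∘ Sum.inr)) -
      2 * ((y ∘ Sum.inl + y ∘ Sum.inr) ⬝ᵥ (y ∘ Sum.inl + y ∘ Sum.inr)))) := by
  set z := y ∘ Sum.inl + y ∘ Sum.inr with hz
  have h1 : z ⬝ᵥ (((johnsonGraph n 2 1).adjMatrix ℝ : Matrix (Pairs n) (Pairs n) ℝ) *ᵥ z) =
      (incidence n *ᵥ z) ⬝ᵥ (incidence n *ᵥ z) - 2 * (z ⬝ᵥ z) := by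
    have h2 : ((johnsonGraph n 2 1).adjMatrix ℝ : Matrix (Pairs n) (Pairs n) ℝ) =
        (incidence n)ᵀ * incidence n - (2 : ℝ) • 1 := by
      rw [transpose_incidence_mul, add_sub_cancel_right]
    rw [h2, Matrix.sub_mulVec, Matrix.smul_mulVec, Matrix.one_mulVec, dotProduct_sub,
      dotProduct_smul, ← Matrix.mulVec_mulVec, Matrix.dotProduct_mulVec, Matrix.vecMul_transpose,
      smul_eq_mul]
  rw [← h1, lichMatrix, Matrix.smul_mulVec, Matrix.sub_mulVec, Matrix.smul_mulVec,
    Matrix.one_mulVec, dotProduct_smul, dotProduct_sub, dotProduct_smul, smul_eq_mul, smul_eq_mul]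
  congr 2
  rw [Matrix.fromBlocks_mulVec, ← Matrix.mulVec_add, ← hz]
  conv_lhs => rw [← Sum.elim_comp_inl_inr y]
  rw [sumElim_dotProduct_sumElim, ← add_dotProduct]

/-- Up to the factor `1/(4(n-1))`, the form is at least `4(n-2)|y|² - (n-4)|z|²`, where `z` adds the
two halves of `y`. Since `|z|² ≤ 2|y|²` and `n - 4 ≥ 0`, this is at least `2n|y|²`; the sign of `n -
4` is where `n = 3` fails. -/
theorem le_dotProduct_lichMatrix_mulVec (hn : 4 ≤ n) (y : Pairs n ⊕ Pairs n → ℝ)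
    (hy : ∑ s, y s = 0) :
    (n : ℝ) / (2 * ((n : ℝ) - 1)) * (y ⬝ᵥ y) ≤ y ⬝ᵥ (lichMatrix n *ᵥ y) := by
  have h4 : (4 : ℝ) ≤ n := by exact_mod_cast hn
  rw [dotProduct_lichMatrix_mulVec]
  set z := y ∘ Sum.inl + y ∘ Sum.inr with hz
  have h1 : ∑ S, z S = 0 := by
    rw [← hy, Fintype.sum_sum_type, ← Finset.sum_add_distrib]
    rfl
  have h2 := dotProduct_mulVec_incidence_le (by omega) z h1
  have h3 : z ⬝ᵥ z ≤ 2 * (y ⬝ᵥ y) := by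
    simp only [dotProduct, Fintype.sum_sum_type, ← Finset.sum_add_distrib, Finset.mul_sum]
    refine Finset.sum_le_sum fun S _ => ?_
    simp only [hz, Pi.add_apply, Function.comp_apply]
    nlinarith [sq_nonneg (y (Sum.inl S) - y (Sum.inr S))]
  have h5 : (n : ℝ) / (2 * ((n : ℝ) - 1)) = 1 / (4 * ((n : ℝ) - 1)) * (2 * n) := by
    field_simp
    ring
  rw [h5, mul_assoc]
  refine mul_le_mul_of_nonneg_left ?_ (by apply one_div_nonneg.2; linarith)
  nlinarith

end SO2nFlag
end

/-! ### The normal frame of the flag manifold. -/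

noncomputable section

namespace SO2nFlag

open Matrix ReductiveDecomposition

attribute [local instance] LieRing.ofAssociativeRing

variable {n : ℕ}

lemma lie_frameVec (α β : (Pairs n ⊕ Pairs n) × Fin 2) :
    ⁅(frameVec α : so2n n), (frameVec β : so2n n)⁆ =
      (normFactor n * normFactor n) • ⁅elt α, elt β⁆ := by
  rw [coe_frameVec, coe_frameVec, smul_lie, lie_smul, smul_smul]

lemma lie_frameVec_mem_p {α β : (Pairs n ⊕ Pairs n) × Fin 2} (h : pairOf α.1 ≠ pairOf β.1) :
    ⁅(frameVec α : so2n n), (frameVec β : so2n n)⁆ ∈ (decomposition n).p := by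
  rw [lie_frameVec]
  exact Submodule.smul_mem _ _ (lie_elt_mem_p h)

lemma lie_frameVec_mem_k {α β : (Pairs n ⊕ Pairs n) × Fin 2} (h : pairOf α.1 = pairOf β.1) :
    ⁅(frameVec α : so2n n), (frameVec β : so2n n)⁆ ∈ (decomposition n).k := by
  rw [lie_frameVec]
  exact (decomposition n).k.toSubmodule.smul_mem _ (lie_elt_mem_k h)

/-- Skewness of `ad X` turns inner products of brackets into matrix entries of `(ad X)²`, for which
the frame vectors are eigenvectors in the cases needed. -/
lemma killingForm_lie_lie (X Y W : so2n n) :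
    killingForm ℝ (so2n n) ⁅X, Y⁆ ⁅X, W⁆ = -killingForm ℝ (so2n n) ⁅X, ⁅X, Y⁆⁆ W := by
  rw [← LieModule.traceForm_apply_lie_apply, ← lie_skew X ⁅X, Y⁆, map_neg, LinearMap.neg_apply,
    neg_neg]

lemma killingForm_frameVec (hn : 2 ≤ n) (α β : (Pairs n ⊕ Pairs n) × Fin 2) :
    killingForm ℝ (so2n n) (frameVec α : so2n n) (frameVec β : so2n n) =
      -if α = β then 1 else 0 := by
  rw [← frameVec_ortho hn, standardMetric_apply, neg_neg]

lemma lie_lie_frameVec_of_adj (hn : 2 ≤ n) {α β : (Pairs n ⊕ Pairs n) × Fin 2}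
    (h : ((pairOf α.1).1 ∩ (pairOf β.1).1).card = 1) :
    ⁅(frameVec α : so2n n), ⁅(frameVec α : so2n n), (frameVec β : so2n n)⁆⁆ =
      (-(1 / (8 * ((n : ℝ) - 1)))) • (frameVec β : so2n n) := by
  rw [lie_frameVec, coe_frameVec, coe_frameVec, smul_lie, lie_smul, lie_lie_elt_of_adj h,
    ← normFactor_mul_self hn]
  module

lemma lie_lie_frameVec_of_label_eq (hn : 2 ≤ n) {α β : (Pairs n ⊕ Pairs n) × Fin 2}
    (h : α.1 = β.1) (h' : α ≠ β) :
    ⁅(frameVec α : so2n n), ⁅(frameVec α : so2n n), (frameVec β : so2n n)⁆⁆ =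
      (-(4 * (1 / (8 * ((n : ℝ) - 1))))) • (frameVec β : so2n n) := by
  rw [lie_frameVec, coe_frameVec, coe_frameVec, smul_lie, lie_smul, lie_lie_elt_of_label_eq h h',
    ← normFactor_mul_self hn]
  module

lemma card_inter_pairs {S T : Pairs n} (h : S ≠ T) :
    (S.1 ∩ T.1).card = 0 ∧ ¬(johnsonGraph n 2 1).Adj S T ∨
      (S.1 ∩ T.1).card = 1 ∧ (johnsonGraph n 2 1).Adj S T := by
  have h1 := congrFun (congrFun (transpose_incidence_mul (n := n)) S) T
  have h2 : (S.1 ∩ T.1).card ≤ 2 := (Finset.card_le_card Finset.inter_subset_left).trans S.2.le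
  have h3 : (S.1 ∩ T.1).card ≠ 2 := by
    intro h3
    have e1 := Finset.eq_of_subset_of_card_le (Finset.inter_subset_left (s₁ := S.1) (s₂ := T.1))
      (by rw [h3, S.2])
    have e2 := Finset.eq_of_subset_of_card_le (Finset.inter_subset_right (s₁ := S.1) (s₂ := T.1))
      (by rw [h3, T.2])
    exact h (Subtype.ext (e1.symm.trans e2))
  have h4 : (johnsonGraph n 2 1).Adj S T ↔ (S.1 ∩ T.1).card = 1 := by
    simp [johnsonGraph, h]
  rw [h4]
  omega

/-- For distinct pairs the first bracket lies in `𝔭`, so the `𝔨`-part of the second is invisible to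
it and the double-bracket eigenvalue decides. For equal pairs the bracket lies in `𝔨`, matching the
zero diagonal of the adjacency matrix. -/
lemma frameVec_bracketP (hn : 2 ≤ n) (α β δ : (Pairs n ⊕ Pairs n) × Fin 2) :
    gB n ((decomposition n).lieP (frameVec α) (frameVec β))
        ((decomposition n).lieP (frameVec α) (frameVec δ)) =
      if β = δ then (johnsonGraph n 2 1).adjMatrix ℝ (pairOf α.1) (pairOf β.1) /
        (8 * ((n : ℝ) - 1)) else 0 := by
  by_cases h : pairOf α.1 = pairOf β.1
  · rw [lieP_of_mem_k _ (lie_frameVec_mem_k h), h]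
    simp
  · have h1 : gB n ((decomposition n).lieP (frameVec α) (frameVec β))
        ((decomposition n).lieP (frameVec α) (frameVec δ)) = killingForm ℝ (so2n n)
          ⁅(frameVec α : so2n n), ⁅(frameVec α : so2n n), (frameVec β : so2n n)⁆⁆
          (frameVec δ : so2n n) := by
      have h2 := killingForm_k_p ((decomposition n).lieK (frameVec α) (frameVec δ))
        ⟨_, lie_frameVec_mem_p h⟩
      have h3 := killingForm_lie_lie (frameVec α : so2n n) (frameVec β : so2n n)
        (frameVec δ : so2n n)
      rw [(decomposition n).lie_eq_lieP_add_lieK (frameVec α) (frameVec δ), map_add,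
        LieModule.traceForm_comm _ _ _ _ ((decomposition n).lieK _ _ : so2n n), h2,
        add_zero] at h3
      rw [lieP_of_mem_p _ (lie_frameVec_mem_p h), standardMetric_apply, h3, neg_neg]
    rw [h1]
    rcases card_inter_pairs h with ⟨h2, h3⟩ | ⟨h2, h3⟩
    · rw [lie_frameVec, lie_elt_of_disjoint h2]
      simp [SimpleGraph.adjMatrix_apply, h3]
    · rw [lie_lie_frameVec_of_adj hn h2, map_smul, LinearMap.smul_apply, killingForm_frameVec hn,
        SimpleGraph.adjMatrix_apply, if_pos h3]
      split_ifs <;> simp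

lemma lieK_frameVec_eq_zero {α β : (Pairs n ⊕ Pairs n) × Fin 2} (h : α.1 ≠ β.1 ∨ α = β) :
    (decomposition n).lieK (frameVec α) (frameVec β) = 0 := by
  by_cases h1 : pairOf α.1 = pairOf β.1
  · have h2 : ⁅(frameVec α : so2n n), (frameVec β : so2n n)⁆ = 0 := by
      rcases h with h | h
      · rw [lie_frameVec, elt_mul_elt_of_label_ne h1 h, smul_zero]
      · rw [h, lie_self]
    rw [lieK_of_mem_p]
    rw [h2]
    exact Submodule.zero_mem _
  · exact lieK_of_mem_p _ (lie_frameVec_mem_p h1)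

lemma frameVec_bracketK (hn : 2 ≤ n) (α β δ : (Pairs n ⊕ Pairs n) × Fin 2) :
    killingForm ℝ (so2n n) ((decomposition n).lieK (frameVec α) (frameVec β) : so2n n)
        ((decomposition n).lieK (frameVec α) (frameVec δ) : so2n n) =
      if β = δ ∧ α.1 = β.1 ∧ α ≠ β then -(1 / (2 * ((n : ℝ) - 1))) else 0 := by
  by_cases h1 : α.1 ≠ β.1 ∨ α = β
  · rw [lieK_frameVec_eq_zero h1, if_neg]
    · simp
    · tauto
  by_cases h2 : α.1 ≠ δ.1 ∨ α = δ
  · rw [lieK_frameVec_eq_zero h2, if_neg]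
    · simp
    · rintro ⟨rfl, h3⟩
      tauto
  push Not at h1 h2
  have h3 : β = δ := by
    obtain ⟨s, r⟩ := α
    obtain ⟨t, q⟩ := β
    obtain ⟨u, p⟩ := δ
    obtain ⟨rfl : s = t, h4⟩ := h1
    obtain ⟨rfl : s = u, h5⟩ := h2
    have h6 : r ≠ q := fun h => h4 (by rw [h])
    have h7 : r ≠ p := fun h => h5 (by rw [h])
    -- Both differ from `r` in `Fin 2`, which leaves a single value.
    have : q = p := by omega
    rw [this]
  subst h3
  rw [if_pos ⟨rfl, h1⟩, lieK_of_mem_k _ (lie_frameVec_mem_k (by rw [h1.1]))]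
  simp only
  rw [killingForm_lie_lie, lie_lie_frameVec_of_label_eq hn h1.1 h1.2, map_smul,
    LinearMap.smul_apply, killingForm_frameVec hn, if_pos rfl, smul_eq_mul]
  have h2 : (2 : ℝ) ≤ n := by exact_mod_cast hn
  have h4 : (n : ℝ) - 1 ≠ 0 := by linarith
  field_simp
  norm_num

/-- The orthonormal frame of `𝔭` adapted to the isotropy summands. -/
def frame (hn : 2 ≤ n) : (decomposition n).NormalFrame (Pairs n ⊕ Pairs n) where
  e := frameVec
  ν s t := (johnsonGraph n 2 1).adjMatrix ℝ (pairOf s) (pairOf t) / (8 * ((n : ℝ) - 1))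
  lam := ((n : ℝ) - 2) / ((n : ℝ) - 1)
  μ := 1 / (2 * ((n : ℝ) - 1))
  killing_k_p := killingForm_k_p
  ortho := frameVec_ortho hn
  expand := frameVec_expand hn
  bracketP := frameVec_bracketP hn
  bracketK := frameVec_bracketK hn
  sum_ν s := by
    have h2 : (2 : ℝ) ≤ n := by exact_mod_cast hn
    have h4 : (n : ℝ) - 1 ≠ 0 := by linarith
    rw [Fintype.sum_sum_type, ← Finset.sum_div]
    simp only [pairOf, Sum.elim_inl, Sum.elim_inr, id]
    rw [← Finset.sum_div, sum_adjMatrix_johnson]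
    field_simp
    ring

/-- The constant `lam` is the diagonal entry, and `2/(8(n-1)) = 1/(4(n-1))` is the weight of each
Johnson edge. -/
lemma frame_lich (hn : 2 ≤ n) (a : Pairs n ⊕ Pairs n → ℝ) (s : Pairs n ⊕ Pairs n) :
    (frame hn).lam * a s - 2 * ∑ t, (frame hn).ν t s * a t = (lichMatrix n *ᵥ a) s := by
  have h2 : (2 : ℝ) ≤ n := by exact_mod_cast hn
  have h4 : (n : ℝ) - 1 ≠ 0 := by linarith
  have h1 : ∀ t, lichMatrix n s t * a t = (if s = t then ((n : ℝ) - 2) / ((n : ℝ) - 1) * a t else 0)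
      - 2 * ((johnsonGraph n 2 1).adjMatrix ℝ (pairOf t) (pairOf s) / (8 * ((n : ℝ) - 1)) * a t) := by
    intro t
    rw [lichMatrix_comm, lichMatrix_apply]
    change _ * (_ - (johnsonGraph n 2 1).adjMatrix ℝ (pairOf t) (pairOf s)) * _ = _
    simp only [eq_comm (a := t)]
    split_ifs <;> field_simp <;> ring
  simp only [Matrix.mulVec, dotProduct, h1, Finset.sum_sub_distrib, ← Finset.mul_sum,
    Finset.sum_ite_eq, Finset.mem_univ, if_true]
  rfl

end SO2nFlag
end

/-! ### Invariant symmetric endomorphisms are scalar on each summand. -/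

noncomputable section

namespace SO2nFlag

open Matrix ReductiveDecomposition

attribute [local instance] LieRing.ofAssociativeRing

variable {n : ℕ}

/-- The angle by which a torus element rotates an isotropy summand. -/
def phase (θ : Fin n → ℝ) : Pairs n ⊕ Pairs n → ℝ :=
  Sum.elim (fun S => θ (firstPlane S) - θ (secondPlane S))
    fun S => θ (firstPlane S) + θ (secondPlane S)

lemma rot_mul_block_zero (θ : Fin n → ℝ) (s : Pairs n ⊕ Pairs n) :
    rot (θ (firstPlane (pairOf s))) * block s 0 * (rot (θ (secondPlane (pairOf s))))ᵀ =
      Real.cos (phase θ s) • block s 0 + Real.sin (phase θ s) • block s 1 := by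
  rcases s with s | s <;> ext a b <;> fin_cases a <;> fin_cases b <;>
    simp [rot, block, phase, pairOf, Matrix.mul_apply, Fin.sum_univ_two,
      Real.cos_add, Real.sin_add, Real.cos_sub, Real.sin_sub] <;> ring

lemma rot_mul_block_one (θ : Fin n → ℝ) (s : Pairs n ⊕ Pairs n) :
    rot (θ (firstPlane (pairOf s))) * block s 1 * (rot (θ (secondPlane (pairOf s))))ᵀ =
      (-Real.sin (phase θ s)) • block s 0 + Real.cos (phase θ s) • block s 1 := by
  rcases s with s | s <;> ext a b <;> fin_cases a <;> fin_cases b <;>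
    simp [rot, block, phase, pairOf, Matrix.mul_apply, Fin.sum_univ_two,
      Real.cos_add, Real.sin_add, Real.cos_sub, Real.sin_sub] <;> ring

lemma pairMatrix_add (i j : Fin n) (z w : Matrix (Fin 2) (Fin 2) ℝ) :
    pairMatrix i j (z + w) = pairMatrix i j z + pairMatrix i j w := by
  simp only [pairMatrix, Matrix.transpose_add, Matrix.add_kronecker]
  abel

lemma pairMatrix_smul (i j : Fin n) (c : ℝ) (z : Matrix (Fin 2) (Fin 2) ℝ) :
    pairMatrix i j (c • z) = c • pairMatrix i j z := by
  simp only [pairMatrix, Matrix.transpose_smul, Matrix.smul_kronecker, smul_sub]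

/-- The torus element with given rotation angles. -/
def torusElt (θ : Fin n → ℝ) : maxTorus n := ⟨⟨rotMatrix θ, rotMatrix_mem θ⟩, ⟨θ, rfl⟩⟩

/-- The isotropy transformation with given rotation angles. -/
def isoRot (θ : Fin n → ℝ) : Module.End ℝ (decomposition n).p :=
  (Ad (torusElt θ).1).restrict fun _ hX => Ad_mem_p (torusElt θ).2 hX

lemma isoRot_mem (θ : Fin n → ℝ) : isoRot θ ∈ isotropySet n := ⟨torusElt θ, rfl⟩

lemma exists_isoRot {γ : Module.End ℝ (decomposition n).p} (hγ : γ ∈ isotropySet n) :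
    ∃ θ, γ = isoRot θ := by
  obtain ⟨⟨_, ⟨θ, rfl⟩⟩, rfl⟩ := hγ
  exact ⟨θ, rfl⟩

lemma coe_isoRot (θ : Fin n → ℝ) (X : (decomposition n).p) :
    (isoRot θ X).1.1 = rotMatrix θ * X.1.1 * (rotMatrix θ)ᵀ := rfl

lemma isoRot_frameVec_zero (θ : Fin n → ℝ) (s : Pairs n ⊕ Pairs n) :
    isoRot θ (frameVec (s, 0)) =
      Real.cos (phase θ s) • frameVec (s, 0) + Real.sin (phase θ s) • frameVec (s, 1) := by
  refine Subtype.ext (Subtype.ext ?_)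
  rw [coe_isoRot]
  change rotMatrix θ * (normFactor n • pairMatrix _ _ _) * (rotMatrix θ)ᵀ =
    Real.cos (phase θ s) • normFactor n • pairMatrix (firstPlane (pairOf s))
      (secondPlane (pairOf s)) (block s 0) + Real.sin (phase θ s) • normFactor n •
      pairMatrix (firstPlane (pairOf s)) (secondPlane (pairOf s)) (block s 1)
  rw [Matrix.mul_smul, Matrix.smul_mul, rotMatrix_mul_pairMatrix_mul, rot_mul_block_zero,
    pairMatrix_add, pairMatrix_smul, pairMatrix_smul]
  module

lemma isoRot_frameVec_one (θ : Fin n → ℝ) (s : Pairs n ⊕ Pairs n) :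
    isoRot θ (frameVec (s, 1)) =
      (-Real.sin (phase θ s)) • frameVec (s, 0) + Real.cos (phase θ s) • frameVec (s, 1) := by
  refine Subtype.ext (Subtype.ext ?_)
  rw [coe_isoRot]
  change rotMatrix θ * (normFactor n • pairMatrix _ _ _) * (rotMatrix θ)ᵀ =
    (-Real.sin (phase θ s)) • normFactor n • pairMatrix (firstPlane (pairOf s))
      (secondPlane (pairOf s)) (block s 0) + Real.cos (phase θ s) • normFactor n •
      pairMatrix (firstPlane (pairOf s)) (secondPlane (pairOf s)) (block s 1)
  rw [Matrix.mul_smul, Matrix.smul_mul, rotMatrix_mul_pairMatrix_mul, rot_mul_block_one,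
    pairMatrix_add, pairMatrix_smul, pairMatrix_smul]
  module

lemma isoRot_frameVec_of_sin_eq_zero {θ : Fin n → ℝ} {s : Pairs n ⊕ Pairs n}
    (h : Real.sin (phase θ s) = 0) (r : Fin 2) :
    isoRot θ (frameVec (s, r)) = Real.cos (phase θ s) • frameVec (s, r) := by
  fin_cases r
  · simpa [h] using isoRot_frameVec_zero θ s
  · simpa [h] using isoRot_frameVec_one θ s

lemma hom_ext_frameVec (hn : 2 ≤ n) {V : Type*} [AddCommGroup V] [Module ℝ V]
    {f g : (decomposition n).p →ₗ[ℝ] V} (h : ∀ α, f (frameVec α) = g (frameVec α)) : f = g := by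
  refine LinearMap.ext fun X => ?_
  rw [← frameVec_expand hn X, map_sum, map_sum]
  simp only [map_smul, h]

/-- The torus separates the isotropy summands. -/
lemma exists_phase_separating {s t : Pairs n ⊕ Pairs n} (h : s ≠ t) :
    ∃ θ : Fin n → ℝ, (∀ u, Real.sin (phase θ u) = 0) ∧
      Real.cos (phase θ s) ≠ Real.cos (phase θ t) := by
  by_cases hst : pairOf s = pairOf t
  -- The simultaneous quarter turn has phase `0` on the first summand of a pair and `π` on the
  -- second.
  · refine ⟨fun _ => Real.pi / 2, ?_, ?_⟩
    · rintro (u | u) <;> simp [phase]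
    · rcases s with s | s <;> rcases t with t | t
      · exact absurd (congrArg Sum.inl hst) h
      · simp only [phase, Sum.elim_inl, Sum.elim_inr, sub_self, add_halves, Real.cos_zero,
          Real.cos_pi]
        norm_num
      · simp only [phase, Sum.elim_inl, Sum.elim_inr, sub_self, add_halves, Real.cos_zero,
          Real.cos_pi]
        norm_num
      · exact absurd (congrArg Sum.inr hst) h
  -- A plane `k` in just one of the two pairs separates them: the half turn in that plane alone acts
  -- by `-1` exactly on the summands whose pair contains `k`.
  · have hk : ∃ k, ¬(k ∈ (pairOf s).1 ↔ k ∈ (pairOf t).1) := by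
      by_contra! hk
      exact hst (Subtype.ext (Finset.ext hk))
    obtain ⟨k, hk⟩ := hk
    have hne := fun u : Pairs n => firstPlane_ne u
    have hmem : ∀ u : Pairs n, k ∈ u.1 ↔ k = firstPlane u ∨ k = secondPlane u := by
      intro u
      conv_lhs => rw [planes_eq u]
      simp
    have hph : ∀ u, Real.sin (phase (fun i => if k = i then Real.pi else 0) u) = 0 ∧
        Real.cos (phase (fun i => if k = i then Real.pi else 0) u) =
          if k ∈ (pairOf u).1 then -1 else 1 := by
      rintro (u | u) <;> simp only [phase, pairOf, Sum.elim_inl, Sum.elim_inr, id, hmem] <;>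
        have hu := hne u <;> by_cases h1 : k = firstPlane u <;> by_cases h2 : k = secondPlane u
      · exact absurd (h1.symm.trans h2) hu
      all_goals first
        | exact absurd (h1.symm.trans h2) hu
        | simp [h1, h2, hu, hu.symm]
    refine ⟨_, fun u => (hph u).1, ?_⟩
    rw [(hph s).2, (hph t).2]
    split_ifs with h1 h2 h2
    · exact absurd (iff_of_true h1 h2) hk
    · norm_num
    · norm_num
    · exact absurd (iff_of_false h1 h2) hk

lemma exists_phase_pi_div_two (s : Pairs n ⊕ Pairs n) :
    ∃ θ : Fin n → ℝ, phase θ s = Real.pi / 2 := by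
  refine ⟨fun i => if i = firstPlane (pairOf s) then Real.pi / 2 else 0, ?_⟩
  rcases s with s | s <;> simp [phase, pairOf, (firstPlane_ne s).symm]

lemma gB_frameVec_isoRot (hn : 2 ≤ n) {θ : Fin n → ℝ} (hθ : ∀ u, Real.sin (phase θ u) = 0)
    (β : (Pairs n ⊕ Pairs n) × Fin 2) (X : (decomposition n).p) :
    gB n (frameVec β) (isoRot θ X) = Real.cos (phase θ β.1) * gB n (frameVec β) X := by
  have h : gB n (frameVec β) ∘ₗ isoRot θ = Real.cos (phase θ β.1) • gB n (frameVec β) := by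
    refine hom_ext_frameVec hn fun δ => ?_
    rw [LinearMap.comp_apply, isoRot_frameVec_of_sin_eq_zero (hθ _), map_smul,
      LinearMap.smul_apply, frameVec_ortho hn]
    split_ifs with h7
    · rw [h7]
    · simp
  exact LinearMap.congr_fun h X

lemma gB_frameVec_apply_eq_zero (hn : 2 ≤ n) {A : Module.End ℝ (decomposition n).p}
    (hA : A ∈ invSym n) {α β : (Pairs n ⊕ Pairs n) × Fin 2} (h : α.1 ≠ β.1) :
    gB n (frameVec β) (A (frameVec α)) = 0 := by
  obtain ⟨θ, h1, h2⟩ := exists_phase_separating h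
  have h3 : isoRot θ (A (frameVec α)) = Real.cos (phase θ α.1) • A (frameVec α) := by
    have h4 := LinearMap.congr_fun (hA.2 _ (isoRot_mem θ)) (frameVec α)
    rw [Module.End.mul_apply, Module.End.mul_apply] at h4
    rw [h4, isoRot_frameVec_of_sin_eq_zero (h1 _), map_smul]
  have h6 := gB_frameVec_isoRot hn h1 β (A (frameVec α))
  rw [h3, map_smul, smul_eq_mul] at h6
  have h7 : (Real.cos (phase θ α.1) - Real.cos (phase θ β.1)) *
      gB n (frameVec β) (A (frameVec α)) = 0 := by linarith
  exact (mul_eq_zero.1 h7).resolve_left (sub_ne_zero.2 h2)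

/-- The eigenvalue of an invariant symmetric endomorphism on an isotropy summand. -/
def eigen (A : Module.End ℝ (decomposition n).p) (s : Pairs n ⊕ Pairs n) : ℝ :=
  gB n (frameVec (s, 0)) (A (frameVec (s, 0)))

/-- Separation by the torus makes `A` preserve each summand. There it commutes with a quarter turn,
so it is multiplication by a complex number, and symmetry removes the imaginary part. -/
lemma apply_frameVec_of_mem (hn : 2 ≤ n) {A : Module.End ℝ (decomposition n).p}
    (hA : A ∈ invSym n) (α : (Pairs n ⊕ Pairs n) × Fin 2) :
    A (frameVec α) = eigen A α.1 • frameVec α := by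
  have hexp : ∀ s r, A (frameVec (s, r)) = gB n (frameVec (s, 0)) (A (frameVec (s, r))) •
      frameVec (s, 0) + gB n (frameVec (s, 1)) (A (frameVec (s, r))) • frameVec (s, 1) := by
    intro s r
    conv_lhs => rw [← frameVec_expand hn (A (frameVec (s, r)))]
    rw [Fintype.sum_prod_type, Finset.sum_eq_single s, Fin.sum_univ_two]
    · intro t _ ht
      refine Finset.sum_eq_zero fun q _ => ?_
      rw [gB_frameVec_apply_eq_zero hn hA (α := (s, r)) (β := (t, q)) ht.symm, zero_smul]
    · simp
  obtain ⟨s, r⟩ := α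
  obtain ⟨θ, hθ⟩ := exists_phase_pi_div_two s
  have h0 : isoRot θ (frameVec (s, 0)) = frameVec (s, 1) := by
    simp [isoRot_frameVec_zero, hθ]
  have h1 : isoRot θ (frameVec (s, 1)) = -frameVec (s, 0) := by
    simp [isoRot_frameVec_one, hθ]
  have h2 := LinearMap.congr_fun (hA.2 _ (isoRot_mem θ)) (frameVec (s, 0))
  rw [Module.End.mul_apply, Module.End.mul_apply, h0] at h2
  have h3 : A (frameVec (s, 1)) = eigen A s • frameVec (s, 1) -
      gB n (frameVec (s, 1)) (A (frameVec (s, 0))) • frameVec (s, 0) := by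
    rw [← h2]
    conv_lhs => rw [hexp s 0]
    rw [map_add, map_smul, map_smul, h0, h1, eigen]
    module
  have h4 : gB n (frameVec (s, 1)) (A (frameVec (s, 0))) =
      gB n (frameVec (s, 0)) (A (frameVec (s, 1))) := by
    rw [(decomposition n).standardMetric_comm, hA.1]
  have h5 : gB n (frameVec (s, 1)) (A (frameVec (s, 0))) = 0 := by
    have h6 := congrArg (gB n (frameVec (s, 0))) h3
    rw [map_sub, map_smul, map_smul, frameVec_ortho hn, frameVec_ortho hn, ← h4] at h6
    simp at h6
    linarith
  fin_cases r
  · simpa [h5, eigen] using hexp s 0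
  · simpa [h5] using h3

/-- The endomorphism that acts on each isotropy summand by a scalar. -/
def diagEnd (a : Pairs n ⊕ Pairs n → ℝ) : Module.End ℝ (decomposition n).p :=
  ∑ α : (Pairs n ⊕ Pairs n) × Fin 2, a α.1 • (gB n (frameVec α)).smulRight (frameVec α)

lemma diagEnd_frameVec (hn : 2 ≤ n) (a : Pairs n ⊕ Pairs n → ℝ)
    (α : (Pairs n ⊕ Pairs n) × Fin 2) : diagEnd a (frameVec α) = a α.1 • frameVec α := by
  rw [diagEnd, LinearMap.sum_apply, Finset.sum_eq_single α]
  · simp [frameVec_ortho hn]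
  · intro β _ hβ
    simp [frameVec_ortho hn, hβ]
  · simp

lemma diagEnd_mem (hn : 2 ≤ n) (a : Pairs n ⊕ Pairs n → ℝ) : diagEnd a ∈ invSym n := by
  constructor
  · intro X Y
    have h : gB n ∘ₗ diagEnd a = (gB n).compl₂ (diagEnd a) := by
      refine hom_ext_frameVec hn fun α => hom_ext_frameVec hn fun β => ?_
      rw [LinearMap.comp_apply, LinearMap.compl₂_apply, diagEnd_frameVec hn, diagEnd_frameVec hn,
        map_smul, map_smul, LinearMap.smul_apply, frameVec_ortho hn]
      split_ifs with h
      · rw [h]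
      · simp
    exact LinearMap.congr_fun (LinearMap.congr_fun h X) Y
  · intro γ hγ
    obtain ⟨θ, rfl⟩ := exists_isoRot hγ
    refine hom_ext_frameVec hn fun α => ?_
    rw [Module.End.mul_apply, Module.End.mul_apply, diagEnd_frameVec hn, map_smul]
    obtain ⟨s, r⟩ := α
    fin_cases r
    · simp only [Fin.zero_eta, isoRot_frameVec_zero, map_add, map_smul, diagEnd_frameVec hn]
      module
    · simp only [Fin.mk_one, isoRot_frameVec_one, map_add, map_smul, diagEnd_frameVec hn]
      module

lemma eigen_diagEnd (hn : 2 ≤ n) (a : Pairs n ⊕ Pairs n → ℝ) : eigen (diagEnd a) = a := by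
  funext s
  rw [eigen, diagEnd_frameVec hn, map_smul, frameVec_ortho hn]
  simp

lemma diagEnd_eigen (hn : 2 ≤ n) {A : Module.End ℝ (decomposition n).p} (hA : A ∈ invSym n) :
    diagEnd (eigen A) = A :=
  hom_ext_frameVec hn fun α => by rw [diagEnd_frameVec hn, apply_frameVec_of_mem hn hA]

lemma trace_diagEnd (hn : 2 ≤ n) (a : Pairs n ⊕ Pairs n → ℝ) :
    LinearMap.trace ℝ _ (diagEnd a) = 2 * ∑ s, a s := by
  rw [diagEnd, map_sum, Fintype.sum_prod_type, Finset.mul_sum]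
  refine Finset.sum_congr rfl fun s _ => ?_
  simp only [map_smul, LinearMap.trace_smulRight, frameVec_ortho hn]
  simp

lemma diagEnd_mul (hn : 2 ≤ n) (a b : Pairs n ⊕ Pairs n → ℝ) :
    diagEnd a * diagEnd b = diagEnd (a * b) :=
  hom_ext_frameVec hn fun α => by
    rw [Module.End.mul_apply, diagEnd_frameVec hn, map_smul, diagEnd_frameVec hn,
      diagEnd_frameVec hn, smul_smul, mul_comm]
    rfl

/-- This links the frame to the intrinsic description of the summands. Frame coordinates at other
labels vanish: for another pair by the support condition, and for the same pair because the
simultaneous quarter turn acts with opposite signs. -/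
lemma diagEnd_apply_of_mem_summand (hn : 2 ≤ n) (a : Pairs n ⊕ Pairs n → ℝ)
    {s : Pairs n ⊕ Pairs n} {X : (decomposition n).p} (hX : X ∈ summand s) :
    diagEnd a X = a s • X := by
  have h0 : ∀ α : (Pairs n ⊕ Pairs n) × Fin 2, α.1 ≠ s → gB n (frameVec α) X = 0 := by
    intro α hα
    by_cases h : pairOf α.1 = pairOf s
    · have h1 : isoRot (fun _ => Real.pi / 2) X =
          s.elim (fun _ => (1 : ℝ)) (fun _ => -1) • X := by
        refine Subtype.ext (Subtype.ext ?_)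
        rw [coe_isoRot, hX.2, Matrix.smul_mul, Matrix.mul_assoc, rotMatrix_transpose,
          ← rotMatrix_add, add_neg_cancel, rotMatrix_zero, Matrix.mul_one]
        rfl
      have h2 := gB_frameVec_isoRot hn (θ := fun _ => Real.pi / 2)
        (by rintro (u | u) <;> simp [phase]) α X
      rw [h1, map_smul, smul_eq_mul] at h2
      obtain ⟨t, r⟩ := α
      rcases s with s | s <;> rcases t with t | t
      · exact absurd (congrArg Sum.inl h) hα
      · simp only [phase, Sum.elim_inl, Sum.elim_inr, add_halves, Real.cos_pi] at h2
        linarith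
      · simp only [phase, Sum.elim_inl, Sum.elim_inr, sub_self, Real.cos_zero] at h2
        linarith
      · exact absurd (congrArg Sum.inr h) hα
    · rw [gB_frameVec, Finset.sum_eq_zero, mul_zero]
      intro a _
      refine Finset.sum_eq_zero fun b _ => ?_
      rw [hX.1, mul_zero]
      rw [← planes_eq]
      intro h1
      refine h (Subtype.ext (h1.trans ?_))
      rcases s with s | s <;> rfl
  conv_lhs => rw [← frameVec_expand hn X]
  conv_rhs => rw [← frameVec_expand hn X]
  rw [map_sum, Finset.smul_sum]
  refine Finset.sum_congr rfl fun α _ => ?_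
  rw [map_smul, diagEnd_frameVec hn]
  by_cases h : α.1 = s
  · rw [h, smul_comm]
  · rw [h0 α h, zero_smul, zero_smul, smul_zero]

end SO2nFlag
end

/-! ### The Lichnerowicz operator, the Hessian and the stability type. -/

noncomputable section

namespace SO2nFlag

open Matrix ReductiveDecomposition Polynomial

attribute [local instance] LieRing.ofAssociativeRing

variable {n : ℕ}

lemma eigen_add (A B : Module.End ℝ (decomposition n).p) : eigen (A + B) = eigen A + eigen B := by
  funext s
  simp [eigen]

lemma eigen_smul (c : ℝ) (A : Module.End ℝ (decomposition n).p) : eigen (c • A) = c • eigen A := by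
  funext s
  simp [eigen]

lemma sqrt_two_mul_inv : √2 * (1 / √2) = (1 : ℝ) := by
  rw [mul_one_div, div_self (by positivity)]

/-- The coordinates of `Sym(𝔭)^K` given by the normalized projections onto the isotropy
summands. -/
def coordEquiv (hn : 2 ≤ n) : invSym n ≃ₗ[ℝ] (Pairs n ⊕ Pairs n → ℝ) where
  toFun A := √2 • eigen A.1
  map_add' A B := by
    rw [Submodule.coe_add, eigen_add, smul_add]
  map_smul' c A := by
    rw [Submodule.coe_smul, eigen_smul, smul_comm, RingHom.id_apply]
  invFun y := ⟨diagEnd ((1 / √2 : ℝ) • y), diagEnd_mem hn _⟩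
  left_inv A := Subtype.ext <| by
    change diagEnd ((1 / √2 : ℝ) • √2 • eigen A.1) = A.1
    rw [smul_smul, mul_comm, sqrt_two_mul_inv, one_smul, diagEnd_eigen hn A.2]
  right_inv y := by
    change √2 • eigen (diagEnd ((1 / √2 : ℝ) • y)) = y
    rw [eigen_diagEnd hn, smul_smul, sqrt_two_mul_inv, one_smul]

/-- The basis of normalized projections onto the isotropy summands. -/
def projBasis (hn : 2 ≤ n) : Module.Basis (Pairs n ⊕ Pairs n) ℝ (invSym n) :=
  Module.Basis.ofEquivFun (coordEquiv hn)

lemma coe_projBasis (hn : 2 ≤ n) (s : Pairs n ⊕ Pairs n) :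
    (projBasis hn s).1 = diagEnd ((1 / √2 : ℝ) • Pi.single s 1) := by
  rw [projBasis, Module.Basis.coe_ofEquivFun]
  rfl

lemma projBasis_repr (hn : 2 ≤ n) (A : invSym n) :
    ⇑((projBasis hn).repr A) = √2 • eigen A.1 := by
  rw [← Module.Basis.equivFun_apply, projBasis, Module.Basis.equivFun_ofEquivFun]
  rfl

lemma projBasis_apply_of_mem_summand (hn : 2 ≤ n) (s r : Pairs n ⊕ Pairs n)
    {X : (decomposition n).p} (hX : X ∈ summand r) :
    (projBasis hn s).1 X = if s = r then (1 / √2 : ℝ) • X else 0 := by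
  rw [coe_projBasis, diagEnd_apply_of_mem_summand hn _ hX, Pi.smul_apply, Pi.single_apply]
  by_cases h : s = r
  · simp [h]
  · simp [h, Ne.symm h]

lemma trace_projBasis_mul (hn : 2 ≤ n) (s r : Pairs n ⊕ Pairs n) :
    LinearMap.trace ℝ _ ((projBasis hn s).1 * (projBasis hn r).1) = if s = r then 1 else 0 := by
  rw [coe_projBasis, coe_projBasis, diagEnd_mul hn, trace_diagEnd hn]
  have h2 : (√2)⁻¹ * (√2)⁻¹ = (1 / 2 : ℝ) := by
    rw [← mul_inv, Real.mul_self_sqrt (by norm_num), one_div]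
  by_cases h : s = r
  · subst h
    rw [Finset.sum_eq_single s]
    · simp [h2]
    · intro t _ ht
      simp [ht]
    · simp
  · rw [if_neg h, Finset.sum_eq_zero, mul_zero]
    intro t _
    by_cases ht : t = s
    · subst ht
      simp [h]
    · simp [ht]

/-- The operator on `Sym(𝔭)^K` induced by the Lichnerowicz Laplacian. -/
def lichOp (hn : 2 ≤ n) : Module.End ℝ (invSym n) :=
  Matrix.toLin (projBasis hn) (projBasis hn) (lichMatrix n)

lemma toMatrix_lichOp (hn : 2 ≤ n) :
    LinearMap.toMatrix (projBasis hn) (projBasis hn) (lichOp hn) = lichMatrix n :=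
  LinearMap.toMatrix_toLin _ _ _

lemma eigen_lichOp (hn : 2 ≤ n) (A : invSym n) :
    eigen (lichOp hn A).1 = lichMatrix n *ᵥ eigen A.1 := by
  have h := LinearMap.toMatrix_mulVec_repr (projBasis hn) (projBasis hn) (lichOp hn) A
  rw [toMatrix_lichOp, projBasis_repr, projBasis_repr, Matrix.mulVec_smul] at h
  exact (smul_right_injective _ (by positivity : (√2 : ℝ) ≠ 0) h).symm

lemma charpoly_lichOp (hn : 3 ≤ n) : (lichOp (by omega : 2 ≤ n)).charpoly =
    X * (X - C ((n : ℝ) / (2 * ((n : ℝ) - 1)))) ^ (n - 1) * (X - C 1) ^ (n * (n - 3) / 2) *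
      (X - C (((n : ℝ) - 2) / ((n : ℝ) - 1))) ^ (n * (n - 1) / 2) := by
  rw [← charpoly_lichMatrix hn, ← toMatrix_lichOp (by omega), LinearMap.charpoly_toMatrix]

lemma frame_e_apply (hn : 2 ≤ n) {A : Module.End ℝ (decomposition n).p} (hA : A ∈ invSym n)
    (α : (Pairs n ⊕ Pairs n) × Fin 2) : A ((frame hn).e α) = eigen A α.1 • (frame hn).e α :=
  apply_frameVec_of_mem hn hA α

lemma lichnerowicz_eq_lichOp (hn : 2 ≤ n) (A : invSym n) (X Y : (decomposition n).p) :
    (decomposition n).lichnerowicz (gB n) ((decomposition n).tensorOf (gB n) A.1) X Y =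
      gB n ((lichOp hn A).1 X) Y := by
  refine (frame hn).lichnerowicz_tensorOf A.1 (eigen A.1) (frame_e_apply hn A.2) (lichOp hn A).1
    (fun α => ?_) X Y
  rw [frame_lich, ← eigen_lichOp]
  exact frame_e_apply hn (lichOp hn A).2 α

lemma isEinstein_gB (hn : 2 ≤ n) :
    (decomposition n).IsEinstein (gB n) ((n : ℝ) / (4 * ((n : ℝ) - 1))) := by
  intro X Y
  have h2 : (2 : ℝ) ≤ n := by exact_mod_cast hn
  have h4 : (n : ℝ) - 1 ≠ 0 := by linarith
  rw [(frame hn).ricci_standardMetric]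
  congr 1
  change ((n : ℝ) - 2) / ((n : ℝ) - 1) / 4 + 1 / (2 * ((n : ℝ) - 1)) = _
  field_simp
  ring

lemma mem_ttInv (hn : 2 ≤ n) {A : Module.End ℝ (decomposition n).p} :
    A ∈ (decomposition n).ttInv (gB n) (isotropySet n) ↔ A ∈ invSym n ∧ ∑ s, eigen A s = 0 := by
  have htr : A ∈ invSym n → LinearMap.trace ℝ _ A = 2 * ∑ s, eigen A s := fun hA => by
    rw [← trace_diagEnd hn, diagEnd_eigen hn hA]
  constructor
  · rintro ⟨hA, h, -⟩
    refine ⟨hA, ?_⟩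
    have := htr hA
    linarith
  · rintro ⟨hA, h⟩
    refine ⟨hA, by rw [htr hA, h, mul_zero], fun Y => ?_⟩
    exact (frame hn).divergence_tensorOf A (eigen A) (frame_e_apply hn hA) Y

lemma isCritical_gB (hn : 2 ≤ n) : (decomposition n).IsCritical (gB n) (isotropySet n) := by
  intro A hA
  obtain ⟨h1, h2⟩ := (mem_ttInv hn).1 hA
  exact (frame hn).hasDerivAt_scalExp A (eigen A) (frame_e_apply hn h1) h2

lemma hess_gB (hn : 2 ≤ n) {A B : Module.End ℝ (decomposition n).p} (hA : A ∈ invSym n)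
    (hB : B ∈ invSym n) : (decomposition n).hess (gB n) A B =
      ∑ s, ((n : ℝ) / (2 * ((n : ℝ) - 1)) * eigen A s - (lichMatrix n *ᵥ eigen A) s) *
        eigen B s := by
  have h2 : (2 : ℝ) ≤ n := by exact_mod_cast hn
  have h4 : (n : ℝ) - 1 ≠ 0 := by linarith
  rw [(frame hn).hess_eq A B _ _ (frame_e_apply hn hA) (frame_e_apply hn hB)]
  refine Finset.sum_congr rfl fun s _ => ?_
  rw [frame_lich]
  congr 3
  change ((n : ℝ) - 2) / ((n : ℝ) - 1) / 2 + 2 * (1 / (2 * ((n : ℝ) - 1))) = _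
  field_simp
  ring

/-- Every column sum vanishes, since each pair has `2(n-2)` neighbours and is counted in two blocks.
Thus `L` has traceless image, and an eigenvector with nonzero eigenvalue is automatically traceless.
-/
lemma sum_lichMatrix_mulVec (hn : 2 ≤ n) (a : Pairs n ⊕ Pairs n → ℝ) :
    ∑ s, (lichMatrix n *ᵥ a) s = 0 := by
  have h2 : (2 : ℝ) ≤ n := by exact_mod_cast hn
  simp only [Matrix.mulVec, dotProduct]
  rw [Finset.sum_comm]
  refine Finset.sum_eq_zero fun t _ => ?_
  rw [← Finset.sum_mul]
  have h1 : ∑ s, lichMatrix n s t = 0 := by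
    simp only [lichMatrix_apply, ← Finset.mul_sum, Finset.sum_sub_distrib]
    have h3 : ∑ s, (johnsonGraph n 2 1).adjMatrix ℝ (pairOf s) (pairOf t) =
        4 * ((n : ℝ) - 2) := by
      rw [Fintype.sum_sum_type]
      simp only [pairOf, Sum.elim_inl, Sum.elim_inr, id]
      rw [sum_adjMatrix_johnson]
      ring
    change _ * (_ - ∑ s, (johnsonGraph n 2 1).adjMatrix ℝ (pairOf s) (pairOf t)) = _
    rw [h3]
    simp
  rw [h1, zero_mul]

lemma eigen_injOn (hn : 2 ≤ n) {A B : Module.End ℝ (decomposition n).p} (hA : A ∈ invSym n)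
    (hB : B ∈ invSym n) (h : eigen A = eigen B) : A = B := by
  rw [← diagEnd_eigen hn hA, ← diagEnd_eigen hn hB, h]

/-- The eigenspaces of the Lichnerowicz operator as spaces of endomorphisms of `𝔭`. -/
def lichEigenspace (hn : 2 ≤ n) (μ : ℝ) : Submodule ℝ (Module.End ℝ (decomposition n).p) :=
  ((lichOp hn).eigenspace μ).map (invSym n).subtype

lemma mem_lichEigenspace (hn : 2 ≤ n) {μ : ℝ} {A : Module.End ℝ (decomposition n).p} :
    A ∈ lichEigenspace hn μ ↔ A ∈ invSym n ∧ lichMatrix n *ᵥ eigen A = μ • eigen A := by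
  constructor
  · rintro ⟨A, hA, rfl⟩
    refine ⟨A.2, ?_⟩
    have h := Module.End.mem_eigenspace_iff.1 hA
    change lichMatrix n *ᵥ eigen A.1 = μ • eigen A.1
    rw [← eigen_lichOp hn, h, Submodule.coe_smul, eigen_smul]
  · rintro ⟨hA, h⟩
    refine ⟨⟨A, hA⟩, Module.End.mem_eigenspace_iff.2 (Subtype.ext ?_), rfl⟩
    refine eigen_injOn hn (lichOp hn _).2 (μ • (⟨A, hA⟩ : invSym n)).2 ?_
    rw [eigen_lichOp hn, Submodule.coe_smul, eigen_smul, h]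

lemma lichEigenspace_le_ttInv (hn : 2 ≤ n) {μ : ℝ} (hμ : μ ≠ 0) :
    lichEigenspace hn μ ≤ (decomposition n).ttInv (gB n) (isotropySet n) := by
  intro A hA
  obtain ⟨h1, h2⟩ := (mem_lichEigenspace hn).1 hA
  refine (mem_ttInv hn).2 ⟨h1, ?_⟩
  have h3 := sum_lichMatrix_mulVec hn (eigen A)
  rw [h2] at h3
  simp only [Pi.smul_apply, smul_eq_mul, ← Finset.mul_sum] at h3
  exact (mul_eq_zero.1 h3).resolve_left hμ

lemma finrank_lichEigenspace (hn : 3 ≤ n) (μ : ℝ) :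
    Module.finrank ℝ (lichEigenspace (by omega : 2 ≤ n) μ) =
      (if μ = 0 then 1 else 0) + (if μ = (n : ℝ) / (2 * ((n : ℝ) - 1)) then n - 1 else 0) +
        (if μ = 1 then n * (n - 3) / 2 else 0) +
        (if μ = ((n : ℝ) - 2) / ((n : ℝ) - 1) then n * (n - 1) / 2 else 0) := by
  have h1 : Module.finrank ℝ (lichEigenspace (by omega : 2 ≤ n) μ) =
      Module.finrank ℝ ((lichOp (by omega : 2 ≤ n)).eigenspace μ) :=
    Submodule.finrank_map_subtype_eq _ _
  rw [h1, finrank_eigenspace_eq_rootMultiplicity (projBasis (by omega)), charpoly_lichOp hn]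
  · rw [← Polynomial.count_roots, Polynomial.roots_mul, Polynomial.roots_mul, Polynomial.roots_mul]
    · simp only [Polynomial.roots_pow, Polynomial.roots_X_sub_C, Polynomial.roots_X,
        Multiset.count_add, Multiset.count_nsmul, Multiset.count_singleton]
      simp only [mul_ite, mul_one, mul_zero]
    · exact mul_ne_zero X_ne_zero (pow_ne_zero _ (X_sub_C_ne_zero _))
    · exact mul_ne_zero (mul_ne_zero X_ne_zero (pow_ne_zero _ (X_sub_C_ne_zero _)))
        (pow_ne_zero _ (X_sub_C_ne_zero _))
    · exact mul_ne_zero (mul_ne_zero (mul_ne_zero X_ne_zero (pow_ne_zero _ (X_sub_C_ne_zero _)))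
        (pow_ne_zero _ (X_sub_C_ne_zero _))) (pow_ne_zero _ (X_sub_C_ne_zero _))
  · intro s t
    rw [toMatrix_lichOp, lichMatrix_comm]

lemma mem_spectrum_lichOp (hn : 3 ≤ n) (μ : ℝ) :
    μ ∈ spectrum ℝ (lichOp (by omega : 2 ≤ n)) ↔ μ = 0 ∨ μ = (n : ℝ) / (2 * ((n : ℝ) - 1)) ∨
      (μ = 1 ∧ n * (n - 3) / 2 ≠ 0) ∨ μ = ((n : ℝ) - 2) / ((n : ℝ) - 1) := by
  have h1 : n * (n - 1) / 2 ≠ 0 := by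
    have : 3 * 2 ≤ n * (n - 1) := Nat.mul_le_mul hn (by omega)
    omega
  have h2 : n - 1 ≠ 0 := by omega
  rw [← Module.End.hasEigenvalue_iff_mem_spectrum, Module.End.hasEigenvalue_iff_isRoot_charpoly,
    charpoly_lichOp hn]
  simp only [Polynomial.IsRoot, Polynomial.eval_mul, Polynomial.eval_pow, Polynomial.eval_sub,
    Polynomial.eval_X, Polynomial.eval_C, mul_eq_zero, pow_eq_zero_iff', sub_eq_zero]
  tauto

lemma hessKer_gB (hn : 2 ≤ n) : (decomposition n).hessKer (gB n) (isotropySet n) =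
    lichEigenspace hn ((n : ℝ) / (2 * ((n : ℝ) - 1))) := by
  have h2 : (2 : ℝ) ≤ n := by exact_mod_cast hn
  ext A
  constructor
  · rintro ⟨hA, h⟩
    obtain ⟨h3, h4⟩ := (mem_ttInv hn).1 hA
    refine (mem_lichEigenspace hn).2 ⟨h3, ?_⟩
    -- The test direction is `(2ρ - L)A` itself. It is traceless, hence admissible, and the Hessian
    -- then returns its squared norm.
    set c := fun s => (n : ℝ) / (2 * ((n : ℝ) - 1)) * eigen A s - (lichMatrix n *ᵥ eigen A) s
      with hc
    have h5 : ∑ s, c s = 0 := by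
      rw [Finset.sum_sub_distrib, sum_lichMatrix_mulVec hn, ← Finset.mul_sum, h4]
      simp
    have h6 := h (diagEnd c) ((mem_ttInv hn).2 ⟨diagEnd_mem hn c, by rwa [eigen_diagEnd hn]⟩)
    rw [hess_gB hn h3 (diagEnd_mem hn c), eigen_diagEnd hn,
      Finset.sum_eq_zero_iff_of_nonneg fun s _ => mul_self_nonneg (c s)] at h6
    funext s
    have h7 := mul_self_eq_zero.1 (h6 s (Finset.mem_univ s))
    rw [Pi.smul_apply, smul_eq_mul]
    exact (sub_eq_zero.1 h7).symm
  · intro hA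
    obtain ⟨h3, h4⟩ := (mem_lichEigenspace hn).1 hA
    refine ⟨lichEigenspace_le_ttInv hn (div_ne_zero (by linarith) (by linarith)) hA,
      fun B hB => ?_⟩
    rw [hess_gB hn h3 hB.1, h4]
    simp

lemma hasNullity_gB (hn : 3 ≤ n) : (decomposition n).HasNullity (gB n) (isotropySet n)
    (n - 1 + if n = 4 then 6 else 0) := by
  have h2 : (3 : ℝ) ≤ n := by exact_mod_cast hn
  refine ⟨_, (hessKer_gB (by omega)).symm, ?_⟩
  have h3 : (n : ℝ) / (2 * ((n : ℝ) - 1)) ≠ 0 := div_ne_zero (by linarith) (by linarith)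
  have h4 : (n : ℝ) / (2 * ((n : ℝ) - 1)) ≠ 1 := by
    rw [Ne, div_eq_one_iff_eq (by linarith)]
    intro h
    linarith
  -- Only for `n = 4` do two eigenvalues meet at `2ρ`; the additional multiplicity is then `4 * 3 /
  -- 2 = 6`.
  have h5 : (n : ℝ) / (2 * ((n : ℝ) - 1)) = ((n : ℝ) - 2) / ((n : ℝ) - 1) ↔ n = 4 := by
    rw [div_eq_div_iff (by linarith) (by linarith)]
    constructor
    · intro h
      have h6 : ((n : ℝ) - 1) * (n - 4) = 0 := by linarith
      have h7 := (mul_eq_zero.1 h6).resolve_left (by linarith)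
      exact_mod_cast sub_eq_zero.1 h7
    · rintro rfl
      norm_num
  rw [finrank_lichEigenspace hn, if_neg h3, if_pos rfl, if_neg h4]
  simp only [h5]
  split_ifs with h
  · subst h; rfl
  · simp

lemma gDegenerate_gB (hn : 3 ≤ n) : (decomposition n).GDegenerate (gB n) (isotropySet n) := by
  obtain ⟨W, hW, hd⟩ := hasNullity_gB hn
  have h : W ≠ ⊥ := by
    rintro rfl
    rw [finrank_bot] at hd
    omega
  obtain ⟨A, hA, h0⟩ := W.ne_bot_iff.1 h
  exact ⟨A, hW ▸ hA, h0⟩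

lemma gSemistable_gB (hn : 4 ≤ n) : (decomposition n).GSemistable (gB n) (isotropySet n) := by
  intro A hA
  obtain ⟨h1, h2⟩ := (mem_ttInv (by omega)).1 hA
  rw [hess_gB (by omega) h1 h1]
  have h3 := le_dotProduct_lichMatrix_mulVec hn _ h2
  simp only [dotProduct, Finset.mul_sum] at h3
  simp only [sub_mul, Finset.sum_sub_distrib, mul_assoc]
  simp only [mul_comm (eigen A _) ((lichMatrix n *ᵥ eigen A) _)] at h3
  linarith

lemma hess_self_pos {n : ℕ} (hn : 2 ≤ n) {μ : ℝ} (hμ : μ < (n : ℝ) / (2 * ((n : ℝ) - 1)))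
    {A : Module.End ℝ (decomposition n).p} (hA : A ∈ lichEigenspace hn μ) (h0 : A ≠ 0) :
    0 < (decomposition n).hess (gB n) A A := by
  obtain ⟨h1, h2⟩ := (mem_lichEigenspace hn).1 hA
  rw [hess_gB hn h1 h1, h2]
  have h3 : eigen A ≠ 0 := fun h => h0 <| eigen_injOn hn h1 (zero_mem _) <| by
    rw [h]
    funext s
    simp [eigen]
  obtain ⟨s, hs⟩ := Function.ne_iff.1 h3
  have h4 : ∀ t, ((n : ℝ) / (2 * ((n : ℝ) - 1)) * eigen A t - (μ • eigen A) t) * eigen A t =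
      ((n : ℝ) / (2 * ((n : ℝ) - 1)) - μ) * (eigen A t * eigen A t) := by
    intro t
    rw [Pi.smul_apply, smul_eq_mul]
    ring
  simp only [h4]
  refine Finset.sum_pos' (fun t _ => mul_nonneg (by linarith) (mul_self_nonneg _))
    ⟨s, Finset.mem_univ s, mul_pos (by linarith) (mul_self_pos.2 hs)⟩

lemma finrank_ttInv_three :
    Module.finrank ℝ ((decomposition 3).ttInv (gB 3) (isotropySet 3)) ≤ 5 := by
  have h1 : Module.finrank ℝ (invSym 3) = 6 := by
    rw [Module.finrank_eq_card_basis (projBasis (n := 3) (by norm_num)), Fintype.card_sum,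
      card_pairs]
  have h2 : (decomposition 3).ttInv (gB 3) (isotropySet 3) < invSym 3 := by
    refine lt_of_le_of_ne (fun A hA => hA.1) fun h => ?_
    have h3 : diagEnd (fun _ => (1 : ℝ)) ∈ (decomposition 3).ttInv (gB 3) (isotropySet 3) := by
      rw [h]
      exact diagEnd_mem (by norm_num) _
    have h4 := ((mem_ttInv (by norm_num)).1 h3).2
    rw [eigen_diagEnd (by norm_num)] at h4
    simp only [Finset.sum_const, Finset.card_univ, Fintype.card_sum, card_pairs] at h4
    norm_num at h4
  have h3 := Submodule.finrank_lt_finrank_of_lt h2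
  omega

/-- The eigenspace for `(n-2)/(n-1) = 1/2`, below `2ρ = 3/4`, has dimension three and is positive
for the Hessian. Conversely a positive space meets the two-dimensional kernel trivially inside
TT-tensors of dimension at most five. -/
lemma hasCoindex_three : (decomposition 3).HasCoindex (gB 3) (isotropySet 3) 3 := by
  constructor
  · refine ⟨lichEigenspace (by norm_num) (1 / 2), lichEigenspace_le_ttInv _ (by norm_num), ?_,
      fun A hA h0 => hess_self_pos _ (by norm_num) hA h0⟩
    rw [finrank_lichEigenspace le_rfl]
    norm_num
  · rintro d ⟨W, hW, rfl, hpos⟩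
    obtain ⟨N, hN, hd⟩ := hasNullity_gB (n := 3) le_rfl
    norm_num at hd
    have hdisj : W ⊓ N = ⊥ := by
      rw [Submodule.eq_bot_iff]
      rintro A ⟨hA, hA'⟩
      by_contra h0
      have h1 : A ∈ (decomposition 3).hessKer (gB 3) (isotropySet 3) := hN ▸ hA'
      exact (hpos A hA h0).ne' (h1.2 A h1.1)
    have hle : W ⊔ N ≤ (decomposition 3).ttInv (gB 3) (isotropySet 3) := by
      refine sup_le hW fun A hA => ?_
      have h1 : A ∈ (decomposition 3).hessKer (gB 3) (isotropySet 3) := hN ▸ hA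
      exact h1.1
    have h2 := Submodule.finrank_mono hle
    have h3 := Submodule.finrank_sup_add_finrank_inf_eq W N
    rw [hdisj, finrank_bot] at h3
    have h4 := finrank_ttInv_three
    omega

lemma gUnstable_three : (decomposition 3).GUnstable (gB 3) (isotropySet 3) := by
  intro h
  obtain ⟨W, hW, hd, hpos⟩ := hasCoindex_three.1
  have h1 : W ≠ ⊥ := by
    rintro rfl
    rw [finrank_bot] at hd
    omega
  obtain ⟨A, hA, h0⟩ := W.ne_bot_iff.1 h1
  exact absurd (h A (hW hA)) (not_le.2 (hpos A hA h0))

end SO2nFlag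
end

open SO2nFlag ReductiveDecomposition Polynomial in
theorem mainTheorem7 (n : ℕ) (hn : 3 ≤ n) :
    -- `𝔭` is the orthogonal complement of `𝔨` for the Killing form, and `g_B` is a metric on it
    (decomposition n).p =
      (killingForm ℝ (so2n n)).orthogonal (decomposition n).k.toSubmodule ∧
    (∀ X : (decomposition n).p, X ≠ 0 → 0 < gB n X X) ∧
    -- the Einstein constant
    (decomposition n).IsEinstein (gB n) ((n : ℝ) / (4 * ((n : ℝ) - 1))) ∧
    (decomposition n).IsCritical (gB n) (isotropySet n) ∧
    -- the Lichnerowicz Laplacian as an operator on `Sym(𝔭)^K`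
    (∃ Lp : Module.End ℝ (invSym n),
      (∀ (A : invSym n) (X Y : (decomposition n).p),
        (decomposition n).lichnerowicz (gB n) ((decomposition n).tensorOf (gB n) A.1) X Y =
          gB n ((Lp A).1 X) Y) ∧
      -- its matrix in the orthonormal basis of normalized projections onto the isotropy summands
      (∃ b : Module.Basis (Pairs n ⊕ Pairs n) ℝ (invSym n),
        (∀ s r, ∀ X ∈ summand r, (b s).1 X = if s = r then (1 / √2 : ℝ) • X else 0) ∧
        (∀ s r, LinearMap.trace ℝ _ ((b s).1 * (b r).1) = if s = r then 1 else 0) ∧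
        LinearMap.toMatrix b b Lp =
          (1 / (4 * ((n : ℝ) - 1))) • ((4 * ((n : ℝ) - 2)) • 1 -
            Matrix.fromBlocks ((johnsonGraph n 2 1).adjMatrix ℝ)
              ((johnsonGraph n 2 1).adjMatrix ℝ)
              ((johnsonGraph n 2 1).adjMatrix ℝ)
              ((johnsonGraph n 2 1).adjMatrix ℝ))) ∧
      -- its spectrum, with multiplicities
      Lp.charpoly =
        X * (X - C ((n : ℝ) / (2 * ((n : ℝ) - 1)))) ^ (n - 1) *
          (X - C 1) ^ (n * (n - 3) / 2) *
          (X - C (((n : ℝ) - 2) / ((n : ℝ) - 1))) ^ (n * (n - 1) / 2) ∧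
      (4 ≤ n → spectrum ℝ Lp =
        {0, (n : ℝ) / (2 * ((n : ℝ) - 1)), ((n : ℝ) - 2) / ((n : ℝ) - 1), 1}) ∧
      (n = 3 → spectrum ℝ Lp = {0, 1 / 2, 3 / 4})) ∧
    -- the stability type
    (4 ≤ n → (decomposition n).GNeutrallyStable (gB n) (isotropySet n)) ∧
    (5 ≤ n → (decomposition n).HasNullity (gB n) (isotropySet n) (n - 1)) ∧
    (n = 4 → (decomposition n).HasNullity (gB n) (isotropySet n) 9) ∧
    (n = 3 → (decomposition n).GUnstable (gB n) (isotropySet n) ∧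
      (decomposition n).HasCoindex (gB n) (isotropySet n) 3 ∧
      (decomposition n).GDegenerate (gB n) (isotropySet n) ∧
      (decomposition n).HasNullity (gB n) (isotropySet n) 2) := by
  have h2 : 2 ≤ n := by omega
  refine ⟨p_eq_orthogonal h2, gB_pos h2, isEinstein_gB h2, isCritical_gB h2,
    ⟨lichOp h2, lichnerowicz_eq_lichOp h2,
      ⟨projBasis h2, fun s r X hX => projBasis_apply_of_mem_summand h2 s r hX,
        trace_projBasis_mul h2, toMatrix_lichOp h2⟩, charpoly_lichOp hn, fun h4 => ?_, ?_⟩,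
    fun h4 => ⟨gSemistable_gB h4, gDegenerate_gB hn⟩, fun h5 => ?_, ?_, ?_⟩
  · have h : n * (n - 3) / 2 ≠ 0 := by
      have : 4 * 1 ≤ n * (n - 3) := Nat.mul_le_mul h4 (by omega)
      omega
    ext μ
    rw [mem_spectrum_lichOp hn]
    simp only [Set.mem_insert_iff, Set.mem_singleton_iff, h, ne_eq, not_false_eq_true, and_true]
    tauto
  -- For `n = 3` the factor belonging to the eigenvalue `1` has exponent zero, so `1` is absent from
  -- the spectrum.
  · rintro rfl
    ext μ
    rw [mem_spectrum_lichOp hn]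
    norm_num
    tauto
  · have h := hasNullity_gB hn
    rwa [if_neg (by omega), add_zero] at h
  · rintro rfl
    exact hasNullity_gB hn
  · rintro rfl
    exact ⟨gUnstable_three, hasCoindex_three, gDegenerate_gB hn, hasNullity_gB hn⟩
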